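/- Let $V=\mathbb R^{4,3}$ have a basis $e_1,\dots,e_7$ (with dual basis $e^i$, $e^{ijk}=e^i\wedge e^j\wedge e^k$), let $\omega=\sqrt2(e^{167}+e^{235})-e^4\wedge(e^{15}-e^{26}-e^{37})$ and $\langle\cdot,\cdot\rangle=2(e^1\cdot e^5+e^2\cdot e^6+e^3\cdot e^7)-(e^4)^2$, where $\alpha\cdot\beta=\frac12(\alpha\otimes\beta+\beta\otimes\alpha)$, and let $\mathfrak g_2^*\subset\mathfrak{so}(4,3)$ be the Lie algebra of the stabiliser of $\omega$ in $GL(V)$. Let $\mathfrak h\subset\mathfrak g_2^*$ be a Lie subalgebra such that - $\mathfrak h$ is indecomposable: no non-degenerate subspace of $V$ other than $0$ and $V$ is $\mathfrak h$-invariant; - $\mathfrak h$ is a Berger algebra: $\mathfrak h=\mathrm{span}\{R(x,y)\mid x,y\in V,\ R\in\mathcal K(\mathfrak h)\}$, where $\mathcal K(\mathfrak h)=\{R\in\Lambda^2V^*\otimes\mathfrak h\mid R(x,y)z+R(y,z)x+R(z,x)y=0\ \forall x,y,z\in V\}$; - $\mathfrak h$ is of Type II: the socle of the $\mathfrak h$-module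 $V$ (the sum of its irreducible submodules) has dimension $2$. For $A=\begin{pmatrix}a_1&a_2\\a_3&a_4\end{pmatrix}\in\mathfrak{gl}(2,\mathbb R)$, $z\in\mathbb R^4$, $c\in\mathbb R$ put $$h(A,z,c)=\begin{pmatrix} a_1&a_2&z_2&\sqrt2z_3&z_4&0&-c\\ a_3&a_4&z_1&\sqrt2z_2&z_3&c&0\\ 0&0&a_1-a_4&-\sqrt2a_2&0&-z_4&-z_3\\ 0&0&-\sqrt2a_3&0&-\sqrt2a_2&\sqrt2z_3&\sqrt2z_2\\ 0&0&0&-\sqrt2a_3&-a_1+a_4&-z_2&-z_1\\ 0&0&0&0&0&-a_1&-a_3\\ 0&0&0&0&0&-a_2&-a_4\end{pmatrix}.$$ For a linear subspace $Z\subset\mathbb R^4$ let $\mathfrak n_Z=\{h(0,z,c)\mid z\in Z,\ c\in\mathbb R\}$; write $\mathfrak n=\mathfrak n_{\mathbb R^4}$, and $\mathfrak n(i,j,\dots)=\mathfrak n_Z$ for $Z=\{z\mid z_l=0\text{ for }l\notin\{i,j,\dots\}\}$. Identify $A\in\mathfrak{gl}(2,\mathbb R)$ with $h(A,0,0)$.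 Let $C_a=\begin{pmatrix}a&-1\\1&a\end{pmatrix}$ for $a\in\mathbb R$, $\mathfrak u(1)=\left\{\begin{pmatrix}a&-b\\b&a\end{pmatrix}\mid a,b\in\mathbb R\right\}$, and let $\mathfrak d$ be the algebra of diagonal $2\times2$ matrices. Then there is a basis $b_1,\dots,b_7$ of $V$ with $\langle\cdot,\cdot\rangle=2(b^1\cdot b^6+b^2\cdot b^7+b^3\cdot b^5)-(b^4)^2$ and $\omega=\sqrt2(-b^{157}+b^{236})-b^4\wedge(b^{16}-b^{27}-b^{35})$ such that, in this basis, $\mathfrak h\subset\mathfrak p_2=\{h(A,z,c)\}=\mathfrak{gl}(2,\mathbb R)\ltimes\mathfrak n$ and, with $\mathfrak a$ the projection of $\mathfrak h$ to $\mathfrak{gl}(2,\mathbb R)$, one of the following holds: 1. $\mathfrak a\in\{\mathfrak{sl}(2,\mathbb R),\mathfrak{gl}(2,\mathbb R)\}$ and $\mathfrak h=\mathfrak a\ltimes\mathfrak n$. 2. $\mathfrak a=\mathfrak u(1)$ or $\mathfrak a=\mathbb R\cdot C_a$ for some $a\in\mathbb R$, and $\mathfrak h=\mathfrak a\ltimes\mathfrak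 n$ or $\mathfrak h=\mathfrak a\ltimes\{h(0,(3r,s,r,3s),c)\mid r,s,c\in\mathbb R\}$. 3. $\mathfrak a=\mathfrak d$ and $\mathfrak h=\mathfrak a\ltimes\mathfrak n_1$ with $\mathfrak n_1\in\{\mathfrak n,\mathfrak n(1,3),\mathfrak n(2,3),\mathfrak n(1,2,3),\mathfrak n(1,2,4)\}$. 4. $\mathfrak a=\mathbb R\cdot\mathrm{diag}(1,\mu)$ with $\mu\in[-1,1)$, and (a) $\mathfrak h=\mathfrak a\ltimes\mathfrak n_1$ with $\mathfrak n_1\in\{\mathfrak n,\mathfrak n(2,3),\mathfrak n(1,2,3),\mathfrak n(1,2,4),\mathfrak n(1,3,4),\mathfrak n(2,3,4)\}$; or (b) $\mu=1/2$ and $\mathfrak h=\mathbb R\cdot h(\mathrm{diag}(1,1/2),(1,0,0,0),0)\ltimes\mathfrak n_1$ with $\mathfrak n_1\in\{\mathfrak n(2,3),\mathfrak n(2,3,4)\}$; or (c) $\mu=0$ and either $\mathfrak h=\mathfrak a\ltimes\mathfrak n(2,4)$ or $\mathfrak h=\mathbb R\cdot h(\mathrm{diag}(1,0),(0,1,0,0),0)\ltimes\mathfrak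 n_1$ with $\mathfrak n_1\in\{\mathfrak n(1,4),\mathfrak n(3,4),\mathfrak n(1,3,4)\}$. 5. $\mathfrak a\in\{0,\mathbb R\cdot I\}$ and $\mathfrak h=\mathfrak a\ltimes\mathfrak n_1$, where $\mathfrak n_1\in\{\mathfrak n,\mathfrak n(1,3),\mathfrak n(2,3),\mathfrak n(1,3,4),\mathfrak n(2,3,4)\}$ or $\mathfrak n_1=\mathfrak n_Z$ for one of (a) $Z=\{(z_1,0,z_1,z_4)\mid z_1,z_4\in\mathbb R\}$; (b) $Z=\{(0,z_2,z_3,-z_2)\mid z_2,z_3\in\mathbb R\}$; (c) $Z=\{(z_1,\alpha z_1,\alpha z_4,z_4)\mid z_1,z_4\in\mathbb R\}$ with $\alpha\in\left[\frac{\sqrt3-1}{\sqrt6},\frac{\sqrt3+1}{\sqrt6}\right]$; (d) $Z=\{(sz_1,\alpha z_2,-\alpha z_1,-z_2)\mid z_1,z_2\in\mathbb R\}$ with $s\in(0,1]$, $\alpha\in\mathbb R$, $3\alpha^2-(s+1)\alpha-s=0$; (e) $Z=\{(z_1,z_2,\kappa z_1,z_4)\mid z_1,z_2,z_4\in\mathbb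 R\}$ with $\kappa=\pm1$. -/

import Mathlib

attribute [local instance 100] LieRing.ofAssociativeRing

namespace SplitG2

noncomputable section

variable {V : Type*} [AddCommGroup V] [Module ℝ V]

/-- The 3-form `α ∧ β ∧ γ`, with `(α ∧ β ∧ γ)(u₀, u₁, u₂)` the determinant of the matrix of the
values of `α, β, γ` at `u₀, u₁, u₂`. -/
def wedge3 (α β γ : V →ₗ[ℝ] ℝ) : V [⋀^Fin 3]→ₗ[ℝ] ℝ :=
  (Matrix.detRowAlternating (n := Fin 3) (R := ℝ)).compLinearMap (LinearMap.pi ![α, β, γ])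

/-- The symmetric product `α · β` of two linear forms. -/
def symProd (α β : V →ₗ[ℝ] ℝ) : LinearMap.BilinForm ℝ V :=
  (1 / 2 : ℝ) •
    (LinearMap.BilinForm.linMulLin α β + LinearMap.BilinForm.linMulLin β α)

/-- `b^{ijk}` for a basis `b_1, …, b_7`; the indices run from `0` to `6` in the code. -/
def dual3 (b : Module.Basis (Fin 7) ℝ V) (i j k : Fin 7) : V [⋀^Fin 3]→ₗ[ℝ] ℝ :=
  wedge3 (b.coord i) (b.coord j) (b.coord k)

/-- `b^i · b^j` for a basis `b_1, …, b_7`; the indices run from `0` to `6` in the code. -/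
def dual2 (b : Module.Basis (Fin 7) ℝ V) (i j : Fin 7) : LinearMap.BilinForm ℝ V :=
  symProd (b.coord i) (b.coord j)

/-- `ω₀ = √2 (e^{167} + e^{235}) - e^4 ∧ (e^{15} - e^{26} - e^{37})`. -/
def omega0 (e : Module.Basis (Fin 7) ℝ V) : V [⋀^Fin 3]→ₗ[ℝ] ℝ :=
  √2 • (dual3 e 0 5 6 + dual3 e 1 2 4)
    - (dual3 e 3 0 4 - dual3 e 3 1 5 - dual3 e 3 2 6)

/-- The metric `2 (e^1·e^5 + e^2·e^6 + e^3·e^7) - (e^4)^2` of signature `(4,3)` that `ω₀` induces. -/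
def metric0 (e : Module.Basis (Fin 7) ℝ V) : LinearMap.BilinForm ℝ V :=
  (2 : ℝ) • (dual2 e 0 4 + dual2 e 1 5 + dual2 e 2 6) - dual2 e 3 3

/-- `√2 (-b^{157} + b^{236}) - b^4 ∧ (b^{16} - b^{27} - b^{35})`. -/
def omegaII (b : Module.Basis (Fin 7) ℝ V) : V [⋀^Fin 3]→ₗ[ℝ] ℝ :=
  √2 • (-dual3 b 0 4 6 + dual3 b 1 2 5)
    - (dual3 b 3 0 5 - dual3 b 3 1 6 - dual3 b 3 2 4)

/-- `2 (b^1·b^6 + b^2·b^7 + b^3·b^5) - (b^4)^2`. -/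
def metricII (b : Module.Basis (Fin 7) ℝ V) : LinearMap.BilinForm ℝ V :=
  (2 : ℝ) • (dual2 b 0 5 + dual2 b 1 6 + dual2 b 2 4) - dual2 b 3 3

theorem update_zero {W : Type*} (u v w x : W) : Function.update ![u, v, w] 0 x = ![x, v, w] := by
  ext i; fin_cases i <;> rfl

theorem update_one {W : Type*} (u v w x : W) : Function.update ![u, v, w] 1 x = ![u, x, w] := by
  ext i; fin_cases i <;> rfl

theorem update_two {W : Type*} (u v w x : W) : Function.update ![u, v, w] 2 x = ![u, v, x] := by
  ext i; fin_cases i <;> rfl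

/-- The Lie algebra of the stabiliser of a 3-form in `GL(V)`. -/
def stabilizerAlgebra (ω : V [⋀^Fin 3]→ₗ[ℝ] ℝ) : LieSubalgebra ℝ (Module.End ℝ V) where
  carrier := {X | ∀ u v w : V, ω ![X u, v, w] + ω ![u, X v, w] + ω ![u, v, X w] = 0}
  zero_mem' := by
    intro u v w
    have h0 : ω ![0, v, w] = 0 := ω.map_coord_zero (0 : Fin 3) rfl
    have h1 : ω ![u, 0, w] = 0 := ω.map_coord_zero (1 : Fin 3) rfl
    have h2 : ω ![u, v, 0] = 0 := ω.map_coord_zero (2 : Fin 3) rfl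
    simp [h0, h1, h2]
  add_mem' := by
    intro X Y hX hY u v w
    have a0 : ∀ x y : V, ω ![x + y, v, w] = ω ![x, v, w] + ω ![y, v, w] := fun x y => by
      have t := ω.map_update_add ![0, v, w] 0 x y
      simpa only [update_zero, update_one, update_two, smul_eq_mul] using t
    have a1 : ∀ x y : V, ω ![u, x + y, w] = ω ![u, x, w] + ω ![u, y, w] := fun x y => by
      have t := ω.map_update_add ![u, 0, w] 1 x y
      simpa only [update_zero, update_one, update_two, smul_eq_mul] using t
    have a2 : ∀ x y : V, ω ![u, v, x + y] = ω ![u, v, x] + ω ![u, v, y] := fun x y => by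
      have t := ω.map_update_add ![u, v, 0] 2 x y
      simpa only [update_zero, update_one, update_two, smul_eq_mul] using t
    have hx := hX u v w
    have hy := hY u v w
    simp only [LinearMap.add_apply, a0, a1, a2]
    linarith
  smul_mem' := by
    intro c X hX u v w
    have a0 : ∀ x : V, ω ![c • x, v, w] = c * ω ![x, v, w] := fun x => by
      have t := ω.map_update_smul ![0, v, w] 0 c x
      simpa only [update_zero, update_one, update_two, smul_eq_mul] using t
    have a1 : ∀ x : V, ω ![u, c • x, w] = c * ω ![u, x, w] := fun x => by
      have t := ω.map_update_smul ![u, 0, w] 1 c x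
      simpa only [update_zero, update_one, update_two, smul_eq_mul] using t
    have a2 : ∀ x : V, ω ![u, v, c • x] = c * ω ![u, v, x] := fun x => by
      have t := ω.map_update_smul ![u, v, 0] 2 c x
      simpa only [update_zero, update_one, update_two, smul_eq_mul] using t
    have hx := hX u v w
    simp only [LinearMap.smul_apply, a0, a1, a2]
    linear_combination c * hx
  lie_mem' := by
    intro X Y hX hY u v w
    have a0 : ∀ x y v w : V, ω ![x - y, v, w] = ω ![x, v, w] - ω ![y, v, w] :=
      fun x y v w => by
      have t := ω.map_update_sub ![0, v, w] 0 x y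
      simpa only [update_zero, update_one, update_two, smul_eq_mul] using t
    have a1 : ∀ x y u w : V, ω ![u, x - y, w] = ω ![u, x, w] - ω ![u, y, w] :=
      fun x y u w => by
      have t := ω.map_update_sub ![u, 0, w] 1 x y
      simpa only [update_zero, update_one, update_two, smul_eq_mul] using t
    have a2 : ∀ x y u v : V, ω ![u, v, x - y] = ω ![u, v, x] - ω ![u, v, y] :=
      fun x y u v => by
      have t := ω.map_update_sub ![u, v, 0] 2 x y
      simpa only [update_zero, update_one, update_two, smul_eq_mul] using t
    have e1 := hX (Y u) v w
    have e2 := hX u (Y v) w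
    have e3 := hX u v (Y w)
    have f1 := hY (X u) v w
    have f2 := hY u (X v) w
    have f3 := hY u v (X w)
    simp only [LieRing.of_associative_ring_bracket, LinearMap.sub_apply, Module.End.mul_apply,
      a0, a1, a2]
    linarith

/-- `𝔤₂^*` with respect to the basis `e`: the Lie algebra of the stabiliser of `ω₀`. -/
def g2star (e : Module.Basis (Fin 7) ℝ V) : LieSubalgebra ℝ (Module.End ℝ V) :=
  stabilizerAlgebra (omega0 e)

/-- `𝒦(𝔥)`: the algebraic curvature maps `R ∈ Λ²V^* ⊗ 𝔥` that satisfy the first Bianchi identity. -/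
def curvatureMaps (h : LieSubalgebra ℝ (Module.End ℝ V)) :
    Set (V →ₗ[ℝ] V →ₗ[ℝ] Module.End ℝ V) :=
  {R | (∀ x, R x x = 0) ∧ (∀ x y, R x y ∈ h) ∧
    ∀ x y z, R x y z + R y z x + R z x y = 0}

/-- Berger's first criterion: `𝔥` is spanned by the values of its curvature maps. -/
def IsBerger (h : LieSubalgebra ℝ (Module.End ℝ V)) : Prop :=
  Submodule.span ℝ {X : Module.End ℝ V | ∃ R ∈ curvatureMaps h, ∃ x y : V, X = R x y}
    = h.toSubmodule

/-- The natural representation of `𝔥` on `(V, g)` leaves invariant no proper non-zero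
non-degenerate subspace. -/
def IsIndecomposable (g : LinearMap.BilinForm ℝ V) (h : LieSubalgebra ℝ (Module.End ℝ V)) :
    Prop :=
  ∀ W : LieSubmodule ℝ h V, (g.restrict W.toSubmodule).Nondegenerate → W = ⊥ ∨ W = ⊤

/-- The socle of the natural representation of `𝔥`: the sum of all irreducible
subrepresentations, which is the maximal semisimple subrepresentation. -/
def socle (h : LieSubalgebra ℝ (Module.End ℝ V)) : LieSubmodule ℝ h V :=
  sSup {N : LieSubmodule ℝ h V | IsAtom N}

/-- `𝔥` is of Type II: its socle has dimension two. -/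
def IsTypeII (h : LieSubalgebra ℝ (Module.End ℝ V)) : Prop :=
  Module.finrank ℝ (socle h) = 2

/-- The matrix `h(A, z, c)`. -/
def hMatrix (A : Matrix (Fin 2) (Fin 2) ℝ) (z : Fin 4 → ℝ) (c : ℝ) :
    Matrix (Fin 7) (Fin 7) ℝ :=
  !![A 0 0, A 0 1, z 1, √2 * z 2, z 3, 0, -c;
     A 1 0, A 1 1, z 0, √2 * z 1, z 2, c, 0;
     0, 0, A 0 0 - A 1 1, -√2 * A 0 1, 0, -z 3, -z 2;
     0, 0, -√2 * A 1 0, 0, -√2 * A 0 1, √2 * z 2, √2 * z 1;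
     0, 0, 0, -√2 * A 1 0, -A 0 0 + A 1 1, -z 1, -z 0;
     0, 0, 0, 0, 0, -A 0 0, -A 1 0;
     0, 0, 0, 0, 0, -A 0 1, -A 1 1]

/-- The endomorphism of `V` with matrix `h(A, z, c)` in the basis `b`. -/
def hElem (b : Module.Basis (Fin 7) ℝ V) (A : Matrix (Fin 2) (Fin 2) ℝ) (z : Fin 4 → ℝ) (c : ℝ) :
    Module.End ℝ V :=
  Matrix.toLin b b (hMatrix A z c)

/-- `𝔥^{II} = 𝔤𝔩(2,ℝ) ⋉ 𝔫`, that is `𝔭₂` in the basis `b`. -/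
def p2 (b : Module.Basis (Fin 7) ℝ V) : Set (Module.End ℝ V) :=
  {X | ∃ A z c, X = hElem b A z c}

/-- The projection `𝔞` of `𝔥 ⊆ 𝔭₂` to `𝔤𝔩(2,ℝ)`. -/
def glProjection (b : Module.Basis (Fin 7) ℝ V) (h : LieSubalgebra ℝ (Module.End ℝ V)) :
    Set (Matrix (Fin 2) (Fin 2) ℝ) :=
  {A | ∃ z c, hElem b A z c ∈ h}

/-- `𝔞 ⋉ {h(0, z, c) | z ∈ Z, c ∈ ℝ}`. -/
def semi (b : Module.Basis (Fin 7) ℝ V) (a : Set (Matrix (Fin 2) (Fin 2) ℝ))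
    (Z : Set (Fin 4 → ℝ)) : Set (Module.End ℝ V) :=
  {X | ∃ A ∈ a, ∃ z ∈ Z, ∃ c : ℝ, X = hElem b A 0 0 + hElem b 0 z c}

/-- `ℝ · h(A, z₀, 0) ⋉ {h(0, z, c) | z ∈ Z, c ∈ ℝ}`. -/
def twistedSemi (b : Module.Basis (Fin 7) ℝ V) (A : Matrix (Fin 2) (Fin 2) ℝ) (z₀ : Fin 4 → ℝ)
    (Z : Set (Fin 4 → ℝ)) : Set (Module.End ℝ V) :=
  {X | ∃ t : ℝ, ∃ z ∈ Z, ∃ c : ℝ, X = t • hElem b A z₀ 0 + hElem b 0 z c}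

/-- `Z(i, j, …)`: the vectors of `ℝ⁴` whose coordinates outside `I` vanish; the indices run from
`0` to `3` in the code. -/
def Zc (I : Set (Fin 4)) : Set (Fin 4 → ℝ) := {z | ∀ l, l ∉ I → z l = 0}

/-- `𝔰𝔩(2,ℝ)`. -/
def sl2 : Set (Matrix (Fin 2) (Fin 2) ℝ) := {A | A.trace = 0}

/-- The two-dimensional algebra `𝔲(1)` of all `!![a, -b; b, a]`. -/
def u1 : Set (Matrix (Fin 2) (Fin 2) ℝ) := {A | ∃ a b : ℝ, A = !![a, -b; b, a]}

/-- The diagonal matrices `𝔡`. -/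
def diag2 : Set (Matrix (Fin 2) (Fin 2) ℝ) := {A | ∃ a d : ℝ, A = !![a, 0; 0, d]}

/-- The line `ℝ · A`. -/
def line (A : Matrix (Fin 2) (Fin 2) ℝ) : Set (Matrix (Fin 2) (Fin 2) ℝ) :=
  {B | ∃ t : ℝ, B = t • A}

/-- `C_a`. -/
def Ca (a : ℝ) : Matrix (Fin 2) (Fin 2) ℝ := !![a, -1; 1, a]

/-- The exceptional subspaces `Z ⊆ ℝ⁴`, two- and three-dimensional, for `𝔞 = 0` or `𝔞 = ℝ·I`. -/
inductive IsSpecialZ : Set (Fin 4 → ℝ) → Prop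
  | a : IsSpecialZ {z | ∃ z₁ z₄ : ℝ, z = ![z₁, 0, z₁, z₄]}
  | b : IsSpecialZ {z | ∃ z₂ z₃ : ℝ, z = ![0, z₂, z₃, -z₂]}
  | c (α : ℝ) (hα : α ∈ Set.Icc ((√3 - 1) / √6) ((√3 + 1) / √6)) :
      IsSpecialZ {z | ∃ z₁ z₄ : ℝ, z = ![z₁, α * z₁, α * z₄, z₄]}
  | d (s α : ℝ) (hs : s ∈ Set.Ioc (0 : ℝ) 1) (hα : 3 * α ^ 2 - (s + 1) * α - s = 0) :
      IsSpecialZ {z | ∃ z₁ z₂ : ℝ, z = ![s * z₁, α * z₂, -α * z₁, -z₂]}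
  | e (κ : ℝ) (hκ : κ = 1 ∨ κ = -1) :
      IsSpecialZ {z | ∃ z₁ z₂ z₄ : ℝ, z = ![z₁, z₂, κ * z₁, z₄]}

/-- The list: `𝔥`, whose projection to `𝔤𝔩(2,ℝ)` is `𝔞`, is one of the algebras of the
classification in the basis `b`. -/
inductive InList (b : Module.Basis (Fin 7) ℝ V) (a : Set (Matrix (Fin 2) (Fin 2) ℝ))
    (h : Set (Module.End ℝ V)) : Prop
  | case1 (ha : a = sl2 ∨ a = Set.univ) (hh : h = semi b a Set.univ)
  | case2 (ha : a = u1 ∨ ∃ r : ℝ, a = line (Ca r))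
      (hh : h = semi b a Set.univ ∨
        h = semi b a {z | ∃ r s : ℝ, z = ![3 * r, s, r, 3 * s]})
  | case3 (ha : a = diag2)
      (hh : ∃ Z ∈ ({Set.univ, Zc {0, 2}, Zc {1, 2}, Zc {0, 1, 2}, Zc {0, 1, 3}} :
        Set (Set (Fin 4 → ℝ))), h = semi b a Z)
  | case4a (μ : ℝ) (hμ : μ ∈ Set.Ico (-1 : ℝ) 1) (ha : a = line !![1, 0; 0, μ])
      (hh : ∃ Z ∈ ({Set.univ, Zc {1, 2}, Zc {0, 1, 2}, Zc {0, 1, 3}, Zc {0, 2, 3},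
        Zc {1, 2, 3}} : Set (Set (Fin 4 → ℝ))), h = semi b a Z)
  | case4b (ha : a = line !![1, 0; 0, 1 / 2])
      (hh : ∃ Z ∈ ({Zc {1, 2}, Zc {1, 2, 3}} : Set (Set (Fin 4 → ℝ))),
        h = twistedSemi b !![1, 0; 0, 1 / 2] ![1, 0, 0, 0] Z)
  | case4c (ha : a = line !![1, 0; 0, 0])
      (hh : h = semi b a (Zc {1, 3}) ∨
        ∃ Z ∈ ({Zc {0, 3}, Zc {2, 3}, Zc {0, 2, 3}} : Set (Set (Fin 4 → ℝ))),
          h = twistedSemi b !![1, 0; 0, 0] ![0, 1, 0, 0] Z)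
  | case5 (ha : a = {0} ∨ a = line 1)
      (hh : ∃ Z, (Z ∈ ({Set.univ, Zc {0, 2}, Zc {1, 2}, Zc {0, 2, 3}, Zc {1, 2, 3}} :
        Set (Set (Fin 4 → ℝ))) ∨ IsSpecialZ Z) ∧ h = semi b a Z)

end

end SplitG2

/-! ### Coordinates and frames. -/

namespace SplitG2

/-! The socle S is a plane. A non-degenerate metric on S would contradict indecomposability; if the
radical of S were a line, semisimplicity would give an invariant complementary line, which is not
null. So S is totally isotropic. For a basis u, v of S, the vector n dual to ω(u, v, ·) is
multiplied by the trace of 𝔥 on S. Hence n is a common eigenvector and lies in S, and this forces n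
= 0. Elements of G₂^* carry such a plane to the span of the first two basis vectors
(`exists_adapted_frame`), and 𝔥 ⊂ 𝔭₂ = 𝔤𝔩(2,ℝ) ⋉ 𝔫. Here 𝔫 is a Heisenberg algebra: modulo its
centre it is the space of binary cubics z₁y³ + 3z₂y²x + 3z₃yx² + z₄x³, up to a twist, and its
bracket is the invariant symplectic form on cubics.

Two constraints drive the classification. First, the socle is no larger than S and is semisimple:
the three-dimensional middle block contains no common eigenvector (`Good.middle_eq_zero`), and a
triangular projection can be diagonalised (`Good.exists_shear`). Secondly, by Berger's criterion a
linear form that kills all curvature values kills 𝔥 (`Good.linForm_eq_zero`). Pair symmetry puts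
both index pairs of a curvature tensor into 𝔭₂, and the Bianchi identity leaves 26 parameters,
arranged in nine rows (`Curv`). These constraints put the centre of 𝔫 into 𝔥
(`Good.center_of_diagonal`, `Good.center_of_hasRotation`), after which only the projection 𝔞 and the
part in ℝ⁴ matter.

Up to conjugation 𝔞 is triangular, hence diagonal, or contains some C_r
(`Good.triangular_or_rotation`). With C_r, the space ℝ⁴ splits into planes of weights 1 and 3. The
first must lie in 𝔥; if the second does not, 𝔞 is conformal. If 𝔞 is diagonal and not scalar, a
generator acts on the four coordinates with distinct eigenvalues, so 𝔥 ∩ 𝔫 is given by a coordinate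
subspace. The nilradical part of the generator can be conjugated away except at the resonances μ =
1/2 and μ = 0, and the two constraints leave the listed subspaces.

If 𝔞 is scalar, the subspace Z ⊂ ℝ⁴ is restricted only by the absence of a kernel in the middle
block, and such subspaces are classified under GL(2,ℝ) (`normalizable_of_noKernel`). A line always
has a kernel. A hyperplane is given by a dual cubic, which has a real root. A pencil has a Jacobian
quartic, whose real roots are the double roots of its members. With a real root the pencil reduces
to the span of (1, α, 0, 0) and (0, 0, α', 1), governed by αα', or to a degenerate form. Without one
the Jacobian is a product of two definite quadratics, and diagonalising them simultaneously gives
family (d). -/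

/-- The metric in coordinates for which the fourth basis vector has square `-2`. -/
def coordMetric (u v : Fin 7 → ℝ) : ℝ :=
  u 0 * v 5 + u 5 * v 0 + u 1 * v 6 + u 6 * v 1 + u 2 * v 4 + u 4 * v 2 - 2 * (u 3 * v 3)

/-- The minor of the matrix with rows `u, v, w` on the columns `i, j, k`. -/
def minor3 (i j k : Fin 7) (u v w : Fin 7 → ℝ) : ℝ :=
  u i * (v j * w k - v k * w j) - u j * (v i * w k - v k * w i) + u k * (v i * w j - v j * w i)

/-- The 3-form in coordinates for which the fourth basis vector has square `-2`,
divided by `√2`. -/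
def coordForm (u v w : Fin 7 → ℝ) : ℝ :=
  -minor3 0 4 6 u v w + minor3 1 2 5 u v w - minor3 3 0 5 u v w + minor3 3 1 6 u v w
    + minor3 3 2 4 u v w

/-- The matrix `h(A, z, c)` after the fourth basis vector is multiplied by `√2`. -/
def hRat (a₁ a₂ a₃ a₄ z₁ z₂ z₃ z₄ c : ℝ) : Matrix (Fin 7) (Fin 7) ℝ :=
  !![a₁, a₂, z₂, 2 * z₃, z₄, 0, -c;
     a₃, a₄, z₁, 2 * z₂, z₃, c, 0;
     0, 0, a₁ - a₄, -2 * a₂, 0, -z₄, -z₃;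
     0, 0, -a₃, 0, -a₂, z₃, z₂;
     0, 0, 0, -2 * a₃, -a₁ + a₄, -z₂, -z₁;
     0, 0, 0, 0, 0, -a₁, -a₃;
     0, 0, 0, 0, 0, -a₂, -a₄]

variable {V : Type*} [AddCommGroup V] [Module ℝ V]

/-- A linear coordinate system in which the metric and the 3-form are the standard ones. -/
structure IsFrame (e : Module.Basis (Fin 7) ℝ V) (φ : V ≃ₗ[ℝ] (Fin 7 → ℝ)) : Prop where
  metric : ∀ u v, metric0 e u v = coordMetric (φ u) (φ v)
  form : ∀ u v w, omega0 e ![u, v, w] = √2 * coordForm (φ u) (φ v) (φ w)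

theorem wedge3_apply (α β γ : V →ₗ[ℝ] ℝ) (u v w : V) :
    wedge3 α β γ ![u, v, w] = α u * (β v * γ w - γ v * β w) - β u * (α v * γ w - γ v * α w)
      + γ u * (α v * β w - β v * α w) := by
  have h : wedge3 α β γ ![u, v, w]
      = Matrix.det (Matrix.of fun i => LinearMap.pi ![α, β, γ] (![u, v, w] i)) := rfl
  rw [h, Matrix.det_fin_three]
  simp [LinearMap.pi_apply]
  ring

theorem symProd_apply (α β : V →ₗ[ℝ] ℝ) (u v : V) :
    symProd α β u v = (1 / 2) * (α u * β v + β u * α v) := by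
  simp [symProd, LinearMap.BilinForm.linMulLin_apply]
  ring

theorem sqrt_two_mul_self : √2 * √2 = (2 : ℝ) := Real.mul_self_sqrt (by norm_num)

/-- The linear automorphism of `ℝ⁷` with matrix `T`, given its inverse `S`. -/
noncomputable def matEquiv (T S : Matrix (Fin 7) (Fin 7) ℝ) (h : T * S = 1) :
    (Fin 7 → ℝ) ≃ₗ[ℝ] (Fin 7 → ℝ) :=
  Matrix.toLin'OfInv (mul_eq_one_comm.mp h) h

theorem matEquiv_apply (T S : Matrix (Fin 7) (Fin 7) ℝ) (h : T * S = 1) (x : Fin 7 → ℝ) :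
    matEquiv T S h x = T.mulVec x := rfl

theorem matEquiv_symm_apply (T S : Matrix (Fin 7) (Fin 7) ℝ) (h : T * S = 1) (x : Fin 7 → ℝ) :
    (matEquiv T S h).symm x = S.mulVec x := rfl

/-- The matrix that expresses the standard frame by the coordinates of `e`. -/
noncomputable def frameMatrix : Matrix (Fin 7) (Fin 7) ℝ :=
  !![1, 0, 0, 0, 0, 0, 0;
     0, 1, 0, 0, 0, 0, 0;
     0, 0, 1, 0, 0, 0, 0;
     0, 0, 0, √2 / 2, 0, 0, 0;
     0, 0, 0, 0, 0, 0, 1;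
     0, 0, 0, 0, 1, 0, 0;
     0, 0, 0, 0, 0, 1, 0]

noncomputable def frameMatrixInv : Matrix (Fin 7) (Fin 7) ℝ :=
  !![1, 0, 0, 0, 0, 0, 0;
     0, 1, 0, 0, 0, 0, 0;
     0, 0, 1, 0, 0, 0, 0;
     0, 0, 0, √2, 0, 0, 0;
     0, 0, 0, 0, 0, 1, 0;
     0, 0, 0, 0, 0, 0, 1;
     0, 0, 0, 0, 1, 0, 0]

theorem frameMatrix_mul_inv : frameMatrix * frameMatrixInv = 1 := by
  have h := sqrt_two_mul_self
  ext i j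
  fin_cases i <;> fin_cases j <;>
    simp [frameMatrix, frameMatrixInv, Matrix.mul_apply, Fin.sum_univ_succ]
  linarith

/-- The matrix that multiplies the fourth coordinate by `t`. -/
noncomputable def scaleMatrix (t : ℝ) : Matrix (Fin 7) (Fin 7) ℝ :=
  Matrix.diagonal ![1, 1, 1, t, 1, 1, 1]

theorem scaleMatrix_mul_inv : scaleMatrix √2 * scaleMatrix (√2 / 2) = 1 := by
  have h := sqrt_two_mul_self
  rw [scaleMatrix, scaleMatrix, Matrix.diagonal_mul_diagonal, ← Matrix.diagonal_one]
  congr 1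
  ext i
  fin_cases i <;> simp
  linarith

/-- Permuting the last three coordinates and dividing the fourth by √2 makes the coefficients of the
metric, and of the form divided by √2, integral. -/
theorem isFrame_standard (e : Module.Basis (Fin 7) ℝ V) :
    IsFrame e (e.equivFun.trans (matEquiv _ _ frameMatrix_mul_inv)) := by
  have h := sqrt_two_mul_self
  constructor
  · intro u v
    simp only [LinearEquiv.trans_apply, matEquiv_apply, metric0, dual2, LinearMap.sub_apply,
      LinearMap.smul_apply, LinearMap.add_apply, symProd_apply, coordMetric, frameMatrix]
    simp [Matrix.mulVec, dotProduct, Fin.sum_univ_succ, Module.Basis.coord_apply]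
    linear_combination (1 / 2 * e.repr u 3 * e.repr v 3) * h
  · intro u v w
    simp only [LinearEquiv.trans_apply, matEquiv_apply, omega0, dual3, AlternatingMap.sub_apply,
      AlternatingMap.smul_apply, AlternatingMap.add_apply, wedge3_apply, coordForm, minor3,
      frameMatrix]
    simp [Matrix.mulVec, dotProduct, Fin.sum_univ_succ, Module.Basis.coord_apply]
    generalize e.repr u = a, e.repr v = b, e.repr w = c
    ring_nf
    simp only [Real.sq_sqrt (show (0:ℝ) ≤ 2 by norm_num)]
    ring

/-- The basis of the classification that belongs to a frame. -/
noncomputable def frameBasis (φ : V ≃ₗ[ℝ] (Fin 7 → ℝ)) : Module.Basis (Fin 7) ℝ V :=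
  Module.Basis.ofEquivFun (φ.trans (matEquiv _ _ scaleMatrix_mul_inv))

theorem frameBasis_repr (φ : V ≃ₗ[ℝ] (Fin 7 → ℝ)) (v : V) (i : Fin 7) :
    (frameBasis φ).repr v i = ![1, 1, 1, √2, 1, 1, 1] i * φ v i := by
  simp [frameBasis, matEquiv_apply, scaleMatrix, Matrix.mulVec_diagonal]

theorem frameBasis_metric {e : Module.Basis (Fin 7) ℝ V} {φ : V ≃ₗ[ℝ] (Fin 7 → ℝ)}
    (hφ : IsFrame e φ) : metric0 e = metricII (frameBasis φ) := by
  have h := sqrt_two_mul_self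
  refine LinearMap.ext₂ fun u v => ?_
  rw [hφ.metric]
  simp only [metricII, dual2, LinearMap.sub_apply, LinearMap.smul_apply, LinearMap.add_apply,
    symProd_apply, coordMetric, Module.Basis.coord_apply, frameBasis_repr]
  simp
  linear_combination (φ u 3 * φ v 3) * h

theorem frameBasis_form {e : Module.Basis (Fin 7) ℝ V} {φ : V ≃ₗ[ℝ] (Fin 7 → ℝ)}
    (hφ : IsFrame e φ) : omega0 e = omegaII (frameBasis φ) := by
  refine AlternatingMap.ext fun x => ?_
  have hx : x = ![x 0, x 1, x 2] := by ext i; fin_cases i <;> rfl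
  rw [hx, hφ.form]
  simp only [omegaII, dual3, AlternatingMap.sub_apply, AlternatingMap.smul_apply,
    AlternatingMap.add_apply, AlternatingMap.neg_apply, wedge3_apply, coordForm, minor3,
    Module.Basis.coord_apply, frameBasis_repr]
  simp
  ring

/-- The endomorphism of `V` with matrix `M` in the coordinates `φ`. -/
noncomputable def coordEnd (φ : V ≃ₗ[ℝ] (Fin 7 → ℝ)) (M : Matrix (Fin 7) (Fin 7) ℝ) :
    Module.End ℝ V :=
  φ.symm.toLinearMap ∘ₗ Matrix.toLin' M ∘ₗ φ.toLinearMap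

theorem apply_coordEnd (φ : V ≃ₗ[ℝ] (Fin 7 → ℝ)) (M : Matrix (Fin 7) (Fin 7) ℝ) (v : V) :
    φ (coordEnd φ M v) = M.mulVec (φ v) := by
  simp [coordEnd]

/-- Rescaling the fourth vector absorbs every √2 in `hMatrix`, so the later computations are
polynomial over ℚ. -/
theorem hElem_frameBasis (φ : V ≃ₗ[ℝ] (Fin 7 → ℝ)) (A : Matrix (Fin 2) (Fin 2) ℝ)
    (z : Fin 4 → ℝ) (c : ℝ) :
    hElem (frameBasis φ) A z c
      = coordEnd φ (hRat (A 0 0) (A 0 1) (A 1 0) (A 1 1) (z 0) (z 1) (z 2) (z 3) c) := by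
  have h := sqrt_two_mul_self
  refine LinearMap.ext fun v => φ.injective ?_
  rw [apply_coordEnd]
  ext i
  have hi := congrFun (Matrix.repr_toLin (v₁ := frameBasis φ) (v₂ := frameBasis φ)
    (hMatrix A z c) v) i
  change (frameBasis φ).repr (hElem (frameBasis φ) A z c v) i = _ at hi
  rw [frameBasis_repr] at hi
  simp only [Matrix.mulVec, dotProduct, Fin.sum_univ_succ, frameBasis_repr] at hi ⊢
  fin_cases i <;> simp [hMatrix, hRat] at hi ⊢
  · linear_combination hi + (z 2 * φ v 3) * h
  · linear_combination hi + (z 1 * φ v 3) * h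
  · linear_combination hi - (A 0 1 * φ v 3) * h
  · linear_combination (√2 / 2) * hi - (1 / 2) * (φ (hElem (frameBasis φ) A z c v) 3
      + A 1 0 * φ v 2 + A 0 1 * φ v 4 - z 2 * φ v 5 - z 1 * φ v 6) * h
  · linear_combination hi - (A 1 0 * φ v 3) * h
  · linear_combination hi
  · linear_combination hi

end SplitG2

/-! ### Elements of G₂^* and their action on 𝔭₂ by conjugation. -/

namespace SplitG2

/-- The matrix of the coordinate change that interchanges the first two basis vectors. -/
def swapMatrix : Matrix (Fin 7) (Fin 7) ℝ :=
  !![0, 1, 0, 0, 0, 0, 0;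
     1, 0, 0, 0, 0, 0, 0;
     0, 0, 0, 0, -1, 0, 0;
     0, 0, 0, -1, 0, 0, 0;
     0, 0, -1, 0, 0, 0, 0;
     0, 0, 0, 0, 0, 0, 1;
     0, 0, 0, 0, 0, 1, 0]

/-- The matrix that interchanges the second and third basis vector, up to sign. -/
def reflMatrix : Matrix (Fin 7) (Fin 7) ℝ :=
  !![-1, 0, 0, 0, 0, 0, 0;
     0, 0, 1, 0, 0, 0, 0;
     0, 1, 0, 0, 0, 0, 0;
     0, 0, 0, 1, 0, 0, 0;
     0, 0, 0, 0, 0, 0, 1;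
     0, 0, 0, 0, 0, -1, 0;
     0, 0, 0, 0, 1, 0, 0]

/-- The matrix that interchanges the first two basis vectors with the last two. -/
def oppMatrix : Matrix (Fin 7) (Fin 7) ℝ :=
  !![0, 0, 0, 0, 0, 1, 0;
     0, 0, 0, 0, 0, 0, 1;
     0, 0, 0, 0, 1, 0, 0;
     0, 0, 0, -1, 0, 0, 0;
     0, 0, 1, 0, 0, 0, 0;
     1, 0, 0, 0, 0, 0, 0;
     0, 1, 0, 0, 0, 0, 0]

/-- The action of `diag(l, m) ∈ GL(2, ℝ)`. -/
noncomputable def torusMatrix (l m : ℝ) : Matrix (Fin 7) (Fin 7) ℝ :=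
  Matrix.diagonal ![l, m, l / m, 1, m / l, 1 / l, 1 / m]

/-- The action of an upper triangular unipotent matrix. -/
def shearMatrix (t : ℝ) : Matrix (Fin 7) (Fin 7) ℝ :=
  !![1, t, 0, 0, 0, 0, 0;
     0, 1, 0, 0, 0, 0, 0;
     0, 0, 1, -2 * t, t ^ 2, 0, 0;
     0, 0, 0, 1, -t, 0, 0;
     0, 0, 0, 0, 1, 0, 0;
     0, 0, 0, 0, 0, 1, 0;
     0, 0, 0, 0, 0, -t, 1]

/-- The exponential of `h(0, z, c)`. -/
noncomputable def unipMatrix (z₁ z₂ z₃ z₄ c : ℝ) : Matrix (Fin 7) (Fin 7) ℝ :=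
  !![1, 0, z₂, 2 * z₃, z₄, z₃ ^ 2 - z₂ * z₄, (z₂ * z₃ - z₁ * z₄) / 2 - c;
     0, 1, z₁, 2 * z₂, z₃, (z₂ * z₃ - z₁ * z₄) / 2 + c, z₂ ^ 2 - z₁ * z₃;
     0, 0, 1, 0, 0, -z₄, -z₃;
     0, 0, 0, 1, 0, z₃, z₂;
     0, 0, 0, 0, 1, -z₂, -z₁;
     0, 0, 0, 0, 0, 1, 0;
     0, 0, 0, 0, 0, 0, 1]

/-- `T` preserves the coordinate metric and the coordinate 3-form. -/
structure PreservesForms (T : Matrix (Fin 7) (Fin 7) ℝ) : Prop where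
  metric : ∀ u v, coordMetric (T.mulVec u) (T.mulVec v) = coordMetric u v
  form : ∀ u v w, coordForm (T.mulVec u) (T.mulVec v) (T.mulVec w) = coordForm u v w

theorem swapMatrix_preserves : PreservesForms swapMatrix := by
  constructor <;> intros <;>
    simp [coordMetric, coordForm, minor3, swapMatrix, Matrix.mulVec, dotProduct,
      Fin.sum_univ_succ] <;> ring

theorem reflMatrix_preserves : PreservesForms reflMatrix := by
  constructor <;> intros <;>
    simp [coordMetric, coordForm, minor3, reflMatrix, Matrix.mulVec, dotProduct,
      Fin.sum_univ_succ] <;> ring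

theorem oppMatrix_preserves : PreservesForms oppMatrix := by
  constructor <;> intros <;>
    simp [coordMetric, coordForm, minor3, oppMatrix, Matrix.mulVec, dotProduct,
      Fin.sum_univ_succ] <;> ring

theorem torusMatrix_preserves {l m : ℝ} (hl : l ≠ 0) (hm : m ≠ 0) :
    PreservesForms (torusMatrix l m) := by
  constructor <;> intros <;>
    simp [coordMetric, coordForm, minor3, torusMatrix, Matrix.mulVec_diagonal] <;>
    field_simp

theorem shearMatrix_preserves (t : ℝ) : PreservesForms (shearMatrix t) := by
  constructor <;> intros <;>
    simp [coordMetric, coordForm, minor3, shearMatrix, Matrix.mulVec, dotProduct,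
      Fin.sum_univ_succ] <;> ring

theorem unipMatrix_preserves (z₁ z₂ z₃ z₄ c : ℝ) :
    PreservesForms (unipMatrix z₁ z₂ z₃ z₄ c) := by
  constructor <;> intros <;>
    simp [coordMetric, coordForm, minor3, unipMatrix, Matrix.mulVec, dotProduct,
      Fin.sum_univ_succ] <;> ring

theorem swapMatrix_mul_self : swapMatrix * swapMatrix = 1 := by
  ext i j
  fin_cases i <;> fin_cases j <;> simp [swapMatrix, Matrix.mul_apply, Fin.sum_univ_succ]

theorem reflMatrix_mul_self : reflMatrix * reflMatrix = 1 := by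
  ext i j
  fin_cases i <;> fin_cases j <;> simp [reflMatrix, Matrix.mul_apply, Fin.sum_univ_succ]

theorem oppMatrix_mul_self : oppMatrix * oppMatrix = 1 := by
  ext i j
  fin_cases i <;> fin_cases j <;> simp [oppMatrix, Matrix.mul_apply, Fin.sum_univ_succ]

theorem torusMatrix_inv_mul {l m : ℝ} (hl : l ≠ 0) (hm : m ≠ 0) :
    torusMatrix l⁻¹ m⁻¹ * torusMatrix l m = 1 := by
  rw [torusMatrix, torusMatrix, Matrix.diagonal_mul_diagonal, ← Matrix.diagonal_one]
  congr 1
  ext i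
  fin_cases i <;> simp <;> field_simp

theorem shearMatrix_neg_mul (t : ℝ) : shearMatrix (-t) * shearMatrix t = 1 := by
  ext i j
  fin_cases i <;> fin_cases j <;>
    (simp [shearMatrix, Matrix.mul_apply, Fin.sum_univ_succ]; try ring)

theorem unipMatrix_neg_mul (z₁ z₂ z₃ z₄ c : ℝ) :
    unipMatrix (-z₁) (-z₂) (-z₃) (-z₄) (-c) * unipMatrix z₁ z₂ z₃ z₄ c = 1 := by
  ext i j
  fin_cases i <;> fin_cases j <;>
    simp [unipMatrix, Matrix.mul_apply, Fin.sum_univ_succ] <;> ring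

theorem hRat_mulVec (a₁ a₂ a₃ a₄ z₁ z₂ z₃ z₄ c : ℝ) (x : Fin 7 → ℝ) :
    (hRat a₁ a₂ a₃ a₄ z₁ z₂ z₃ z₄ c).mulVec x =
      ![a₁ * x 0 + a₂ * x 1 + z₂ * x 2 + 2 * z₃ * x 3 + z₄ * x 4 - c * x 6,
        a₃ * x 0 + a₄ * x 1 + z₁ * x 2 + 2 * z₂ * x 3 + z₃ * x 4 + c * x 5,
        (a₁ - a₄) * x 2 - 2 * a₂ * x 3 - z₄ * x 5 - z₃ * x 6,
        -a₃ * x 2 - a₂ * x 4 + z₃ * x 5 + z₂ * x 6,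
        -2 * a₃ * x 3 + (a₄ - a₁) * x 4 - z₂ * x 5 - z₁ * x 6,
        -a₁ * x 5 - a₃ * x 6,
        -a₂ * x 5 - a₄ * x 6] := by
  ext i
  simp only [hRat, Matrix.mulVec, dotProduct, Fin.sum_univ_succ]
  fin_cases i <;> simp <;> ring

theorem unipMatrix_mulVec (z₁ z₂ z₃ z₄ c : ℝ) (x : Fin 7 → ℝ) :
    (unipMatrix z₁ z₂ z₃ z₄ c).mulVec x =
      ![x 0 + z₂ * x 2 + 2 * z₃ * x 3 + z₄ * x 4 + (z₃ ^ 2 - z₂ * z₄) * x 5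
          + ((z₂ * z₃ - z₁ * z₄) / 2 - c) * x 6,
        x 1 + z₁ * x 2 + 2 * z₂ * x 3 + z₃ * x 4 + ((z₂ * z₃ - z₁ * z₄) / 2 + c) * x 5
          + (z₂ ^ 2 - z₁ * z₃) * x 6,
        x 2 - z₄ * x 5 - z₃ * x 6,
        x 3 + z₃ * x 5 + z₂ * x 6,
        x 4 - z₂ * x 5 - z₁ * x 6,
        x 5,
        x 6] := by
  ext i
  simp only [unipMatrix, Matrix.mulVec, dotProduct, Fin.sum_univ_succ]
  fin_cases i <;> simp <;> ring

theorem eq_conj_of_intertwine {S T M N : Matrix (Fin 7) (Fin 7) ℝ} (hST : T * S = 1)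
    (h : ∀ x, S.mulVec (M.mulVec x) = N.mulVec (S.mulVec x)) : S * M * T = N := by
  have h1 : S * M = N * S := by
    apply Matrix.toLin'.injective
    refine LinearMap.ext fun x => ?_
    simpa using h x
  rw [h1, Matrix.mul_assoc, mul_eq_one_comm.mp hST, Matrix.mul_one]

theorem swapMatrix_conj (a₁ a₂ a₃ a₄ z₁ z₂ z₃ z₄ c : ℝ) :
    swapMatrix * hRat a₁ a₂ a₃ a₄ z₁ z₂ z₃ z₄ c * swapMatrix
      = hRat a₄ a₃ a₂ a₁ (-z₄) (-z₃) (-z₂) (-z₁) (-c) := by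
  refine eq_conj_of_intertwine swapMatrix_mul_self fun x => ?_
  ext i
  simp only [hRat, swapMatrix, Matrix.mulVec, dotProduct, Fin.sum_univ_succ]
  fin_cases i <;> simp <;> ring

theorem torusMatrix_conj {l m : ℝ} (hl : l ≠ 0) (hm : m ≠ 0) (a₁ a₂ a₃ a₄ z₁ z₂ z₃ z₄ c : ℝ) :
    torusMatrix l m * hRat a₁ a₂ a₃ a₄ z₁ z₂ z₃ z₄ c * torusMatrix l⁻¹ m⁻¹
      = hRat a₁ (l / m * a₂) (m / l * a₃) a₄ (m ^ 2 / l * z₁) (m * z₂) (l * z₃) (l ^ 2 / m * z₄)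
        (l * m * c) := by
  refine eq_conj_of_intertwine (torusMatrix_inv_mul hl hm) fun x => ?_
  ext i
  simp only [hRat, torusMatrix, Matrix.mulVec_diagonal]
  simp only [Matrix.mulVec, dotProduct, Fin.sum_univ_succ]
  fin_cases i <;> simp [Matrix.diagonal_apply] <;> field_simp

/-- On the cubic z₁y³ + 3z₂y²x + 3z₃yx² + z₄x³ this is the substitution y ↦ y + tx. -/
theorem shearMatrix_conj (t a₁ a₂ a₃ a₄ z₁ z₂ z₃ z₄ c : ℝ) :
    shearMatrix t * hRat a₁ a₂ a₃ a₄ z₁ z₂ z₃ z₄ c * shearMatrix (-t)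
      = hRat (a₁ + t * a₃) (a₂ + t * (a₄ - a₁) - t ^ 2 * a₃) a₃ (a₄ - t * a₃) z₁ (z₂ + t * z₁)
        (z₃ + 2 * t * z₂ + t ^ 2 * z₁) (z₄ + 3 * t * z₃ + 3 * t ^ 2 * z₂ + t ^ 3 * z₁) c := by
  refine eq_conj_of_intertwine (shearMatrix_neg_mul t) fun x => ?_
  ext i
  simp only [hRat, shearMatrix, Matrix.mulVec, dotProduct, Fin.sum_univ_succ]
  fin_cases i <;> simp <;> ring

/-- The nilradical is two-step nilpotent: the ℝ⁴-part changes by the linear action of A on n, and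
the halves in the last entry are the second-order terms of the exponential. -/
theorem unipMatrix_conj (n₁ n₂ n₃ n₄ m a₁ a₂ a₃ a₄ z₁ z₂ z₃ z₄ c : ℝ) :
    unipMatrix n₁ n₂ n₃ n₄ m * hRat a₁ a₂ a₃ a₄ z₁ z₂ z₃ z₄ c
        * unipMatrix (-n₁) (-n₂) (-n₃) (-n₄) (-m)
      = hRat a₁ a₂ a₃ a₄
        (z₁ - ((2 * a₄ - a₁) * n₁ + 3 * a₃ * n₂))
        (z₂ - (a₂ * n₁ + a₄ * n₂ + 2 * a₃ * n₃))
        (z₃ - (2 * a₂ * n₂ + a₁ * n₃ + a₃ * n₄))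
        (z₄ - (3 * a₂ * n₃ + (2 * a₁ - a₄) * n₄))
        (c - (a₁ + a₄) * m
          - (n₁ * (z₄ - (3 * a₂ * n₃ + (2 * a₁ - a₄) * n₄) / 2)
            - n₄ * (z₁ - ((2 * a₄ - a₁) * n₁ + 3 * a₃ * n₂) / 2))
          + 3 * (n₂ * (z₃ - (2 * a₂ * n₂ + a₁ * n₃ + a₃ * n₄) / 2)
            - n₃ * (z₂ - (a₂ * n₁ + a₄ * n₂ + 2 * a₃ * n₃) / 2))) := by
  refine eq_conj_of_intertwine (unipMatrix_neg_mul n₁ n₂ n₃ n₄ m) fun x => ?_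
  simp only [hRat_mulVec, unipMatrix_mulVec]
  ext i
  fin_cases i <;> simp <;> ring

/-- The last entry contains the invariant symplectic form on binary cubics; two elements of the
nilradical bracket to the centre through it. -/
theorem hRat_bracket (a₁ a₂ a₃ a₄ z₁ z₂ z₃ z₄ c b₁ b₂ b₃ b₄ w₁ w₂ w₃ w₄ d : ℝ) :
    hRat a₁ a₂ a₃ a₄ z₁ z₂ z₃ z₄ c * hRat b₁ b₂ b₃ b₄ w₁ w₂ w₃ w₄ d
        - hRat b₁ b₂ b₃ b₄ w₁ w₂ w₃ w₄ d * hRat a₁ a₂ a₃ a₄ z₁ z₂ z₃ z₄ c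
      = hRat (a₂ * b₃ - b₂ * a₃) (a₁ * b₂ + a₂ * b₄ - b₁ * a₂ - b₂ * a₄)
        (a₃ * b₁ + a₄ * b₃ - b₃ * a₁ - b₄ * a₃) (a₃ * b₂ - b₃ * a₂)
        ((2 * a₄ - a₁) * w₁ + 3 * a₃ * w₂ - ((2 * b₄ - b₁) * z₁ + 3 * b₃ * z₂))
        (a₂ * w₁ + a₄ * w₂ + 2 * a₃ * w₃ - (b₂ * z₁ + b₄ * z₂ + 2 * b₃ * z₃))
        (2 * a₂ * w₂ + a₁ * w₃ + a₃ * w₄ - (2 * b₂ * z₂ + b₁ * z₃ + b₃ * z₄))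
        (3 * a₂ * w₃ + (2 * a₁ - a₄) * w₄ - (3 * b₂ * z₃ + (2 * b₁ - b₄) * z₄))
        ((a₁ + a₄) * d - (b₁ + b₄) * c - (z₁ * w₄ - z₄ * w₁) + 3 * (z₂ * w₃ - z₃ * w₂)) := by
  apply Matrix.toLin'.injective
  refine LinearMap.ext fun x => ?_
  simp only [Matrix.toLin'_apply, Matrix.sub_mulVec, ← Matrix.mulVec_mulVec, hRat_mulVec]
  ext i
  fin_cases i <;> simp <;> ring

end SplitG2

/-! ### The equations of 𝔤₂^*. -/

namespace SplitG2

/-- The infinitesimal stabiliser of the 3-form, in coordinates, is given by the equations of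
`𝔤₂^*`. -/
theorem stabilizer_equations {N : Matrix (Fin 7) (Fin 7) ℝ}
    (H : ∀ u v w, coordForm (N.mulVec u) v w + coordForm u (N.mulVec v) w
      + coordForm u v (N.mulVec w) = 0) :
      N 5 0 = 0 ∧
      N 5 1 + N 6 0 = 0 ∧
      N 6 1 = 0 ∧
      N 2 0 - N 3 1 = 0 ∧
      N 3 0 - N 4 1 = 0 ∧
      N 4 0 + N 5 2 = 0 ∧
      N 3 0 + N 6 2 = 0 ∧
      N 1 0 + N 3 2 = 0 ∧
      N 4 2 = 0 ∧
      N 2 0 - N 5 4 - N 6 3 = 0 ∧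
      N 0 0 + N 3 3 + N 5 5 = 0 ∧
      N 1 0 + N 4 3 - N 5 6 = 0 ∧
      N 3 4 - N 6 5 = 0 ∧
      N 0 0 + N 4 4 + N 6 6 = 0 ∧
      N 3 6 + N 4 5 = 0 ∧
      N 4 1 - N 5 3 - N 6 2 = 0 ∧
      N 3 1 + N 5 4 = 0 ∧
      N 1 1 + N 2 2 + N 5 5 = 0 ∧
      N 3 2 - N 5 6 = 0 ∧
      N 2 1 + N 6 4 = 0 ∧
      N 0 1 + N 2 3 - N 6 5 = 0 ∧
      N 1 1 + N 3 3 + N 6 6 = 0 ∧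
      N 2 4 = 0 ∧
      N 0 1 + N 3 4 = 0 ∧
      N 2 6 + N 3 5 = 0 ∧
      N 2 2 + N 3 3 + N 4 4 = 0 ∧
      N 0 2 - N 1 3 - N 4 5 = 0 ∧
      N 1 2 + N 4 6 = 0 ∧
      N 1 4 - N 3 5 = 0 ∧
      N 0 2 - N 3 6 = 0 ∧
      N 1 6 = 0 ∧
      N 0 4 + N 2 5 = 0 ∧
      N 0 3 - N 1 4 + N 2 6 = 0 ∧
      N 0 6 + N 1 5 = 0 ∧
      N 0 5 = 0 := by
  have E := fun i j k : Fin 7 => H (Pi.single i 1) (Pi.single j 1) (Pi.single k 1)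
  simp only [Matrix.mulVec_single_one, coordForm, minor3, Matrix.col_apply] at E
  refine ⟨?_, ?_, ?_, ?_, ?_, ?_, ?_, ?_, ?_, ?_, ?_, ?_, ?_, ?_, ?_, ?_, ?_, ?_,
    ?_, ?_, ?_, ?_, ?_, ?_, ?_, ?_, ?_, ?_, ?_, ?_, ?_, ?_, ?_, ?_, ?_⟩
  · have h := E 0 1 2
    simp at h
    linarith
  · have h := E 0 1 3
    simp at h
    linarith
  · have h := E 0 1 4
    simp at h
    linarith
  · have h := E 0 1 5
    simp at h
    linarith
  · have h := E 0 1 6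
    simp at h
    linarith
  · have h := E 0 2 3
    simp at h
    linarith
  · have h := E 0 2 4
    simp at h
    linarith
  · have h := E 0 2 5
    simp at h
    linarith
  · have h := E 0 2 6
    simp at h
    linarith
  · have h := E 0 3 4
    simp at h
    linarith
  · have h := E 0 3 5
    simp at h
    linarith
  · have h := E 0 3 6
    simp at h
    linarith
  · have h := E 0 4 5
    simp at h
    linarith
  · have h := E 0 4 6
    simp at h
    linarith
  · have h := E 0 5 6
    simp at h
    linarith
  · have h := E 1 2 3
    simp at h
    linarith
  · have h := E 1 2 4
    simp at h
    linarith
  · have h := E 1 2 5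
    simp at h
    linarith
  · have h := E 1 2 6
    simp at h
    linarith
  · have h := E 1 3 4
    simp at h
    linarith
  · have h := E 1 3 5
    simp at h
    linarith
  · have h := E 1 3 6
    simp at h
    linarith
  · have h := E 1 4 5
    simp at h
    linarith
  · have h := E 1 4 6
    simp at h
    linarith
  · have h := E 1 5 6
    simp at h
    linarith
  · have h := E 2 3 4
    simp at h
    linarith
  · have h := E 2 3 5
    simp at h
    linarith
  · have h := E 2 3 6
    simp at h
    linarith
  · have h := E 2 4 5
    simp at h
    linarith
  · have h := E 2 4 6
    simp at h
    linarith
  · have h := E 2 5 6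
    simp at h
    linarith
  · have h := E 3 4 5
    simp at h
    linarith
  · have h := E 3 4 6
    simp at h
    linarith
  · have h := E 3 5 6
    simp at h
    linarith
  · have h := E 4 5 6
    simp at h
    linarith

/-- The 3-form determines its metric infinitesimally: on pairs of basis vectors skewness is a linear
consequence of the stabiliser equations, and bilinearity does the rest. -/
theorem skew_of_stabilizer {N : Matrix (Fin 7) (Fin 7) ℝ}
    (H : ∀ u v w, coordForm (N.mulVec u) v w + coordForm u (N.mulVec v) w
      + coordForm u v (N.mulVec w) = 0) (u v : Fin 7 → ℝ) :
    coordMetric (N.mulVec u) v + coordMetric u (N.mulVec v) = 0 := by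
  obtain ⟨e0, e1, e2, e3, e4, e5, e6, e7, e8, e9, e10, e11, e12, e13, e14, e15, e16, e17, e18, e19,
      e20, e21, e22, e23, e24, e25, e26, e27, e28, e29, e30, e31, e32, e33, e34⟩ :=
    stabilizer_equations H
  have hB : ∀ i j : Fin 7, coordMetric (N.mulVec (Pi.single i 1)) (Pi.single j 1)
      + coordMetric (Pi.single i 1) (N.mulVec (Pi.single j 1)) = 0 := by
    intro i j
    simp only [Matrix.mulVec_single_one, coordMetric, Matrix.col_apply]
    fin_cases i <;> fin_cases j <;> simp <;> linarith
  let B : LinearMap.BilinForm ℝ (Fin 7 → ℝ) := LinearMap.mk₂ ℝ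
    (fun u v => coordMetric (N.mulVec u) v + coordMetric u (N.mulVec v))
    (by intros; simp only [coordMetric, Matrix.mulVec_add, Pi.add_apply]; ring)
    (by intros; simp only [coordMetric, Matrix.mulVec_smul, Pi.smul_apply, smul_eq_mul]; ring)
    (by intros; simp only [coordMetric, Matrix.mulVec_add, Pi.add_apply]; ring)
    (by intros; simp only [coordMetric, Matrix.mulVec_smul, Pi.smul_apply, smul_eq_mul]; ring)
  have h0 : B = 0 := by
    refine LinearMap.BilinForm.ext_basis (Pi.basisFun ℝ (Fin 7)) fun i j => ?_
    simpa [B, Pi.basisFun_apply] using hB i j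
  exact congrArg (fun b : LinearMap.BilinForm ℝ (Fin 7 → ℝ) => b u v) h0

/-- An element that preserves the plane of the first two vectors lies in a nine-dimensional
parabolic subalgebra; the equations express every other entry by the nine listed ones. -/
theorem eq_hRat_of_stabilizer {N : Matrix (Fin 7) (Fin 7) ℝ}
    (H : ∀ u v w, coordForm (N.mulVec u) v w + coordForm u (N.mulVec v) w
      + coordForm u v (N.mulVec w) = 0)
    (h0 : ∀ i : Fin 7, 2 ≤ i → N i 0 = 0 ∧ N i 1 = 0) :
    N = hRat (N 0 0) (N 0 1) (N 1 0) (N 1 1) (N 1 2) (N 0 2) (N 1 4) (N 0 4) (N 1 5) := by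
  obtain ⟨e0, e1, e2, e3, e4, e5, e6, e7, e8, e9, e10, e11, e12, e13, e14, e15, e16, e17, e18, e19,
      e20, e21, e22, e23, e24, e25, e26, e27, e28, e29, e30, e31, e32, e33, e34⟩ :=
    stabilizer_equations H
  have i2 := h0 2 (by decide)
  have i3 := h0 3 (by decide)
  have i4 := h0 4 (by decide)
  have i5 := h0 5 (by decide)
  have i6 := h0 6 (by decide)
  ext i j
  fin_cases i <;> fin_cases j <;> simp [hRat] <;> linarith

end SplitG2

/-! ### The socle as a totally isotropic plane. -/

namespace SplitG2

section Socle

variable {V : Type*} [AddCommGroup V] [Module ℝ V] {h : LieSubalgebra ℝ (Module.End ℝ V)}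

/-- A submodule that is stable under the endomorphisms in `h`, as a Lie submodule. -/
def stableSubmodule (h : LieSubalgebra ℝ (Module.End ℝ V)) (W : Submodule ℝ V)
    (hW : ∀ X ∈ h, ∀ v ∈ W, X v ∈ W) : LieSubmodule ℝ h V :=
  { W with lie_mem := fun {x m} hm => hW x x.2 m hm }

theorem lieSubmodule_stable (N : LieSubmodule ℝ h V) {X : Module.End ℝ V} (hX : X ∈ h) {v : V}
    (hv : v ∈ N) : X v ∈ N :=
  N.lie_mem (x := (⟨X, hX⟩ : h)) hv

theorem line_stable {v : V} (hv : ∀ X ∈ h, ∃ c : ℝ, X v = c • v) :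
    ∀ X ∈ h, ∀ w ∈ Submodule.span ℝ {v}, X w ∈ Submodule.span ℝ {v} := by
  intro X hX w hw
  obtain ⟨t, rfl⟩ := Submodule.mem_span_singleton.mp hw
  obtain ⟨c, hc⟩ := hv X hX
  rw [map_smul, hc]
  exact Submodule.smul_mem _ _ (Submodule.smul_mem _ _ (Submodule.mem_span_singleton_self v))

/-- A common eigenvector lies in the socle. -/
theorem mem_socle_of_eigenvector {v : V} (hv : ∀ X ∈ h, ∃ c : ℝ, X v = c • v) : v ∈ socle h := by
  by_cases h0 : v = 0
  · rw [h0]; exact zero_mem _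
  let L := stableSubmodule h (Submodule.span ℝ {v}) (line_stable hv)
  have hatom := nonzero_span_atom (K := ℝ) v h0
  have hL : IsAtom L := by
    refine ⟨fun hb => hatom.1 ?_, fun N hN => ?_⟩
    · have : L.toSubmodule = ⊥ := by rw [hb]; rfl
      exact this
    · rw [← LieSubmodule.toSubmodule_inj]
      refine hatom.2 _ (lt_of_le_of_ne (show N.toSubmodule ≤ L.toSubmodule from hN.le) ?_)
      intro hc
      exact hN.ne (LieSubmodule.toSubmodule_injective hc)
  have hle : L ≤ socle h := le_sSup hL
  exact hle (Submodule.mem_span_singleton_self v)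

/-- An invariant line in a two-dimensional socle has an invariant complement. -/
theorem exists_eigenvector_complement [FiniteDimensional ℝ V] (h2 : IsTypeII h) {x : V}
    (hx0 : x ≠ 0) (hx : ∀ X ∈ h, ∃ c : ℝ, X x = c • x) :
    ∃ y ∈ socle h, y ∉ Submodule.span ℝ {x} ∧ ∀ X ∈ h, ∃ c : ℝ, X y = c • y := by
  let L := stableSubmodule h (Submodule.span ℝ {x}) (line_stable hx)
  have hxS := mem_socle_of_eigenvector hx
  have hL1 : Module.finrank ℝ L.toSubmodule = 1 := finrank_span_singleton hx0
  have hLS : L.toSubmodule ≤ (socle h).toSubmodule :=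
    (Submodule.span_singleton_le_iff_mem _ _).mpr hxS
  have h2' : Module.finrank ℝ (socle h).toSubmodule = 2 := h2
  -- The irreducible submodules span a plane, so one of them is not inside the line. It meets the
  -- line in zero and is therefore itself a line.
  have hnot : ¬ ∀ N : LieSubmodule ℝ h V, IsAtom N → N ≤ L := by
    intro hall
    have hle : socle h ≤ L := sSup_le hall
    have := Submodule.finrank_mono (show (socle h).toSubmodule ≤ L.toSubmodule from hle)
    omega
  push Not at hnot
  obtain ⟨N, hN, hNL⟩ := hnot
  have hNS : N ≤ socle h := le_sSup hN
  have hinf : N ⊓ L = ⊥ := by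
    rcases hN.le_iff.mp (inf_le_left : N ⊓ L ≤ N) with h1 | h1
    · exact h1
    · exact absurd (inf_eq_left.mp h1) hNL
  have hinf' : N.toSubmodule ⊓ L.toSubmodule = ⊥ := by
    rw [← LieSubmodule.inf_toSubmodule, hinf]; rfl
  have hsum := Submodule.finrank_sup_add_finrank_inf_eq N.toSubmodule L.toSubmodule
  rw [hinf', finrank_bot] at hsum
  have hle := Submodule.finrank_mono (sup_le (show N.toSubmodule ≤ (socle h).toSubmodule from hNS)
    hLS)
  have hN0 : N.toSubmodule ≠ ⊥ := fun hb => hN.1 (LieSubmodule.toSubmodule_injective hb)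
  have hNpos : 0 < Module.finrank ℝ N.toSubmodule := by
    rw [Nat.pos_iff_ne_zero]
    exact fun hz => hN0 (Submodule.finrank_eq_zero.mp hz)
  have hN1 : Module.finrank ℝ N.toSubmodule = 1 := by omega
  obtain ⟨⟨y, hyN⟩, hy0, hy⟩ := finrank_eq_one_iff'.mp hN1
  refine ⟨y, hNS hyN, fun hyL => ?_, fun X hX => ?_⟩
  · have : y ∈ N.toSubmodule ⊓ L.toSubmodule := ⟨hyN, hyL⟩
    rw [hinf', Submodule.mem_bot] at this
    exact hy0 (Subtype.ext this)
  · obtain ⟨c, hc⟩ := hy ⟨X y, lieSubmodule_stable N hX hyN⟩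
    exact ⟨c, (congrArg Subtype.val hc).symm⟩

theorem exists_coeffs_of_mem_socle [FiniteDimensional ℝ V] (h2 : IsTypeII h) {x y u : V}
    (hx0 : x ≠ 0) (hx : x ∈ socle h) (hy : y ∈ socle h) (hyx : y ∉ Submodule.span ℝ {x})
    (hu : u ∈ socle h) : ∃ a b : ℝ, a • x + b • y = u := by
  have hli : LinearIndependent ℝ ![x, y] := by
    rw [LinearIndependent.pair_iff' hx0]
    intro a ha
    exact hyx (ha ▸ Submodule.smul_mem _ _ (Submodule.mem_span_singleton_self x))
  have hspan : Submodule.span ℝ (Set.range ![x, y]) = (socle h).toSubmodule := by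
    refine Submodule.eq_of_le_of_finrank_eq ?_ ?_
    · rw [Submodule.span_le]
      rintro _ ⟨i, rfl⟩
      fin_cases i
      exacts [hx, hy]
    · rw [finrank_span_eq_card hli, show Module.finrank ℝ (socle h).toSubmodule = 2 from h2]; rfl
  have hu' : u ∈ Submodule.span ℝ (Set.range ![x, y]) := by rw [hspan]; exact hu
  simp only [Matrix.range_cons, Matrix.range_empty, Set.union_empty, Set.singleton_union] at hu'
  exact Submodule.mem_span_pair.mp hu'

end Socle

theorem coordMetric_comm (u v : Fin 7 → ℝ) : coordMetric u v = coordMetric v u := by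
  simp only [coordMetric]; ring

theorem eq_zero_of_coordMetric {u : Fin 7 → ℝ} (hu : ∀ v, coordMetric u v = 0) : u = 0 := by
  have E := fun i => hu (Pi.single i 1)
  simp only [coordMetric] at E
  have e0 := E 0
  have e1 := E 1
  have e2 := E 2
  have e3 := E 3
  have e4 := E 4
  have e5 := E 5
  have e6 := E 6
  simp at e0 e1 e2 e3 e4 e5 e6
  ext i
  fin_cases i <;> simp <;> assumption

variable {V : Type*} [AddCommGroup V] [Module ℝ V] {e : Module.Basis (Fin 7) ℝ V}
  {φ : V ≃ₗ[ℝ] (Fin 7 → ℝ)}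

/-- The matrix of an endomorphism in the coordinates `φ`. -/
noncomputable def endMatrix (φ : V ≃ₗ[ℝ] (Fin 7 → ℝ)) (X : Module.End ℝ V) :
    Matrix (Fin 7) (Fin 7) ℝ :=
  LinearMap.toMatrix' (φ.toLinearMap ∘ₗ X ∘ₗ φ.symm.toLinearMap)

theorem apply_eq_endMatrix (φ : V ≃ₗ[ℝ] (Fin 7 → ℝ)) (X : Module.End ℝ V) (v : V) :
    φ (X v) = (endMatrix φ X).mulVec (φ v) := by
  rw [endMatrix, LinearMap.toMatrix'_mulVec]
  simp

theorem coordEnd_endMatrix (φ : V ≃ₗ[ℝ] (Fin 7 → ℝ)) (X : Module.End ℝ V) :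
    coordEnd φ (endMatrix φ X) = X := by
  refine LinearMap.ext fun v => φ.injective ?_
  rw [apply_coordEnd, apply_eq_endMatrix]

theorem endMatrix_stabilizes (hφ : IsFrame e φ) {X : Module.End ℝ V} (hX : X ∈ g2star e)
    (u v w : Fin 7 → ℝ) :
    coordForm ((endMatrix φ X).mulVec u) v w + coordForm u ((endMatrix φ X).mulVec v) w
      + coordForm u v ((endMatrix φ X).mulVec w) = 0 := by
  have h := hX (φ.symm u) (φ.symm v) (φ.symm w)
  rw [hφ.form, hφ.form, hφ.form] at h
  simp only [apply_eq_endMatrix, LinearEquiv.apply_symm_apply] at h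
  have h2 : √2 ≠ (0 : ℝ) := by positivity
  have h3 : √2 * (coordForm ((endMatrix φ X).mulVec u) v w
      + coordForm u ((endMatrix φ X).mulVec v) w
      + coordForm u v ((endMatrix φ X).mulVec w)) = 0 := by linarith
  exact (mul_eq_zero.mp h3).resolve_left h2

theorem metric_skew (hφ : IsFrame e φ) {X : Module.End ℝ V} (hX : X ∈ g2star e) (u v : V) :
    metric0 e (X u) v + metric0 e u (X v) = 0 := by
  rw [hφ.metric, hφ.metric, apply_eq_endMatrix, apply_eq_endMatrix]
  exact skew_of_stabilizer (endMatrix_stabilizes hφ hX) _ _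

theorem metric_comm (hφ : IsFrame e φ) (u v : V) : metric0 e u v = metric0 e v u := by
  rw [hφ.metric, hφ.metric, coordMetric_comm]

theorem isFrame_trans (hφ : IsFrame e φ) {T S : Matrix (Fin 7) (Fin 7) ℝ} (hT : PreservesForms T)
    (hTS : T * S = 1) : IsFrame e (φ.trans (matEquiv T S hTS)) := by
  constructor
  · intro u v
    simp only [LinearEquiv.trans_apply, matEquiv_apply, hT.metric, hφ.metric]
  · intro u v w
    simp only [LinearEquiv.trans_apply, matEquiv_apply, hT.form, hφ.form]

/-- A two-dimensional socle is totally isotropic if no non-degenerate subspace is invariant. -/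
theorem socle_isotropic (hφ : IsFrame e φ) {h : LieSubalgebra ℝ (Module.End ℝ V)}
    (hg : h ≤ g2star e) (hind : IsIndecomposable (metric0 e) h) (h2 : IsTypeII h) :
    ∀ u ∈ socle h, ∀ v ∈ socle h, metric0 e u v = 0 := by
  have : FiniteDimensional ℝ V := Module.Basis.finiteDimensional_of_finite e
  have hsymm := metric_comm hφ
  have h7 : Module.finrank ℝ V = 7 := by simp [Module.finrank_eq_card_basis e]
  have h2' : Module.finrank ℝ (socle h).toSubmodule = 2 := h2
  have nondeg : ∀ W : LieSubmodule ℝ h V, (∀ u ∈ W, (∀ v ∈ W, metric0 e u v = 0) → u = 0) →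
      W = ⊥ ∨ W = ⊤ := by
    intro W hW
    refine hind W ⟨?_, ?_⟩
    · rintro ⟨u, hu⟩ h0
      exact Subtype.ext (hW u hu fun v hv => h0 ⟨v, hv⟩)
    · rintro ⟨u, hu⟩ h0
      exact Subtype.ext (hW u hu fun v hv => by rw [hsymm]; exact h0 ⟨v, hv⟩)
  have small : ∀ W : LieSubmodule ℝ h V, 0 < Module.finrank ℝ W.toSubmodule →
      Module.finrank ℝ W.toSubmodule < 7 → ¬ (W = ⊥ ∨ W = ⊤) := by
    rintro W h0 h1 (rfl | rfl)
    · simp at h0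
    · simp only [LieSubmodule.top_toSubmodule, finrank_top] at h1
      omega
  -- Otherwise the socle itself would be a proper invariant non-degenerate subspace.
  have h3 : ¬ (∀ u ∈ socle h, (∀ v ∈ socle h, metric0 e u v = 0) → u = 0) := fun hc =>
    small _ (by omega) (by omega) (nondeg _ hc)
  push Not at h3
  obtain ⟨x, hxS, hxo, hx0⟩ := h3
  by_contra hne
  push Not at hne
  obtain ⟨u, hu, v, hv, huv⟩ := hne
  -- the radical of the restricted metric is a line
  have rad : ∀ y ∈ socle h, (∀ v ∈ socle h, metric0 e y v = 0) → y ∈ Submodule.span ℝ {x} := by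
    intro y hy hyo
    by_contra hyx
    obtain ⟨a, b, rfl⟩ := exists_coeffs_of_mem_socle h2 hx0 hxS hy hyx hu
    apply huv
    simp [hxo v hv, hyo v hv]
  have hline : ∀ X ∈ h, ∃ c : ℝ, X x = c • x := by
    intro X hX
    have hXS := lieSubmodule_stable (socle h) hX hxS
    have : X x ∈ Submodule.span ℝ {x} := by
      refine rad _ hXS fun v hv => ?_
      have := metric_skew hφ (hg hX) x v
      rw [hxo _ (lieSubmodule_stable (socle h) hX hv)] at this
      linarith
    obtain ⟨c, hc⟩ := Submodule.mem_span_singleton.mp this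
    exact ⟨c, hc.symm⟩
  -- The complementary line is not null, since otherwise it would lie in the radical; so it is an
  -- invariant non-degenerate subspace.
  obtain ⟨y, hyS, hyx, hy⟩ := exists_eigenvector_complement h2 hx0 hline
  have hy0 : y ≠ 0 := fun h0 => hyx (by rw [h0]; exact zero_mem _)
  refine small (stableSubmodule h (Submodule.span ℝ {y}) (line_stable hy)) ?_ ?_ (nondeg _ ?_)
  · rw [show (stableSubmodule h (Submodule.span ℝ {y}) (line_stable hy)).toSubmodule
      = Submodule.span ℝ {y} from rfl, finrank_span_singleton hy0]; norm_num
  · rw [show (stableSubmodule h (Submodule.span ℝ {y}) (line_stable hy)).toSubmodule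
      = Submodule.span ℝ {y} from rfl, finrank_span_singleton hy0]; norm_num
  · intro w hw hwo
    obtain ⟨t, rfl⟩ := Submodule.mem_span_singleton.mp hw
    have h1 := hwo y (Submodule.mem_span_singleton_self y)
    rw [map_smul, LinearMap.smul_apply, smul_eq_mul, mul_eq_zero] at h1
    rcases h1 with h1 | h1
    · rw [h1, zero_smul]
    · exfalso
      apply hyx
      refine rad y hyS fun v hv => ?_
      obtain ⟨a, b, rfl⟩ := exists_coeffs_of_mem_socle h2 hx0 hxS hyS hyx hv
      simp [h1, hsymm y x, hxo y hyS]

end SplitG2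

/-! ### Transitivity on null vectors and frames adapted to the socle. -/

namespace SplitG2

/-- Some invertible matrix that preserves the forms maps `x` to the first basis vector. -/
def ReachesFirst (x : Fin 7 → ℝ) : Prop :=
  ∃ T S : Matrix (Fin 7) (Fin 7) ℝ, T * S = 1 ∧ PreservesForms T ∧
    T.mulVec x = ![1, 0, 0, 0, 0, 0, 0]

theorem ReachesFirst.of_mulVec {T S : Matrix (Fin 7) (Fin 7) ℝ} {x : Fin 7 → ℝ}
    (hTS : T * S = 1) (hT : PreservesForms T) (h : ReachesFirst (T.mulVec x)) :
    ReachesFirst x := by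
  obtain ⟨T', S', h1, h2, h3⟩ := h
  refine ⟨T' * T, S * S', ?_, ⟨fun u v => ?_, fun u v w => ?_⟩, ?_⟩
  · rw [Matrix.mul_assoc, ← Matrix.mul_assoc T, hTS, Matrix.one_mul, h1]
  · rw [← Matrix.mulVec_mulVec, ← Matrix.mulVec_mulVec, h2.metric, hT.metric]
  · rw [← Matrix.mulVec_mulVec, ← Matrix.mulVec_mulVec, ← Matrix.mulVec_mulVec, h2.form, hT.form]
  · rw [← Matrix.mulVec_mulVec, h3]

theorem shearMatrix_mul_neg (t : ℝ) : shearMatrix t * shearMatrix (-t) = 1 :=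
  mul_eq_one_comm.mp (shearMatrix_neg_mul t)

theorem unipMatrix_mul_neg (z₁ z₂ z₃ z₄ c : ℝ) :
    unipMatrix z₁ z₂ z₃ z₄ c * unipMatrix (-z₁) (-z₂) (-z₃) (-z₄) (-c) = 1 :=
  mul_eq_one_comm.mp (unipMatrix_neg_mul z₁ z₂ z₃ z₄ c)

theorem torusMatrix_mul_inv {l m : ℝ} (hl : l ≠ 0) (hm : m ≠ 0) :
    torusMatrix l m * torusMatrix l⁻¹ m⁻¹ = 1 :=
  mul_eq_one_comm.mp (torusMatrix_inv_mul hl hm)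

theorem shearMatrix_mulVec (t : ℝ) (x : Fin 7 → ℝ) :
    (shearMatrix t).mulVec x = ![x 0 + t * x 1, x 1, x 2 - 2 * t * x 3 + t ^ 2 * x 4,
      x 3 - t * x 4, x 4, x 5, x 6 - t * x 5] := by
  ext i
  simp only [shearMatrix, Matrix.mulVec, dotProduct, Fin.sum_univ_succ]
  fin_cases i <;> simp <;> ring

theorem torusMatrix_mulVec (l m : ℝ) (x : Fin 7 → ℝ) :
    (torusMatrix l m).mulVec x = ![l * x 0, m * x 1, l / m * x 2, x 3, m / l * x 4, 1 / l * x 5,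
      1 / m * x 6] := by
  ext i
  simp only [torusMatrix, Matrix.mulVec_diagonal]
  fin_cases i <;> simp

theorem swapMatrix_mulVec (x : Fin 7 → ℝ) :
    swapMatrix.mulVec x = ![x 1, x 0, -x 4, -x 3, -x 2, x 6, x 5] := by
  ext i
  simp only [swapMatrix, Matrix.mulVec, dotProduct, Fin.sum_univ_succ]
  fin_cases i <;> simp

theorem reflMatrix_mulVec (x : Fin 7 → ℝ) :
    reflMatrix.mulVec x = ![-x 0, x 2, x 1, x 3, x 6, -x 5, x 4] := by
  ext i
  simp only [reflMatrix, Matrix.mulVec, dotProduct, Fin.sum_univ_succ]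
  fin_cases i <;> simp

theorem oppMatrix_mulVec (x : Fin 7 → ℝ) :
    oppMatrix.mulVec x = ![x 5, x 6, x 4, -x 3, x 2, x 0, x 1] := by
  ext i
  simp only [oppMatrix, Matrix.mulVec, dotProduct, Fin.sum_univ_succ]
  fin_cases i <;> simp

/-- The torus and a shear normalise the last two coordinates to 1 and 0, a unipotent element clears
the middle block, nullity clears the first coordinate and the centre clears the second. The vector
is then the sixth basis vector, which `oppMatrix` sends to the first. -/
theorem ReachesFirst.of_sixth {x : Fin 7 → ℝ} (h5 : x 5 ≠ 0) (hx : coordMetric x x = 0) :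
    ReachesFirst x := by
  refine .of_mulVec (torusMatrix_mul_inv h5 one_ne_zero) (torusMatrix_preserves h5 one_ne_zero) ?_
  refine .of_mulVec (shearMatrix_mul_neg (x 6)) (shearMatrix_preserves _) ?_
  have h1 := (torusMatrix_preserves h5 one_ne_zero).metric x x
  rw [hx, ← (shearMatrix_preserves (x 6)).metric] at h1
  have e5 : (shearMatrix (x 6)).mulVec ((torusMatrix (x 5) 1).mulVec x) 5 = 1 := by
    rw [shearMatrix_mulVec, torusMatrix_mulVec]
    simp [h5]
  have e6 : (shearMatrix (x 6)).mulVec ((torusMatrix (x 5) 1).mulVec x) 6 = 0 := by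
    rw [shearMatrix_mulVec, torusMatrix_mulVec]
    simp [h5]
  generalize (shearMatrix (x 6)).mulVec ((torusMatrix (x 5) 1).mulVec x) = y at h1 e5 e6 ⊢
  refine .of_mulVec (unipMatrix_mul_neg 0 (y 4) (-y 3) (y 2) 0) (unipMatrix_preserves _ _ _ _ _) ?_
  rw [← (unipMatrix_preserves 0 (y 4) (-y 3) (y 2) 0).metric] at h1
  have f2 : (unipMatrix 0 (y 4) (-y 3) (y 2) 0).mulVec y 2 = 0 := by
    rw [unipMatrix_mulVec]; simp [e5, e6]
  have f3 : (unipMatrix 0 (y 4) (-y 3) (y 2) 0).mulVec y 3 = 0 := by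
    rw [unipMatrix_mulVec]; simp [e5, e6]
  have f4 : (unipMatrix 0 (y 4) (-y 3) (y 2) 0).mulVec y 4 = 0 := by
    rw [unipMatrix_mulVec]; simp [e5, e6]
  have f5 : (unipMatrix 0 (y 4) (-y 3) (y 2) 0).mulVec y 5 = 1 := by
    rw [unipMatrix_mulVec]; simp [e5]
  have f6 : (unipMatrix 0 (y 4) (-y 3) (y 2) 0).mulVec y 6 = 0 := by
    rw [unipMatrix_mulVec]; simp [e6]
  generalize (unipMatrix 0 (y 4) (-y 3) (y 2) 0).mulVec y = w at h1 f2 f3 f4 f5 f6 ⊢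
  have f0 : w 0 = 0 := by
    simp only [coordMetric, f2, f3, f4, f5, f6] at h1
    linarith
  refine .of_mulVec (unipMatrix_mul_neg 0 0 0 0 (-w 1)) (unipMatrix_preserves _ _ _ _ _) ?_
  refine .of_mulVec oppMatrix_mul_self oppMatrix_preserves ?_
  refine ⟨1, 1, Matrix.one_mul 1, ⟨fun u v => by simp only [Matrix.one_mulVec],
    fun u v w => by simp only [Matrix.one_mulVec]⟩, ?_⟩
  rw [Matrix.one_mulVec, oppMatrix_mulVec, unipMatrix_mulVec]
  simp [f0, f2, f3, f4, f5, f6]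

/-- The group of the forms acts transitively on the null vectors. -/
theorem reachesFirst_of_null {x : Fin 7 → ℝ} (h0 : x ≠ 0) (hx : coordMetric x x = 0) :
    ReachesFirst x := by
  have reach5 : ∀ y : Fin 7 → ℝ, coordMetric y y = 0 → y 5 ≠ 0 → ReachesFirst y :=
    fun y hy h => .of_sixth h hy
  -- The two reflections carry a non-zero coordinate to index 5 along the chain 0, 1, 2, 4, 6, 5.
  have viaSwap : ∀ y : Fin 7 → ℝ, coordMetric y y = 0 →
      (coordMetric (swapMatrix.mulVec y) (swapMatrix.mulVec y) = 0 →
        ReachesFirst (swapMatrix.mulVec y)) → ReachesFirst y := fun y hy h =>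
    .of_mulVec swapMatrix_mul_self swapMatrix_preserves
      (h (by rw [swapMatrix_preserves.metric, hy]))
  have viaRefl : ∀ y : Fin 7 → ℝ, coordMetric y y = 0 →
      (coordMetric (reflMatrix.mulVec y) (reflMatrix.mulVec y) = 0 →
        ReachesFirst (reflMatrix.mulVec y)) → ReachesFirst y := fun y hy h =>
    .of_mulVec reflMatrix_mul_self reflMatrix_preserves
      (h (by rw [reflMatrix_preserves.metric, hy]))
  have reach6 : ∀ y : Fin 7 → ℝ, coordMetric y y = 0 → y 6 ≠ 0 → ReachesFirst y :=
    fun y hy h => viaSwap y hy fun hy' => reach5 _ hy' (by rw [swapMatrix_mulVec]; simpa using h)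
  have reach4 : ∀ y : Fin 7 → ℝ, coordMetric y y = 0 → y 4 ≠ 0 → ReachesFirst y :=
    fun y hy h => viaRefl y hy fun hy' => reach6 _ hy' (by rw [reflMatrix_mulVec]; simpa using h)
  have reach2 : ∀ y : Fin 7 → ℝ, coordMetric y y = 0 → y 2 ≠ 0 → ReachesFirst y :=
    fun y hy h => viaSwap y hy fun hy' => reach4 _ hy' (by rw [swapMatrix_mulVec]; simpa using h)
  have reach1 : ∀ y : Fin 7 → ℝ, coordMetric y y = 0 → y 1 ≠ 0 → ReachesFirst y :=
    fun y hy h => viaRefl y hy fun hy' => reach2 _ hy' (by rw [reflMatrix_mulVec]; simpa using h)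
  have reach0 : ∀ y : Fin 7 → ℝ, coordMetric y y = 0 → y 0 ≠ 0 → ReachesFirst y :=
    fun y hy h => viaSwap y hy fun hy' => reach1 _ hy' (by rw [swapMatrix_mulVec]; simpa using h)
  by_contra hne
  have z0 : x 0 = 0 := by_contra fun h => hne (reach0 x hx h)
  have z1 : x 1 = 0 := by_contra fun h => hne (reach1 x hx h)
  have z2 : x 2 = 0 := by_contra fun h => hne (reach2 x hx h)
  have z4 : x 4 = 0 := by_contra fun h => hne (reach4 x hx h)
  have z5 : x 5 = 0 := by_contra fun h => hne (reach5 x hx h)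
  have z6 : x 6 = 0 := by_contra fun h => hne (reach6 x hx h)
  -- Only -2(x 3)² is left of the metric.
  have z3 : x 3 = 0 := by
    simp only [coordMetric, z0, z1, z2, z4, z5, z6] at hx
    nlinarith
  apply h0
  ext i
  fin_cases i <;> assumption

variable {V : Type*} [AddCommGroup V] [Module ℝ V] {e : Module.Basis (Fin 7) ℝ V}

/-- A frame whose first two vectors span the socle of `h`. -/
structure IsAdapted (e : Module.Basis (Fin 7) ℝ V) (h : LieSubalgebra ℝ (Module.End ℝ V))
    (φ : V ≃ₗ[ℝ] (Fin 7 → ℝ)) : Prop where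
  frame : IsFrame e φ
  mem_socle : ∀ v, v ∈ socle h ↔ ∀ i : Fin 7, 2 ≤ i → φ v i = 0

theorem isAdapted_of_basis [FiniteDimensional ℝ V] {h : LieSubalgebra ℝ (Module.End ℝ V)}
    {φ : V ≃ₗ[ℝ] (Fin 7 → ℝ)} (hφ : IsFrame e φ) (h2 : IsTypeII h) {u v : V} (hu0 : u ≠ 0)
    (hu : u ∈ socle h) (hv : v ∈ socle h) (hvu : v ∉ Submodule.span ℝ {u}) {s a b : ℝ}
    (hφu : φ u = ![s, 0, 0, 0, 0, 0, 0]) (hφv : φ v = ![a, b, 0, 0, 0, 0, 0]) :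
    IsAdapted e h φ := by
  have hs : s ≠ 0 := by
    rintro rfl
    refine hu0 (φ.injective ?_)
    rw [hφu, map_zero]
    ext i; fin_cases i <;> rfl
  have hb : b ≠ 0 := by
    rintro rfl
    refine hvu (Submodule.mem_span_singleton.mpr ⟨a / s, φ.injective ?_⟩)
    rw [map_smul, hφu, hφv]
    ext i; fin_cases i <;> simp [hs]
  refine ⟨hφ, fun w => ⟨fun hw => ?_, fun hw => ?_⟩⟩
  · obtain ⟨c, d, rfl⟩ := exists_coeffs_of_mem_socle h2 hu0 hu hv hvu hw
    intro i hi
    rw [map_add, map_smul, map_smul, hφu, hφv]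
    fin_cases i <;> first | (exfalso; revert hi; decide) | simp
  · have : w = ((φ w 0 - φ w 1 / b * a) / s) • u + (φ w 1 / b) • v := by
      apply φ.injective
      rw [map_add, map_smul, map_smul, hφu, hφv]
      ext i
      fin_cases i
      · simp; field_simp; ring
      · simp; field_simp
      all_goals simp
      all_goals exact hw _ (by decide)
    rw [this]
    exact add_mem (SMulMemClass.smul_mem _ hu) (SMulMemClass.smul_mem _ hv)

/-- Isotropic planes are of two kinds, according to whether ω(u, v, ·) vanishes. The non-vanishing
kind is excluded because the dual vector would be a common eigenvector that does not fit into the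
socle. -/
theorem exists_adapted_frame {h : LieSubalgebra ℝ (Module.End ℝ V)}
    (hg : h ≤ g2star e) (hind : IsIndecomposable (metric0 e) h) (h2 : IsTypeII h) :
    ∃ φ, IsAdapted e h φ := by
  have : FiniteDimensional ℝ V := Module.Basis.finiteDimensional_of_finite e
  obtain hφ₀ := isFrame_standard e
  have hiso := socle_isotropic hφ₀ hg hind h2
  generalize e.equivFun.trans (matEquiv _ _ frameMatrix_mul_inv) = φ₀ at hφ₀
  have h2' : Module.finrank ℝ (socle h).toSubmodule = 2 := h2
  -- two independent vectors in the socle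
  obtain ⟨u, hu, hu0⟩ : ∃ u ∈ (socle h).toSubmodule, u ≠ 0 :=
    Submodule.exists_mem_ne_zero_of_ne_bot fun hb => by rw [hb, finrank_bot] at h2'; omega
  obtain ⟨v, hv, hvu⟩ : ∃ v ∈ (socle h).toSubmodule, v ∉ Submodule.span ℝ {u} := by
    by_contra hc
    push Not at hc
    have := Submodule.finrank_mono (show (socle h).toSubmodule ≤ Submodule.span ℝ {u} from hc)
    rw [finrank_span_singleton hu0] at this
    omega
  have hunull : coordMetric (φ₀ u) (φ₀ u) = 0 := by rw [← hφ₀.metric, hiso u hu u hu]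
  obtain ⟨T, S, hTS, hT, hTu⟩ := reachesFirst_of_null
    (fun h0 => hu0 (φ₀.injective (by rw [h0, map_zero]))) hunull
  have hφ₁ := isFrame_trans hφ₀ hT hTS
  have hu1 : (φ₀.trans (matEquiv T S hTS)) u = ![1, 0, 0, 0, 0, 0, 0] := hTu
  generalize φ₀.trans (matEquiv T S hTS) = φ at hφ₁ hu1
  have huv := hφ₁.metric u v
  have hvv := hφ₁.metric v v
  rw [hiso u hu v hv, hu1] at huv
  rw [hiso v hv v hv] at hvv
  set y := φ v with hy
  have y5 : y 5 = 0 := by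
    simp [coordMetric] at huv
    exact huv.symm
  have hvvy : y 1 * y 6 + y 2 * y 4 - y 3 ^ 2 = 0 := by
    simp only [coordMetric, y5] at hvv
    linarith
  -- the cross product of `u` and `v`
  let n : V := φ.symm ![y 3, -y 4, y 6, 0, 0, 0, 0]
  have hcross : ∀ w, omega0 e ![u, v, w] = √2 * metric0 e n w := by
    intro w
    rw [hφ₁.form, hφ₁.metric, hu1, ← hy]
    simp only [n, LinearEquiv.apply_symm_apply, coordForm, minor3, coordMetric]
    simp [y5]
    ring_nf
  have hnd : ∀ a : V, (∀ w, metric0 e a w = 0) → a = 0 := by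
    intro a ha
    apply φ.injective
    rw [map_zero]
    refine eq_zero_of_coordMetric fun x => ?_
    have := ha (φ.symm x)
    rwa [hφ₁.metric, LinearEquiv.apply_symm_apply] at this
  -- As X preserves the form and the socle and is skew, it multiplies n by its trace on the socle.
  have hn : ∀ X ∈ h, ∃ c : ℝ, X n = c • n := by
    intro X hX
    obtain ⟨a, b, hab⟩ := exists_coeffs_of_mem_socle h2 hu0 hu hv hvu
      (lieSubmodule_stable (socle h) hX hu)
    obtain ⟨c, d, hcd⟩ := exists_coeffs_of_mem_socle h2 hu0 hu hv hvu
      (lieSubmodule_stable (socle h) hX hv)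
    refine ⟨a + d, sub_eq_zero.mp (hnd _ fun w => ?_)⟩
    have h1 := metric_skew hφ₁ (hg hX) n w
    have h3 := hg hX u v w
    have h4 : omega0 e ![X u, v, w] = a * omega0 e ![u, v, w] := by
      rw [← hab, hφ₁.form, hφ₁.form, map_add, map_smul, map_smul]
      simp only [coordForm, minor3, Pi.add_apply, Pi.smul_apply, smul_eq_mul]
      ring
    have h5 : omega0 e ![u, X v, w] = d * omega0 e ![u, v, w] := by
      rw [← hcd, hφ₁.form, hφ₁.form, map_add, map_smul, map_smul]
      simp only [coordForm, minor3, Pi.add_apply, Pi.smul_apply, smul_eq_mul]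
      ring
    rw [h4, h5, hcross, hcross] at h3
    have h6 : √2 * ((a + d) * metric0 e n w + metric0 e n (X w)) = 0 := by linarith
    have h7 := (mul_eq_zero.mp h6).resolve_left (by positivity)
    rw [map_sub, map_smul, LinearMap.sub_apply, LinearMap.smul_apply, smul_eq_mul]
    linarith
  obtain ⟨α, β, hαβ⟩ := exists_coeffs_of_mem_socle h2 hu0 hu hv hvu (mem_socle_of_eigenvector hn)
  have hc : α • φ u + β • y = ![y 3, -y 4, y 6, 0, 0, 0, 0] := by
    rw [hy, ← map_smul, ← map_smul, ← map_add, hαβ]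
    exact φ.apply_symm_apply _
  rw [hu1] at hc
  have c1 := congrFun hc 1
  have c2 := congrFun hc 2
  have c3 := congrFun hc 3
  have c4 := congrFun hc 4
  have c6 := congrFun hc 6
  simp at c1 c2 c3 c4 c6
  -- The last four coordinates of n vanish. If β ≠ 0 this kills y 3, y 4 and y 6; if β = 0 then n is
  -- a multiple of u, so y 4 = y 6 = 0, and nullity of v gives y 3 = 0.
  have hy346 : y 3 = 0 ∧ y 4 = 0 ∧ y 6 = 0 := by
    by_cases hβ : β = 0
    · have y4 : y 4 = 0 := by rw [hβ] at c1; linarith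
      have y6 : y 6 = 0 := by rw [hβ] at c2; linarith
      rw [y4, y6] at hvvy
      exact ⟨by nlinarith, y4, y6⟩
    · exact ⟨c3.resolve_left hβ, c4.resolve_left hβ, c6.resolve_left hβ⟩
  obtain ⟨y3, y4, y6⟩ := hy346
  by_cases y2 : y 2 = 0
  · refine ⟨φ, isAdapted_of_basis hφ₁ h2 hu0 hu hv hvu (a := y 0) (b := y 1) hu1 ?_⟩
    ext i; fin_cases i <;> simp [← hy, y2, y3, y4, y5, y6]
  -- The unipotent element removes y 1, and the reflection moves the third vector to the second
  -- place.
  · have hφ₂ := isFrame_trans (isFrame_trans hφ₁ (unipMatrix_preserves (-(y 1 / y 2)) 0 0 0 0)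
      (unipMatrix_mul_neg _ _ _ _ _)) reflMatrix_preserves reflMatrix_mul_self
    refine ⟨_, isAdapted_of_basis hφ₂ h2 hu0 hu hv hvu (s := -1) (a := -y 0) (b := y 2) ?_ ?_⟩
    · simp only [LinearEquiv.trans_apply, matEquiv_apply, hu1, unipMatrix_mulVec,
        reflMatrix_mulVec]
      ext i; fin_cases i <;> simp
    · simp only [LinearEquiv.trans_apply, matEquiv_apply, ← hy, unipMatrix_mulVec,
        reflMatrix_mulVec]
      ext i; fin_cases i <;> simp [y2, y3, y4, y5, y6]

end SplitG2

/-! ### Curvature tensors with values in 𝔭₂. -/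

namespace SplitG2

/-- The pair symmetry of a curvature tensor. -/
theorem curvature_pair_symm {ι : Type*} {K : ι → ι → ι → ι → ℝ}
    (h₁ : ∀ i j k l, K j i k l = -K i j k l) (h₂ : ∀ i j k l, K i j l k = -K i j k l)
    (hb : ∀ i j k l, K i j k l + K j k i l + K k i j l = 0) (i j k l : ι) :
    K i j k l = K k l i j := by
  have e1 := hb i j k l
  have e2 := hb j k l i
  have e3 := hb k l i j
  have e4 := hb l i j k
  have f1 := h₂ j k i l
  have f2 := h₂ k l j i
  have f3 := h₂ l i k j
  have f4 := h₂ i j l k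
  have g1 := h₁ k i j l
  have g2 := h₁ l j k i
  have g3 := h₁ i k l j
  have g4 := h₁ j l i k
  have g5 := h₂ j l i k
  have g6 := h₂ i k j l
  have g7 := h₂ k i l j
  have g8 := h₂ l j i k
  linarith

/-- A tensor with the symmetries of a curvature tensor and values in `𝔭₂`. -/
structure IsParabolicCurvature (K : Fin 7 → Fin 7 → Fin 7 → Fin 7 → ℝ) : Prop where
  anti₁ : ∀ i j k l, K j i k l = -K i j k l
  anti₂ : ∀ i j k l, K i j l k = -K i j k l
  bianchi : ∀ i j k l, K i j k l + K j k i l + K k i j l = 0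
  v01 : ∀ i j, K i j 0 1 = 0
  v02 : ∀ i j, K i j 0 2 = 0
  v03 : ∀ i j, K i j 0 3 = 0
  v04 : ∀ i j, K i j 0 4 = 0
  v12 : ∀ i j, K i j 1 2 = 0
  v13 : ∀ i j, K i j 1 3 = 0
  v14 : ∀ i j, K i j 1 4 = 0
  v23 : ∀ i j, K i j 2 3 = 2 * K i j 0 6
  v24 : ∀ i j, K i j 2 4 = K i j 0 5 - K i j 1 6
  v34 : ∀ i j, K i j 3 4 = -2 * K i j 1 5
  v35 : ∀ i j, K i j 3 5 = 2 * K i j 4 6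
  v36 : ∀ i j, K i j 3 6 = 2 * K i j 2 5

namespace IsParabolicCurvature

variable {K : Fin 7 → Fin 7 → Fin 7 → Fin 7 → ℝ}

theorem symm (hK : IsParabolicCurvature K) (i j k l : Fin 7) : K i j k l = K k l i j :=
  curvature_pair_symm hK.anti₁ hK.anti₂ hK.bianchi i j k l

theorem bianchi' (hK : IsParabolicCurvature K) (i j k l : Fin 7) :
    K i j k l + K j k i l - K i k j l = 0 := by
  have h1 := hK.bianchi i j k l
  have h2 := hK.anti₁ i k j l
  linarith

/-- Pair symmetry transfers the linear equations of 𝔭₂ from the second index pair to the first. -/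
theorem first_pair (hK : IsParabolicCurvature K) (i j : Fin 7) :
    K 0 1 i j = 0 ∧ K 0 2 i j = 0 ∧ K 0 3 i j = 0 ∧ K 0 4 i j = 0 ∧ K 1 2 i j = 0 ∧
      K 1 3 i j = 0 ∧ K 1 4 i j = 0 ∧ K 2 3 i j = 2 * K 0 6 i j ∧
      K 2 4 i j = K 0 5 i j - K 1 6 i j ∧ K 3 4 i j = -2 * K 1 5 i j ∧
      K 3 5 i j = 2 * K 4 6 i j ∧ K 3 6 i j = 2 * K 2 5 i j := by
  simp only [hK.symm _ _ i j, hK.v01, hK.v02, hK.v03, hK.v04, hK.v12, hK.v13, hK.v14, hK.v23,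
    hK.v24, hK.v34, hK.v35, hK.v36, and_self]

/-- Bianchi identities, rewritten in the nine index pairs that parametrise 𝔭₂. The first ten say
that components with both pairs in 𝔤𝔩(2,ℝ) vanish. -/
theorem relations (hK : IsParabolicCurvature K) :
    (K 0 5 0 5 = 0 ∧ K 0 5 1 5 = 0 ∧ K 0 5 0 6 = 0 ∧ K 0 5 1 6 = 0 ∧ K 1 5 1 5 = 0 ∧
      K 1 5 0 6 = 0 ∧ K 1 5 1 6 = 0 ∧ K 0 6 0 6 = 0 ∧ K 0 6 1 6 = 0 ∧ K 1 6 1 6 = 0) ∧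
    (K 0 6 2 5 = K 0 5 2 6 ∧ K 0 6 4 6 = K 0 5 2 5 ∧ K 0 6 4 5 = K 0 5 4 6) ∧
    (K 1 6 2 5 = K 1 5 2 6 ∧ K 1 6 4 6 = K 1 5 2 5 ∧ K 1 6 4 5 = K 1 5 4 6) ∧
    K 2 5 2 5 = K 2 6 4 6 + K 0 6 5 6 ∧ K 2 6 4 5 = K 2 5 4 6 - K 0 5 5 6 + K 1 6 5 6 ∧
      K 2 5 4 5 = K 4 6 4 6 + K 1 5 5 6 := by
  have s := hK.symm
  have b := hK.bianchi'
  have u := fun i j => hK.first_pair i j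
  simp only [forall_and] at u
  obtain ⟨u01, u02, u03, u04, u12, u13, u14, u23, u24, u34, u35, -⟩ := u
  have b0156 := b 0 1 5 6
  have b0235 := b 0 2 3 5
  have b0236 := b 0 2 3 6
  have b0245 := b 0 2 4 5
  have b0246 := b 0 2 4 6
  have b0256 := b 0 2 5 6
  have b0345 := b 0 3 4 5
  have b0346 := b 0 3 4 6
  have b0356 := b 0 3 5 6
  have b0456 := b 0 4 5 6
  have b1236 := b 1 2 3 6
  have b1245 := b 1 2 4 5
  have b1246 := b 1 2 4 6
  have b1256 := b 1 2 5 6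
  have b1345 := b 1 3 4 5
  have b1356 := b 1 3 5 6
  have b1456 := b 1 4 5 6
  have b2356 := b 2 3 5 6
  have b2456 := b 2 4 5 6
  have b3456 := b 3 4 5 6
  simp only [u01, u02, u03, u04, u12, u13, u14, u23, u24, u34, u35, hK.v36]
    at b0156 b0235 b0236 b0245 b0246 b0256 b0345 b0346 b0356 b0456 b1236 b1245 b1246 b1256 b1345
      b1356 b1456 b2356 b2456 b3456
  have s0 := s 0 6 0 5
  have s1 := s 1 6 0 5
  have s2 := s 1 5 0 5
  have s3 := s 1 5 0 6
  have s4 := s 1 6 0 6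
  have s5 := s 1 6 1 5
  have s6 := s 2 5 0 5
  have s7 := s 2 5 0 6
  have s8 := s 2 5 1 5
  have s9 := s 2 5 1 6
  have s10 := s 4 6 0 5
  have s11 := s 4 6 0 6
  have s12 := s 4 6 1 5
  have s13 := s 4 6 1 6
  have s14 := s 5 6 0 6
  have s15 := s 5 6 0 5
  have s16 := s 5 6 1 5
  have s17 := s 5 6 1 6
  have s18 := s 4 6 2 6
  have s19 := s 4 6 2 5
  have s20 := s 4 5 2 5
  have s21 := s 4 5 2 6
  have s22 := s 2 6 0 5
  have s23 := s 2 6 1 5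
  have s24 := s 4 5 0 5
  have s25 := s 4 5 0 6
  have s26 := s 4 5 1 5
  have s27 := s 4 5 1 6
  refine ⟨⟨?_, ?_, ?_, ?_, ?_, ?_, ?_, ?_, ?_, ?_⟩, ⟨?_, ?_, ?_⟩, ⟨?_, ?_, ?_⟩, ?_, ?_, ?_⟩ <;>
    linarith

end IsParabolicCurvature
end SplitG2

/-! ### Membership in 𝔥 and changes of the adapted frame. -/

namespace SplitG2

variable {V : Type*} [AddCommGroup V] [Module ℝ V] {e : Module.Basis (Fin 7) ℝ V}
  {h : LieSubalgebra ℝ (Module.End ℝ V)} {φ : V ≃ₗ[ℝ] (Fin 7 → ℝ)}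

/-- The element of `𝔭₂` with the given parameters, in the frame `φ`, lies in `h`. -/
def Mem (φ : V ≃ₗ[ℝ] (Fin 7 → ℝ)) (h : LieSubalgebra ℝ (Module.End ℝ V))
    (a₁ a₂ a₃ a₄ z₁ z₂ z₃ z₄ c : ℝ) : Prop :=
  coordEnd φ (hRat a₁ a₂ a₃ a₄ z₁ z₂ z₃ z₄ c) ∈ h

/-- The standing assumptions on `h` and the frame. -/
structure Good (e : Module.Basis (Fin 7) ℝ V) (h : LieSubalgebra ℝ (Module.End ℝ V))
    (φ : V ≃ₗ[ℝ] (Fin 7 → ℝ)) : Prop extends IsAdapted e h φ where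
  le : h ≤ g2star e
  berger : IsBerger h
  type : IsTypeII h

theorem coordEnd_add (M N : Matrix (Fin 7) (Fin 7) ℝ) :
    coordEnd φ (M + N) = coordEnd φ M + coordEnd φ N :=
  LinearMap.ext fun v => φ.injective (by
    simp only [LinearMap.add_apply, map_add, apply_coordEnd, Matrix.add_mulVec])

theorem coordEnd_smul (t : ℝ) (M : Matrix (Fin 7) (Fin 7) ℝ) :
    coordEnd φ (t • M) = t • coordEnd φ M :=
  LinearMap.ext fun v => φ.injective (by
    simp only [LinearMap.smul_apply, map_smul, apply_coordEnd, Matrix.smul_mulVec])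

theorem coordEnd_lie (M N : Matrix (Fin 7) (Fin 7) ℝ) :
    coordEnd φ (M * N - N * M) = ⁅coordEnd φ M, coordEnd φ N⁆ :=
  LinearMap.ext fun v => φ.injective (by
    simp only [LieRing.of_associative_ring_bracket, LinearMap.sub_apply, Module.End.mul_apply,
      map_sub, apply_coordEnd, Matrix.sub_mulVec, Matrix.mulVec_mulVec])

theorem coordEnd_trans {T S : Matrix (Fin 7) (Fin 7) ℝ} (hTS : T * S = 1)
    (M : Matrix (Fin 7) (Fin 7) ℝ) :
    coordEnd (φ.trans (matEquiv T S hTS)) M = coordEnd φ (S * M * T) := by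
  refine LinearMap.ext fun v => φ.injective ?_
  rw [apply_coordEnd, ← Matrix.mulVec_mulVec, ← Matrix.mulVec_mulVec, ← matEquiv_apply T S hTS,
    ← matEquiv_symm_apply T S hTS, ← LinearEquiv.trans_apply, ← apply_coordEnd]
  simp

theorem hRat_add (a₁ a₂ a₃ a₄ z₁ z₂ z₃ z₄ c b₁ b₂ b₃ b₄ w₁ w₂ w₃ w₄ d : ℝ) :
    hRat (a₁ + b₁) (a₂ + b₂) (a₃ + b₃) (a₄ + b₄) (z₁ + w₁) (z₂ + w₂) (z₃ + w₃) (z₄ + w₄) (c + d)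
      = hRat a₁ a₂ a₃ a₄ z₁ z₂ z₃ z₄ c + hRat b₁ b₂ b₃ b₄ w₁ w₂ w₃ w₄ d := by
  apply Matrix.toLin'.injective
  refine LinearMap.ext fun x => ?_
  simp only [Matrix.toLin'_apply, Matrix.add_mulVec, hRat_mulVec]
  ext i
  fin_cases i <;> simp <;> ring

theorem hRat_smul (t a₁ a₂ a₃ a₄ z₁ z₂ z₃ z₄ c : ℝ) :
    hRat (t * a₁) (t * a₂) (t * a₃) (t * a₄) (t * z₁) (t * z₂) (t * z₃) (t * z₄) (t * c)
      = t • hRat a₁ a₂ a₃ a₄ z₁ z₂ z₃ z₄ c := by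
  apply Matrix.toLin'.injective
  refine LinearMap.ext fun x => ?_
  simp only [Matrix.toLin'_apply, Matrix.smul_mulVec, hRat_mulVec]
  ext i
  fin_cases i <;> simp <;> ring

section Mem

variable {a₁ a₂ a₃ a₄ z₁ z₂ z₃ z₄ c b₁ b₂ b₃ b₄ w₁ w₂ w₃ w₄ d : ℝ}

theorem Mem.add (hx : Mem φ h a₁ a₂ a₃ a₄ z₁ z₂ z₃ z₄ c) (hy : Mem φ h b₁ b₂ b₃ b₄ w₁ w₂ w₃ w₄ d) :
    Mem φ h (a₁ + b₁) (a₂ + b₂) (a₃ + b₃) (a₄ + b₄) (z₁ + w₁) (z₂ + w₂) (z₃ + w₃) (z₄ + w₄)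
      (c + d) := by
  rw [Mem, hRat_add, coordEnd_add]
  exact add_mem hx hy

theorem Mem.smul (t : ℝ) (hx : Mem φ h a₁ a₂ a₃ a₄ z₁ z₂ z₃ z₄ c) :
    Mem φ h (t * a₁) (t * a₂) (t * a₃) (t * a₄) (t * z₁) (t * z₂) (t * z₃) (t * z₄) (t * c) := by
  rw [Mem, hRat_smul, coordEnd_smul]
  exact h.smul_mem t hx

theorem Mem.sub (hx : Mem φ h a₁ a₂ a₃ a₄ z₁ z₂ z₃ z₄ c) (hy : Mem φ h b₁ b₂ b₃ b₄ w₁ w₂ w₃ w₄ d) :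
    Mem φ h (a₁ - b₁) (a₂ - b₂) (a₃ - b₃) (a₄ - b₄) (z₁ - w₁) (z₂ - w₂) (z₃ - w₃) (z₄ - w₄)
      (c - d) := by
  convert hx.add (hy.smul (-1)) using 1 <;> ring

theorem Mem.zero : Mem φ h 0 0 0 0 0 0 0 0 0 := by
  have h0 : hRat 0 0 0 0 0 0 0 0 0 = 0 := by
    simpa using hRat_smul 0 0 0 0 0 0 0 0 0 0
  have h1 : coordEnd φ 0 = 0 := by simpa using coordEnd_smul (φ := φ) 0 0
  rw [Mem, h0, h1]
  exact h.zero_mem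

theorem Mem.lie (hx : Mem φ h a₁ a₂ a₃ a₄ z₁ z₂ z₃ z₄ c) (hy : Mem φ h b₁ b₂ b₃ b₄ w₁ w₂ w₃ w₄ d) :
    Mem φ h (a₂ * b₃ - b₂ * a₃) (a₁ * b₂ + a₂ * b₄ - b₁ * a₂ - b₂ * a₄)
        (a₃ * b₁ + a₄ * b₃ - b₃ * a₁ - b₄ * a₃) (a₃ * b₂ - b₃ * a₂)
        ((2 * a₄ - a₁) * w₁ + 3 * a₃ * w₂ - ((2 * b₄ - b₁) * z₁ + 3 * b₃ * z₂))
        (a₂ * w₁ + a₄ * w₂ + 2 * a₃ * w₃ - (b₂ * z₁ + b₄ * z₂ + 2 * b₃ * z₃))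
        (2 * a₂ * w₂ + a₁ * w₃ + a₃ * w₄ - (2 * b₂ * z₂ + b₁ * z₃ + b₃ * z₄))
        (3 * a₂ * w₃ + (2 * a₁ - a₄) * w₄ - (3 * b₂ * z₃ + (2 * b₁ - b₄) * z₄))
        ((a₁ + a₄) * d - (b₁ + b₄) * c - (z₁ * w₄ - z₄ * w₁) + 3 * (z₂ * w₃ - z₃ * w₂)) := by
  rw [Mem, ← hRat_bracket, coordEnd_lie]
  exact h.lie_mem hx hy

end Mem

namespace Good

theorem trans (G : Good e h φ) {T S : Matrix (Fin 7) (Fin 7) ℝ} (hT : PreservesForms T)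
    (hTS : T * S = 1) (h0 : ∀ x, (∀ i : Fin 7, 2 ≤ i → T.mulVec x i = 0) ↔
      ∀ i : Fin 7, 2 ≤ i → x i = 0) : Good e h (φ.trans (matEquiv T S hTS)) where
  frame := isFrame_trans G.frame hT hTS
  mem_socle v := by
    simp only [LinearEquiv.trans_apply, matEquiv_apply]
    rw [h0, G.mem_socle]
  le := G.le
  berger := G.berger
  type := G.type

theorem forall_ge_two {x : Fin 7 → ℝ} : (∀ i : Fin 7, 2 ≤ i → x i = 0) ↔
    x 2 = 0 ∧ x 3 = 0 ∧ x 4 = 0 ∧ x 5 = 0 ∧ x 6 = 0 := by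
  constructor
  · intro hx
    exact ⟨hx 2 (by decide), hx 3 (by decide), hx 4 (by decide), hx 5 (by decide),
      hx 6 (by decide)⟩
  · rintro ⟨h2, h3, h4, h5, h6⟩ i hi
    fin_cases i <;> first | (exfalso; revert hi; decide) | assumption

theorem swap (G : Good e h φ) : ∃ ψ, Good e h ψ ∧ ∀ a₁ a₂ a₃ a₄ z₁ z₂ z₃ z₄ c,
    Mem ψ h a₁ a₂ a₃ a₄ z₁ z₂ z₃ z₄ c ↔
      Mem φ h a₄ a₃ a₂ a₁ (-z₄) (-z₃) (-z₂) (-z₁) (-c) := by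
  refine ⟨_, G.trans swapMatrix_preserves swapMatrix_mul_self fun x => ?_,
    fun a₁ a₂ a₃ a₄ z₁ z₂ z₃ z₄ c => ?_⟩
  · rw [forall_ge_two, forall_ge_two, swapMatrix_mulVec]
    simp
    tauto
  · rw [Mem, Mem, coordEnd_trans, swapMatrix_conj]

theorem torus (G : Good e h φ) {l m : ℝ} (hl : l ≠ 0) (hm : m ≠ 0) :
    ∃ ψ, Good e h ψ ∧ ∀ a₁ a₂ a₃ a₄ z₁ z₂ z₃ z₄ c, Mem ψ h a₁ a₂ a₃ a₄ z₁ z₂ z₃ z₄ c ↔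
      Mem φ h a₁ (l / m * a₂) (m / l * a₃) a₄ (m ^ 2 / l * z₁) (m * z₂) (l * z₃) (l ^ 2 / m * z₄)
        (l * m * c) := by
  refine ⟨_, G.trans (torusMatrix_preserves (inv_ne_zero hl) (inv_ne_zero hm))
    (torusMatrix_inv_mul hl hm) fun x => ?_, fun a₁ a₂ a₃ a₄ z₁ z₂ z₃ z₄ c => ?_⟩
  · rw [forall_ge_two, forall_ge_two, torusMatrix_mulVec]
    simp [hl, hm]
  · rw [Mem, Mem, coordEnd_trans, torusMatrix_conj hl hm]

theorem shear (G : Good e h φ) (t : ℝ) :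
    ∃ ψ, Good e h ψ ∧ ∀ a₁ a₂ a₃ a₄ z₁ z₂ z₃ z₄ c, Mem ψ h a₁ a₂ a₃ a₄ z₁ z₂ z₃ z₄ c ↔
      Mem φ h (a₁ + t * a₃) (a₂ + t * (a₄ - a₁) - t ^ 2 * a₃) a₃ (a₄ - t * a₃) z₁ (z₂ + t * z₁)
        (z₃ + 2 * t * z₂ + t ^ 2 * z₁) (z₄ + 3 * t * z₃ + 3 * t ^ 2 * z₂ + t ^ 3 * z₁) c := by
  refine ⟨_, G.trans (shearMatrix_preserves (-t)) (shearMatrix_neg_mul t) fun x => ?_,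
    fun a₁ a₂ a₃ a₄ z₁ z₂ z₃ z₄ c => ?_⟩
  · rw [forall_ge_two, forall_ge_two, shearMatrix_mulVec]
    simp
    constructor
    · rintro ⟨h2, h3, h4, h5, h6⟩
      simp_all
    · rintro ⟨h2, h3, h4, h5, h6⟩
      simp_all
  · rw [Mem, Mem, coordEnd_trans, shearMatrix_conj]

theorem unip (G : Good e h φ) (n₁ n₂ n₃ n₄ m : ℝ) :
    ∃ ψ, Good e h ψ ∧ ∀ a₁ a₂ a₃ a₄ z₁ z₂ z₃ z₄ c, Mem ψ h a₁ a₂ a₃ a₄ z₁ z₂ z₃ z₄ c ↔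
      Mem φ h a₁ a₂ a₃ a₄
        (z₁ - ((2 * a₄ - a₁) * n₁ + 3 * a₃ * n₂))
        (z₂ - (a₂ * n₁ + a₄ * n₂ + 2 * a₃ * n₃))
        (z₃ - (2 * a₂ * n₂ + a₁ * n₃ + a₃ * n₄))
        (z₄ - (3 * a₂ * n₃ + (2 * a₁ - a₄) * n₄))
        (c - (a₁ + a₄) * m
          - (n₁ * (z₄ - (3 * a₂ * n₃ + (2 * a₁ - a₄) * n₄) / 2)
            - n₄ * (z₁ - ((2 * a₄ - a₁) * n₁ + 3 * a₃ * n₂) / 2))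
          + 3 * (n₂ * (z₃ - (2 * a₂ * n₂ + a₁ * n₃ + a₃ * n₄) / 2)
            - n₃ * (z₂ - (a₂ * n₁ + a₄ * n₂ + 2 * a₃ * n₃) / 2))) := by
  refine ⟨_, G.trans (unipMatrix_preserves (-n₁) (-n₂) (-n₃) (-n₄) (-m))
    (unipMatrix_neg_mul n₁ n₂ n₃ n₄ m) fun x => ?_, fun a₁ a₂ a₃ a₄ z₁ z₂ z₃ z₄ c => ?_⟩
  · rw [forall_ge_two, forall_ge_two, unipMatrix_mulVec]
    simp
    constructor
    · rintro ⟨h2, h3, h4, h5, h6⟩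
      simp_all
    · rintro ⟨h2, h3, h4, h5, h6⟩
      simp_all
  · rw [Mem, Mem, coordEnd_trans, unipMatrix_conj]

/-- `h` is contained in `𝔭₂`. -/
theorem exists_params (G : Good e h φ) {X : Module.End ℝ V} (hX : X ∈ h) :
    ∃ a₁ a₂ a₃ a₄ z₁ z₂ z₃ z₄ c, X = coordEnd φ (hRat a₁ a₂ a₃ a₄ z₁ z₂ z₃ z₄ c) := by
  have hcol : ∀ j : Fin 7, j < 2 → ∀ i : Fin 7, 2 ≤ i → endMatrix φ X i j = 0 := by
    intro j hj i hi
    have hmem : φ.symm (Pi.single j 1) ∈ socle h := by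
      rw [G.mem_socle]
      intro k hk
      rw [LinearEquiv.apply_symm_apply, Pi.single_eq_of_ne
        (by rintro rfl; exact absurd hj (not_lt.mpr hk))]
    have h1 := (G.mem_socle _).mp (lieSubmodule_stable (socle h) hX hmem) i hi
    rwa [apply_eq_endMatrix, LinearEquiv.apply_symm_apply, Matrix.mulVec_single_one] at h1
  have h2 := eq_hRat_of_stabilizer (endMatrix_stabilizes G.frame (G.le hX))
    fun i hi => ⟨hcol 0 (by decide) i hi, hcol 1 (by decide) i hi⟩
  exact ⟨_, _, _, _, _, _, _, _, _, (coordEnd_endMatrix φ X).symm.trans (congrArg _ h2)⟩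

end Good

end SplitG2

/-! ### The socle condition and Berger's criterion in coordinates. -/

namespace SplitG2

variable {V : Type*} [AddCommGroup V] [Module ℝ V] {e : Module.Basis (Fin 7) ℝ V}
  {h : LieSubalgebra ℝ (Module.End ℝ V)} {φ : V ≃ₗ[ℝ] (Fin 7 → ℝ)}

/-- A vector of the middle block that is a common eigenvector of `h` vanishes. -/
theorem Good.middle_eq_zero (G : Good e h φ) {x₃ x₄ x₅ : ℝ}
    (H : ∀ a₁ a₂ a₃ a₄ z₁ z₂ z₃ z₄ c, Mem φ h a₁ a₂ a₃ a₄ z₁ z₂ z₃ z₄ c →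
      z₂ * x₃ + 2 * z₃ * x₄ + z₄ * x₅ = 0 ∧ z₁ * x₃ + 2 * z₂ * x₄ + z₃ * x₅ = 0 ∧
      ∃ t, (a₁ - a₄) * x₃ - 2 * a₂ * x₄ = t * x₃ ∧ -a₃ * x₃ - a₂ * x₅ = t * x₄ ∧
        -2 * a₃ * x₄ + (a₄ - a₁) * x₅ = t * x₅) : x₃ = 0 ∧ x₄ = 0 ∧ x₅ = 0 := by
  have hs : φ.symm ![0, 0, x₃, x₄, x₅, 0, 0] ∈ socle h := by
    refine mem_socle_of_eigenvector fun X hX => ?_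
    obtain ⟨a₁, a₂, a₃, a₄, z₁, z₂, z₃, z₄, c, rfl⟩ := G.exists_params hX
    obtain ⟨h1, h2, t, h3, h4, h5⟩ := H _ _ _ _ _ _ _ _ _ hX
    refine ⟨t, φ.injective ?_⟩
    rw [apply_coordEnd, map_smul, LinearEquiv.apply_symm_apply, hRat_mulVec]
    ext i
    fin_cases i <;> simp <;> linarith
  have h0 := (G.mem_socle _).mp hs
  rw [LinearEquiv.apply_symm_apply, Good.forall_ge_two] at h0
  exact ⟨h0.1, h0.2.1, h0.2.2.1⟩

/-- The socle is a semisimple module. -/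
theorem Good.exists_shear (G : Good e h φ)
    (H : ∀ a₁ a₂ a₃ a₄ z₁ z₂ z₃ z₄ c, Mem φ h a₁ a₂ a₃ a₄ z₁ z₂ z₃ z₄ c → a₃ = 0) :
    ∃ t, ∀ a₁ a₂ a₃ a₄ z₁ z₂ z₃ z₄ c, Mem φ h a₁ a₂ a₃ a₄ z₁ z₂ z₃ z₄ c →
      a₂ = t * (a₄ - a₁) := by
  have : FiniteDimensional ℝ V := Module.Basis.finiteDimensional_of_finite e
  have hx0 : φ.symm ![1, 0, 0, 0, 0, 0, 0] ≠ 0 := by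
    intro h0
    have := congrFun ((LinearEquiv.symm_apply_eq _).mp h0) 0
    simp at this
  -- The first basis vector is a common eigenvector, hence so is some independent socle vector y;
  -- the slope of y is the shear.
  obtain ⟨y, hyS, hyx, hy⟩ := exists_eigenvector_complement G.type hx0 fun X hX => by
    obtain ⟨a₁, a₂, a₃, a₄, z₁, z₂, z₃, z₄, c, rfl⟩ := G.exists_params hX
    have h3 := H _ _ _ _ _ _ _ _ _ hX
    refine ⟨a₁, φ.injective ?_⟩
    rw [apply_coordEnd, map_smul, LinearEquiv.apply_symm_apply, hRat_mulVec, h3]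
    ext i
    fin_cases i <;> simp
  have hy2 := Good.forall_ge_two.mp ((G.mem_socle y).mp hyS)
  obtain ⟨e2, e3, e4, e5, e6⟩ := hy2
  have hy1 : φ y 1 ≠ 0 := by
    intro h1
    refine hyx (Submodule.mem_span_singleton.mpr ⟨φ y 0, φ.injective ?_⟩)
    rw [map_smul, LinearEquiv.apply_symm_apply]
    ext i
    fin_cases i <;> simp [h1, e2, e3, e4, e5, e6]
  refine ⟨φ y 0 / φ y 1, fun a₁ a₂ a₃ a₄ z₁ z₂ z₃ z₄ c hm => ?_⟩
  have h3 := H _ _ _ _ _ _ _ _ _ hm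
  obtain ⟨t, ht⟩ := hy _ hm
  have ht' := congrArg φ ht
  rw [apply_coordEnd, map_smul, hRat_mulVec] at ht'
  have t0 := congrFun ht' 0
  have t1 := congrFun ht' 1
  simp [e2, e3, e4, e5, e6, h3, hy1] at t0 t1
  field_simp
  rw [← t1] at t0
  linarith

/-- The values of a curvature map of `𝔥`: the parameters `p, q` have degree one, `s, r` have
degree two, `v` has degree three and `w` degree four. -/
structure Curv (φ : V ≃ₗ[ℝ] (Fin 7 → ℝ)) (h : LieSubalgebra ℝ (Module.End ℝ V))
    (p₀ p₁ p₂ p₃ p₄ q₀ q₁ q₂ q₃ q₄ s₀ s₁ s₂ s₃ s₄ s₅ s₆ r₁ r₂ r₃ r₄ v₁ v₂ v₃ v₄ w : ℝ) :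
    Prop where
  m16 : Mem φ h 0 0 0 0 p₁ p₂ p₃ p₄ r₁
  m26 : Mem φ h 0 0 0 0 q₁ q₂ q₃ q₄ r₂
  m17 : Mem φ h 0 0 0 0 p₀ p₁ p₂ p₃ r₃
  m27 : Mem φ h 0 0 0 0 q₀ q₁ q₂ q₃ r₄
  m37 : Mem φ h p₁ q₁ p₀ q₀ s₀ s₁ s₂ (s₃ - r₁ + r₄) v₁
  m36 : Mem φ h p₂ q₂ p₁ q₁ s₁ (s₂ + r₃) s₃ (s₄ + r₂) v₂
  m57 : Mem φ h p₃ q₃ p₂ q₂ s₂ s₃ s₄ s₅ v₃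
  m56 : Mem φ h p₄ q₄ p₃ q₃ (s₃ - r₁ + r₄) (s₄ + r₂) s₅ s₆ v₄
  m67 : Mem φ h r₁ r₂ r₃ r₄ v₁ v₂ v₃ v₄ w

/-- A linear form on the parameters of `𝔭₂`. -/
def linForm (l : Fin 9 → ℝ) (a₁ a₂ a₃ a₄ z₁ z₂ z₃ z₄ c : ℝ) : ℝ :=
  l 0 * a₁ + l 1 * a₂ + l 2 * a₃ + l 3 * a₄ + l 4 * z₁ + l 5 * z₂ + l 6 * z₃ + l 7 * z₄ + l 8 * c

theorem hRat_injective {a₁ a₂ a₃ a₄ z₁ z₂ z₃ z₄ c b₁ b₂ b₃ b₄ w₁ w₂ w₃ w₄ d : ℝ}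
    (H : coordEnd φ (hRat a₁ a₂ a₃ a₄ z₁ z₂ z₃ z₄ c)
      = coordEnd φ (hRat b₁ b₂ b₃ b₄ w₁ w₂ w₃ w₄ d)) :
    a₁ = b₁ ∧ a₂ = b₂ ∧ a₃ = b₃ ∧ a₄ = b₄ ∧ z₁ = w₁ ∧ z₂ = w₂ ∧ z₃ = w₃ ∧ z₄ = w₄ ∧ c = d := by
  have E : ∀ x, (hRat a₁ a₂ a₃ a₄ z₁ z₂ z₃ z₄ c).mulVec x
      = (hRat b₁ b₂ b₃ b₄ w₁ w₂ w₃ w₄ d).mulVec x := by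
    intro x
    have := congrArg φ (LinearMap.congr_fun H (φ.symm x))
    rwa [apply_coordEnd, apply_coordEnd, LinearEquiv.apply_symm_apply] at this
  simp only [hRat_mulVec] at E
  have e0 := E ![1, 0, 0, 0, 0, 0, 0]
  have e1 := E ![0, 1, 0, 0, 0, 0, 0]
  have e2 := E ![0, 0, 1, 0, 0, 0, 0]
  have e4 := E ![0, 0, 0, 0, 1, 0, 0]
  have e6 := E ![0, 0, 0, 0, 0, 0, 1]
  simp at e0 e1 e2 e4 e6
  tauto

/-- The curvature map `R` in coordinates. -/
noncomputable def curvTensor (φ : V ≃ₗ[ℝ] (Fin 7 → ℝ)) (R : V →ₗ[ℝ] V →ₗ[ℝ] Module.End ℝ V)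
    (i j k l : Fin 7) : ℝ :=
  coordMetric (φ (R (φ.symm (Pi.single i 1)) (φ.symm (Pi.single j 1)) (φ.symm (Pi.single k 1))))
    (Pi.single l 1)

/-- Each parameter of an element X of 𝔭₂ is a pairing of X applied to a basis vector with a basis
vector, for instance a₁ with indices 0 and 5. -/
theorem Good.curvTensor_eq (G : Good e h φ) {R : V →ₗ[ℝ] V →ₗ[ℝ] Module.End ℝ V}
    (hR : R ∈ curvatureMaps h) : IsParabolicCurvature (curvTensor φ R) ∧ ∀ i j,
      R (φ.symm (Pi.single i 1)) (φ.symm (Pi.single j 1)) = coordEnd φ (hRat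
        (curvTensor φ R i j 0 5) (curvTensor φ R i j 1 5) (curvTensor φ R i j 0 6)
        (curvTensor φ R i j 1 6) (curvTensor φ R i j 2 6) (curvTensor φ R i j 2 5)
        (curvTensor φ R i j 4 6) (curvTensor φ R i j 4 5) (curvTensor φ R i j 5 6)) := by
  obtain ⟨hR0, hRh, hRb⟩ := hR
  have par : ∀ i j, ∃ a₁ a₂ a₃ a₄ z₁ z₂ z₃ z₄ c,
      R (φ.symm (Pi.single i 1)) (φ.symm (Pi.single j 1))
        = coordEnd φ (hRat a₁ a₂ a₃ a₄ z₁ z₂ z₃ z₄ c) := fun i j => G.exists_params (hRh _ _)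
  choose a₁ a₂ a₃ a₄ z₁ z₂ z₃ z₄ c hpar using par
  have hK : ∀ i j k l, curvTensor φ R i j k l = coordMetric
      ((hRat (a₁ i j) (a₂ i j) (a₃ i j) (a₄ i j) (z₁ i j) (z₂ i j) (z₃ i j) (z₄ i j)
        (c i j)).mulVec (Pi.single k 1)) (Pi.single l 1) := by
    intro i j k l
    rw [curvTensor, hpar, apply_coordEnd, LinearEquiv.apply_symm_apply]
  have hswap : ∀ x y, R y x = -R x y := by
    intro x y
    have h1 := hR0 (x + y)
    simp only [map_add, LinearMap.add_apply, hR0, zero_add, add_zero] at h1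
    exact eq_neg_of_add_eq_zero_left h1
  refine ⟨⟨fun i j k l => ?_, fun i j k l => ?_, fun i j k l => ?_, ?_, ?_, ?_, ?_, ?_, ?_, ?_, ?_,
    ?_, ?_, ?_, ?_⟩, fun i j => ?_⟩
  · rw [curvTensor, curvTensor, hswap]
    simp only [LinearMap.neg_apply, map_neg, coordMetric, Pi.neg_apply]
    ring
  · have h1 := metric_skew G.frame (G.le (hRh (φ.symm (Pi.single i 1)) (φ.symm (Pi.single j 1))))
      (φ.symm (Pi.single k 1)) (φ.symm (Pi.single l 1))
    rw [G.frame.metric, G.frame.metric, LinearEquiv.apply_symm_apply, LinearEquiv.apply_symm_apply,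
      coordMetric_comm (Pi.single k 1)] at h1
    rw [curvTensor, curvTensor]
    linarith
  · have h1 := congrArg (fun v => coordMetric (φ v) (Pi.single l 1))
      (hRb (φ.symm (Pi.single i 1)) (φ.symm (Pi.single j 1)) (φ.symm (Pi.single k 1)))
    simp only [map_add, map_zero, coordMetric, Pi.add_apply, Pi.zero_apply] at h1
    simp only [curvTensor, coordMetric]
    linarith
  on_goal 13 =>
    rw [hpar]
    congr 2 <;> simp only [hK, hRat_mulVec, coordMetric] <;> simp
  all_goals
    intro i j
    simp only [hK, hRat_mulVec, coordMetric]
    simp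

theorem coordinates_sum (φ : V ≃ₗ[ℝ] (Fin 7 → ℝ)) (x : V) :
    x = ∑ i, φ x i • φ.symm (Pi.single i 1) := by
  apply φ.injective
  simp only [map_sum, map_smul, LinearEquiv.apply_symm_apply]
  ext j
  simp [Finset.sum_apply, Pi.single_apply]

/-- The function F is arbitrary so that one computation serves both membership in 𝔥 and evaluation
of linear forms. -/
theorem IsParabolicCurvature.rows {K : Fin 7 → Fin 7 → Fin 7 → Fin 7 → ℝ}
    (hK : IsParabolicCurvature K) {α : Sort*} (F : ℝ → ℝ → ℝ → ℝ → ℝ → ℝ → ℝ → ℝ → ℝ → α)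
    (f : Fin 7 → Fin 7 → α) (hf : ∀ i j, f i j = F (K i j 0 5) (K i j 1 5) (K i j 0 6) (K i j 1 6)
      (K i j 2 6) (K i j 2 5) (K i j 4 6) (K i j 4 5) (K i j 5 6)) :
    f 0 5 = F 0 0 0 0 (K 0 5 2 6) (K 0 5 2 5) (K 0 5 4 6) (K 0 5 4 5) (K 0 5 5 6) ∧
    f 1 5 = F 0 0 0 0 (K 1 5 2 6) (K 1 5 2 5) (K 1 5 4 6) (K 1 5 4 5) (K 1 5 5 6) ∧
    f 0 6 = F 0 0 0 0 (K 0 6 2 6) (K 0 5 2 6) (K 0 5 2 5) (K 0 5 4 6) (K 0 6 5 6) ∧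
    f 1 6 = F 0 0 0 0 (K 1 6 2 6) (K 1 5 2 6) (K 1 5 2 5) (K 1 5 4 6) (K 1 6 5 6) ∧
    f 2 6 = F (K 0 5 2 6) (K 1 5 2 6) (K 0 6 2 6) (K 1 6 2 6) (K 2 6 2 6) (K 2 6 2 5) (K 2 6 4 6)
      (K 2 5 4 6 - K 0 5 5 6 + K 1 6 5 6) (K 2 6 5 6) ∧
    f 2 5 = F (K 0 5 2 5) (K 1 5 2 5) (K 0 5 2 6) (K 1 5 2 6) (K 2 6 2 5) (K 2 6 4 6 + K 0 6 5 6)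
      (K 2 5 4 6) (K 4 6 4 6 + K 1 5 5 6) (K 2 5 5 6) ∧
    f 4 6 = F (K 0 5 4 6) (K 1 5 4 6) (K 0 5 2 5) (K 1 5 2 5) (K 2 6 4 6) (K 2 5 4 6) (K 4 6 4 6)
      (K 4 6 4 5) (K 4 6 5 6) ∧
    f 4 5 = F (K 0 5 4 5) (K 1 5 4 5) (K 0 5 4 6) (K 1 5 4 6) (K 2 5 4 6 - K 0 5 5 6 + K 1 6 5 6)
      (K 4 6 4 6 + K 1 5 5 6) (K 4 6 4 5) (K 4 5 4 5) (K 4 5 5 6) ∧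
    f 5 6 = F (K 0 5 5 6) (K 1 5 5 6) (K 0 6 5 6) (K 1 6 5 6) (K 2 6 5 6) (K 2 5 5 6) (K 4 6 5 6)
      (K 4 5 5 6) (K 5 6 5 6) := by
  have hs := hK.symm
  obtain ⟨⟨n1, n2, n3, n4, n5, n6, n7, n8, n9, n10⟩, ⟨f1, f2, f3⟩, ⟨g1, g2, g3⟩, k1, k2, k3⟩ :=
    hK.relations
  refine ⟨?_, ?_, ?_, ?_, ?_, ?_, ?_, ?_, ?_⟩ <;> rw [hf]
  · simp only [n1, n2, n3, n4]
  · simp only [hs 1 5 0 5, n2, n5, n6, n7]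
  · simp only [hs 0 6 0 5, hs 0 6 1 5, n3, n6, n8, n9, f1, f2, f3]
  · simp only [hs 1 6 0 5, hs 1 6 1 5, hs 1 6 0 6, n4, n7, n9, n10, g1, g2, g3]
  · simp only [hs 2 6 0 5, hs 2 6 1 5, hs 2 6 0 6, hs 2 6 1 6, k2]
  · simp only [hs 2 5 0 5, hs 2 5 1 5, hs 2 5 0 6, hs 2 5 1 6, hs 2 5 2 6, f1, g1, k1, k3]
  · simp only [hs 4 6 0 5, hs 4 6 1 5, hs 4 6 0 6, hs 4 6 1 6, hs 4 6 2 6, hs 4 6 2 5, f2, g2]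
  · simp only [hs 4 5 0 5, hs 4 5 1 5, hs 4 5 0 6, hs 4 5 1 6, hs 4 5 2 6, hs 4 5 2 5, hs 4 5 4 6,
      f3, g3, k2, k3]
  · simp only [hs 5 6 0 5, hs 5 6 1 5, hs 5 6 0 6, hs 5 6 1 6, hs 5 6 2 6, hs 5 6 2 5, hs 5 6 4 6,
      hs 5 6 4 5]

theorem IsParabolicCurvature.curv {K : Fin 7 → Fin 7 → Fin 7 → Fin 7 → ℝ}
    (hK : IsParabolicCurvature K)
    (hmem : ∀ i j, Mem φ h (K i j 0 5) (K i j 1 5) (K i j 0 6) (K i j 1 6) (K i j 2 6)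
      (K i j 2 5) (K i j 4 6) (K i j 4 5) (K i j 5 6)) :
    Curv φ h (K 0 6 2 6) (K 0 5 2 6) (K 0 5 2 5) (K 0 5 4 6) (K 0 5 4 5)
      (K 1 6 2 6) (K 1 5 2 6) (K 1 5 2 5) (K 1 5 4 6) (K 1 5 4 5)
      (K 2 6 2 6) (K 2 6 2 5) (K 2 6 4 6) (K 2 5 4 6) (K 4 6 4 6) (K 4 6 4 5) (K 4 5 4 5)
      (K 0 5 5 6) (K 1 5 5 6) (K 0 6 5 6) (K 1 6 5 6)
      (K 2 6 5 6) (K 2 5 5 6) (K 4 6 5 6) (K 4 5 5 6) (K 5 6 5 6) := by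
  obtain ⟨r1, r2, r3, r4, r5, r6, r7, r8, r9⟩ := hK.rows (Mem φ h) _ fun _ _ => rfl
  exact ⟨r1 ▸ hmem 0 5, r2 ▸ hmem 1 5, r3 ▸ hmem 0 6, r4 ▸ hmem 1 6, r5 ▸ hmem 2 6, r6 ▸ hmem 2 5,
    r7 ▸ hmem 4 6, r8 ▸ hmem 4 5, r9 ▸ hmem 5 6⟩

/-- By `first_pair` every other row is zero or a combination of the nine basic ones. -/
theorem IsParabolicCurvature.linForm_eq_zero {K : Fin 7 → Fin 7 → Fin 7 → Fin 7 → ℝ}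
    (hK : IsParabolicCurvature K) (l : Fin 9 → ℝ)
    (hl : linForm l 0 0 0 0 (K 0 5 2 6) (K 0 5 2 5) (K 0 5 4 6) (K 0 5 4 5) (K 0 5 5 6) = 0 ∧
    linForm l 0 0 0 0 (K 1 5 2 6) (K 1 5 2 5) (K 1 5 4 6) (K 1 5 4 5) (K 1 5 5 6) = 0 ∧
    linForm l 0 0 0 0 (K 0 6 2 6) (K 0 5 2 6) (K 0 5 2 5) (K 0 5 4 6) (K 0 6 5 6) = 0 ∧
    linForm l 0 0 0 0 (K 1 6 2 6) (K 1 5 2 6) (K 1 5 2 5) (K 1 5 4 6) (K 1 6 5 6) = 0 ∧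
    linForm l (K 0 5 2 6) (K 1 5 2 6) (K 0 6 2 6) (K 1 6 2 6) (K 2 6 2 6) (K 2 6 2 5) (K 2 6 4 6)
      (K 2 5 4 6 - K 0 5 5 6 + K 1 6 5 6) (K 2 6 5 6) = 0 ∧
    linForm l (K 0 5 2 5) (K 1 5 2 5) (K 0 5 2 6) (K 1 5 2 6) (K 2 6 2 5) (K 2 6 4 6 + K 0 6 5 6)
      (K 2 5 4 6) (K 4 6 4 6 + K 1 5 5 6) (K 2 5 5 6) = 0 ∧
    linForm l (K 0 5 4 6) (K 1 5 4 6) (K 0 5 2 5) (K 1 5 2 5) (K 2 6 4 6) (K 2 5 4 6) (K 4 6 4 6)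
      (K 4 6 4 5) (K 4 6 5 6) = 0 ∧
    linForm l (K 0 5 4 5) (K 1 5 4 5) (K 0 5 4 6) (K 1 5 4 6)
      (K 2 5 4 6 - K 0 5 5 6 + K 1 6 5 6) (K 4 6 4 6 + K 1 5 5 6) (K 4 6 4 5) (K 4 5 4 5)
      (K 4 5 5 6) = 0 ∧
    linForm l (K 0 5 5 6) (K 1 5 5 6) (K 0 6 5 6) (K 1 6 5 6) (K 2 6 5 6) (K 2 5 5 6) (K 4 6 5 6)
      (K 4 5 5 6) (K 5 6 5 6) = 0) (i j : Fin 7) (hij : i < j) :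
    linForm l (K i j 0 5) (K i j 1 5) (K i j 0 6) (K i j 1 6)
      (K i j 2 6) (K i j 2 5) (K i j 4 6) (K i j 4 5) (K i j 5 6) = 0 := by
  obtain ⟨f, hf⟩ : ∃ f : Fin 7 → Fin 7 → ℝ, ∀ i j, f i j = linForm l (K i j 0 5) (K i j 1 5)
    (K i j 0 6) (K i j 1 6) (K i j 2 6) (K i j 2 5) (K i j 4 6) (K i j 4 5) (K i j 5 6) :=
    ⟨_, fun _ _ => rfl⟩
  obtain ⟨r1, r2, r3, r4, r5, r6, r7, r8, r9⟩ := hK.rows (linForm l) f hf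
  rw [← r1, ← r2, ← r3, ← r4, ← r5, ← r6, ← r7, ← r8, ← r9] at hl
  obtain ⟨l1, l2, l3, l4, l5, l6, l7, l8, l9⟩ := hl
  have hu : f 0 1 = 0 ∧ f 0 2 = 0 ∧ f 0 3 = 0 ∧ f 0 4 = 0 ∧ f 1 2 = 0 ∧ f 1 3 = 0 ∧ f 1 4 = 0 ∧
      f 2 3 = 2 * f 0 6 ∧ f 2 4 = f 0 5 - f 1 6 ∧ f 3 4 = -2 * f 1 5 ∧ f 3 5 = 2 * f 4 6 ∧
      f 3 6 = 2 * f 2 5 := by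
    have hu := fun i j => hK.first_pair i j
    simp only [forall_and] at hu
    obtain ⟨u01, u02, u03, u04, u12, u13, u14, u23, u24, u34, u35, u36⟩ := hu
    simp only [hf, linForm]
    refine ⟨?_, ?_, ?_, ?_, ?_, ?_, ?_, ?_, ?_, ?_, ?_, ?_⟩
    · simp only [u01]; ring
    · simp only [u02]; ring
    · simp only [u03]; ring
    · simp only [u04]; ring
    · simp only [u12]; ring
    · simp only [u13]; ring
    · simp only [u14]; ring
    · simp only [u23]; ring
    · simp only [u24]; ring
    · simp only [u34]; ring
    · simp only [u35]; ring
    · simp only [u36]; ring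
  obtain ⟨u01, u02, u03, u04, u12, u13, u14, u23, u24, u34, u35, u36⟩ := hu
  simp only [l1, l2, l3, l4, l6, l7, mul_zero, sub_zero] at u23 u24 u34 u35 u36
  rw [← hf]
  clear hf r1 r2 r3 r4 r5 r6 r7 r8 r9
  fin_cases i <;> fin_cases j <;> first
    | assumption
    | exact absurd hij (by decide)

/-- A linear form that vanishes on the values of all curvature maps vanishes on `𝔥`. -/
theorem Good.linForm_eq_zero (G : Good e h φ) (l : Fin 9 → ℝ)
    (H : ∀ p₀ p₁ p₂ p₃ p₄ q₀ q₁ q₂ q₃ q₄ s₀ s₁ s₂ s₃ s₄ s₅ s₆ r₁ r₂ r₃ r₄ v₁ v₂ v₃ v₄ w,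
      Curv φ h p₀ p₁ p₂ p₃ p₄ q₀ q₁ q₂ q₃ q₄ s₀ s₁ s₂ s₃ s₄ s₅ s₆ r₁ r₂ r₃ r₄ v₁ v₂ v₃ v₄ w →
      linForm l 0 0 0 0 p₁ p₂ p₃ p₄ r₁ = 0 ∧ linForm l 0 0 0 0 q₁ q₂ q₃ q₄ r₂ = 0 ∧
      linForm l 0 0 0 0 p₀ p₁ p₂ p₃ r₃ = 0 ∧ linForm l 0 0 0 0 q₀ q₁ q₂ q₃ r₄ = 0 ∧
      linForm l p₁ q₁ p₀ q₀ s₀ s₁ s₂ (s₃ - r₁ + r₄) v₁ = 0 ∧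
      linForm l p₂ q₂ p₁ q₁ s₁ (s₂ + r₃) s₃ (s₄ + r₂) v₂ = 0 ∧
      linForm l p₃ q₃ p₂ q₂ s₂ s₃ s₄ s₅ v₃ = 0 ∧
      linForm l p₄ q₄ p₃ q₃ (s₃ - r₁ + r₄) (s₄ + r₂) s₅ s₆ v₄ = 0 ∧
      linForm l r₁ r₂ r₃ r₄ v₁ v₂ v₃ v₄ w = 0)
    {a₁ a₂ a₃ a₄ z₁ z₂ z₃ z₄ c : ℝ} (hm : Mem φ h a₁ a₂ a₃ a₄ z₁ z₂ z₃ z₄ c) :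
    linForm l a₁ a₂ a₃ a₄ z₁ z₂ z₃ z₄ c = 0 := by
  -- U is the part of 𝔭₂ on which the form vanishes. It contains all curvature values on coordinate
  -- vectors, hence their span, which is 𝔥 by Berger's criterion.
  let U : Submodule ℝ (Module.End ℝ V) :=
    { carrier := {X | ∃ a₁ a₂ a₃ a₄ z₁ z₂ z₃ z₄ c,
        X = coordEnd φ (hRat a₁ a₂ a₃ a₄ z₁ z₂ z₃ z₄ c) ∧ linForm l a₁ a₂ a₃ a₄ z₁ z₂ z₃ z₄ c = 0}
      zero_mem' := ⟨0, 0, 0, 0, 0, 0, 0, 0, 0, by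
        rw [show hRat 0 0 0 0 0 0 0 0 0 = 0 by simpa using hRat_smul 0 0 0 0 0 0 0 0 0 0]
        simpa using (coordEnd_smul (φ := φ) 0 0).symm, by simp [linForm]⟩
      add_mem' := by
        rintro _ _ ⟨a₁, a₂, a₃, a₄, z₁, z₂, z₃, z₄, c, rfl, h1⟩
          ⟨b₁, b₂, b₃, b₄, w₁, w₂, w₃, w₄, d, rfl, h2⟩
        refine ⟨_, _, _, _, _, _, _, _, _, by rw [← coordEnd_add, ← hRat_add], ?_⟩
        simp only [linForm] at h1 h2 ⊢
        linarith
      smul_mem' := by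
        rintro t _ ⟨a₁, a₂, a₃, a₄, z₁, z₂, z₃, z₄, c, rfl, h1⟩
        refine ⟨_, _, _, _, _, _, _, _, _, by rw [← coordEnd_smul, ← hRat_smul], ?_⟩
        simp only [linForm] at h1 ⊢
        linear_combination t * h1 }
  have hU : h.toSubmodule ≤ U := by
    rw [← G.berger, Submodule.span_le]
    rintro _ ⟨R, hR, x, y, rfl⟩
    obtain ⟨hK, hRij⟩ := G.curvTensor_eq hR
    have hmem : ∀ i j, Mem φ h
        (curvTensor φ R i j 0 5) (curvTensor φ R i j 1 5) (curvTensor φ R i j 0 6)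
        (curvTensor φ R i j 1 6) (curvTensor φ R i j 2 6) (curvTensor φ R i j 2 5)
        (curvTensor φ R i j 4 6) (curvTensor φ R i j 4 5) (curvTensor φ R i j 5 6) :=
      fun i j => by rw [Mem, ← hRij]; exact hR.2.1 _ _
    generalize curvTensor φ R = K at hK hRij hmem
    have hC := hK.curv hmem
    have hl := H _ _ _ _ _ _ _ _ _ _ _ _ _ _ _ _ _ _ _ _ _ _ _ _ _ _ hC
    have hz : ∀ i j, linForm l (K i j 0 5) (K i j 1 5) (K i j 0 6) (K i j 1 6) (K i j 2 6)
        (K i j 2 5) (K i j 4 6) (K i j 4 5) (K i j 5 6) = 0 := by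
      have hlt : ∀ i j, i < j → linForm l (K i j 0 5) (K i j 1 5) (K i j 0 6) (K i j 1 6)
          (K i j 2 6) (K i j 2 5) (K i j 4 6) (K i j 4 5) (K i j 5 6) = 0 := by
        exact hK.linForm_eq_zero l hl
      intro i j
      rcases lt_trichotomy i j with hij | rfl | hij
      · exact hlt i j hij
      · have h0 : ∀ k l, K i i k l = 0 := fun k l => by linarith [hK.anti₁ i i k l]
        simp [linForm, h0]
      · have h1 := hlt j i hij
        simp only [linForm, hK.anti₁ i j] at h1 ⊢
        linarith
    have hbase : ∀ i j, R (φ.symm (Pi.single i 1)) (φ.symm (Pi.single j 1)) ∈ U := fun i j =>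
      ⟨_, _, _, _, _, _, _, _, _, hRij i j, hz i j⟩
    rw [coordinates_sum φ x, coordinates_sum φ y]
    simp only [map_sum, map_smul, LinearMap.sum_apply, LinearMap.smul_apply]
    exact Submodule.sum_mem _ fun i _ => Submodule.smul_mem _ _ <|
      Submodule.sum_mem _ fun j _ => Submodule.smul_mem _ _ (hbase _ _)
  obtain ⟨b₁, b₂, b₃, b₄, w₁, w₂, w₃, w₄, d, hX, h1⟩ := hU hm
  obtain ⟨rfl, rfl, rfl, rfl, rfl, rfl, rfl, rfl, rfl⟩ := hRat_injective hX
  exact h1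

end SplitG2

/-! ### Subspaces of binary cubics under GL(2,ℝ). -/

namespace SplitG2

/-- The subspaces of `ℝ⁴` in the list for `𝔞 = 0` or `𝔞 = ℝ·I`. -/
def IsListed (Z : Set (Fin 4 → ℝ)) : Prop :=
  Z ∈ ({Set.univ, Zc {0, 2}, Zc {1, 2}, Zc {0, 2, 3}, Zc {1, 2, 3}} : Set (Set (Fin 4 → ℝ))) ∨
    IsSpecialZ Z

/-- The relations on `ℝ⁴` that are equivalent to a listed subspace under the action of
`GL(2,ℝ)` on binary cubics. -/
inductive Normalizable : (ℝ → ℝ → ℝ → ℝ → Prop) → Prop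
  | base {Z : Set (Fin 4 → ℝ)} (hZ : IsListed Z) :
      Normalizable fun z₁ z₂ z₃ z₄ => ![z₁, z₂, z₃, z₄] ∈ Z
  | swap {P : ℝ → ℝ → ℝ → ℝ → Prop}
      (hP : Normalizable fun z₁ z₂ z₃ z₄ => P (-z₄) (-z₃) (-z₂) (-z₁)) : Normalizable P
  | torus {P : ℝ → ℝ → ℝ → ℝ → Prop} {l m : ℝ} (hl : l ≠ 0) (hm : m ≠ 0)
      (hP : Normalizable fun z₁ z₂ z₃ z₄ =>
        P (m ^ 2 / l * z₁) (m * z₂) (l * z₃) (l ^ 2 / m * z₄)) : Normalizable P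
  | shear {P : ℝ → ℝ → ℝ → ℝ → Prop} (t : ℝ)
      (hP : Normalizable fun z₁ z₂ z₃ z₄ => P z₁ (z₂ + t * z₁) (z₃ + 2 * t * z₂ + t ^ 2 * z₁)
        (z₄ + 3 * t * z₃ + 3 * t ^ 2 * z₂ + t ^ 3 * z₁)) : Normalizable P

theorem Normalizable.of_iff {P Q : ℝ → ℝ → ℝ → ℝ → Prop} (hQ : Normalizable Q)
    (H : ∀ z₁ z₂ z₃ z₄, P z₁ z₂ z₃ z₄ ↔ Q z₁ z₂ z₃ z₄) : Normalizable P := by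
  have : P = Q := by
    funext z₁ z₂ z₃ z₄
    exact propext (H _ _ _ _)
  rwa [this]

/-- The relation vanishes on no vector of the middle block. -/
def NoKernel (P : ℝ → ℝ → ℝ → ℝ → Prop) : Prop :=
  ∀ x₃ x₄ x₅ : ℝ, (∀ z₁ z₂ z₃ z₄, P z₁ z₂ z₃ z₄ →
    z₂ * x₃ + 2 * z₃ * x₄ + z₄ * x₅ = 0 ∧ z₁ * x₃ + 2 * z₂ * x₄ + z₃ * x₅ = 0) →
    x₃ = 0 ∧ x₄ = 0 ∧ x₅ = 0

/-- The plane spanned by two vectors of `ℝ⁴`. -/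
def Pencil (u₁ u₂ u₃ u₄ w₁ w₂ w₃ w₄ z₁ z₂ z₃ z₄ : ℝ) : Prop :=
  ∃ s t, z₁ = s * u₁ + t * w₁ ∧ z₂ = s * u₂ + t * w₂ ∧ z₃ = s * u₃ + t * w₃ ∧
    z₄ = s * u₄ + t * w₄

/-- If the plane has no kernel, then it is equivalent to a listed plane. -/
def PencilOK (u₁ u₂ u₃ u₄ w₁ w₂ w₃ w₄ : ℝ) : Prop :=
  NoKernel (Pencil u₁ u₂ u₃ u₄ w₁ w₂ w₃ w₄) → Normalizable (Pencil u₁ u₂ u₃ u₄ w₁ w₂ w₃ w₄)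

namespace PencilOK

variable {u₁ u₂ u₃ u₄ w₁ w₂ w₃ w₄ : ℝ}

theorem combine {a b c d : ℝ} (hd : a * d - b * c ≠ 0)
    (H : PencilOK (a * u₁ + b * w₁) (a * u₂ + b * w₂) (a * u₃ + b * w₃) (a * u₄ + b * w₄)
      (c * u₁ + d * w₁) (c * u₂ + d * w₂) (c * u₃ + d * w₃) (c * u₄ + d * w₄)) :
    PencilOK u₁ u₂ u₃ u₄ w₁ w₂ w₃ w₄ := by
  have : Pencil u₁ u₂ u₃ u₄ w₁ w₂ w₃ w₄ = Pencil (a * u₁ + b * w₁) (a * u₂ + b * w₂)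
      (a * u₃ + b * w₃) (a * u₄ + b * w₄) (c * u₁ + d * w₁) (c * u₂ + d * w₂) (c * u₃ + d * w₃)
      (c * u₄ + d * w₄) := by
    funext z₁ z₂ z₃ z₄
    refine propext ⟨?_, ?_⟩
    · rintro ⟨s, t, rfl, rfl, rfl, rfl⟩
      have hk := mul_inv_cancel₀ hd
      refine ⟨(a * d - b * c)⁻¹ * (s * d - t * c), (a * d - b * c)⁻¹ * (a * t - b * s),
        ?_, ?_, ?_, ?_⟩
      · linear_combination -(s * u₁ + t * w₁) * hk
      · linear_combination -(s * u₂ + t * w₂) * hk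
      · linear_combination -(s * u₃ + t * w₃) * hk
      · linear_combination -(s * u₄ + t * w₄) * hk
    · rintro ⟨s, t, rfl, rfl, rfl, rfl⟩
      refine ⟨s * a + t * c, s * b + t * d, ?_, ?_, ?_, ?_⟩ <;> ring
  rw [PencilOK, this]
  exact H

/-- Besides the pencil, a possible kernel vector has to be transported, by the action on the middle
block. The same holds for the torus and the shear. -/
theorem swap (H : PencilOK u₄ u₃ u₂ u₁ w₄ w₃ w₂ w₁) : PencilOK u₁ u₂ u₃ u₄ w₁ w₂ w₃ w₄ := by
  have key : (fun z₁ z₂ z₃ z₄ => Pencil u₁ u₂ u₃ u₄ w₁ w₂ w₃ w₄ (-z₄) (-z₃) (-z₂) (-z₁))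
      = Pencil u₄ u₃ u₂ u₁ w₄ w₃ w₂ w₁ := by
    funext z₁ z₂ z₃ z₄
    refine propext ⟨?_, ?_⟩
    · rintro ⟨s, t, h1, h2, h3, h4⟩
      refine ⟨-s, -t, ?_, ?_, ?_, ?_⟩ <;> linarith
    · rintro ⟨s, t, h1, h2, h3, h4⟩
      refine ⟨-s, -t, ?_, ?_, ?_, ?_⟩ <;> linarith
  intro hk
  refine Normalizable.swap ?_
  rw [key]
  refine H fun x₃ x₄ x₅ hx => ?_
  obtain ⟨h1, h2, h3⟩ := hk x₅ x₄ x₃ fun z₁ z₂ z₃ z₄ hz => by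
    obtain ⟨h1, h2⟩ := hx (-z₄) (-z₃) (-z₂) (-z₁) (by rw [← key]; simpa using hz)
    exact ⟨by linarith, by linarith⟩
  exact ⟨h3, h2, h1⟩

theorem torus {l m : ℝ} (hl : l ≠ 0) (hm : m ≠ 0)
    (H : PencilOK (m ^ 2 / l * u₁) (m * u₂) (l * u₃) (l ^ 2 / m * u₄)
      (m ^ 2 / l * w₁) (m * w₂) (l * w₃) (l ^ 2 / m * w₄)) : PencilOK u₁ u₂ u₃ u₄ w₁ w₂ w₃ w₄ := by
  have key : (fun z₁ z₂ z₃ z₄ => Pencil u₁ u₂ u₃ u₄ w₁ w₂ w₃ w₄ (m⁻¹ ^ 2 / l⁻¹ * z₁) (m⁻¹ * z₂)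
      (l⁻¹ * z₃) (l⁻¹ ^ 2 / m⁻¹ * z₄)) = Pencil (m ^ 2 / l * u₁) (m * u₂) (l * u₃) (l ^ 2 / m * u₄)
      (m ^ 2 / l * w₁) (m * w₂) (l * w₃) (l ^ 2 / m * w₄) := by
    funext z₁ z₂ z₃ z₄
    refine propext ⟨?_, ?_⟩
    · rintro ⟨s, t, h1, h2, h3, h4⟩
      field_simp at h1 h2 h3 h4
      refine ⟨s, t, ?_, ?_, ?_, ?_⟩ <;> field_simp <;> linarith
    · rintro ⟨s, t, h1, h2, h3, h4⟩
      field_simp at h1 h2 h3 h4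
      refine ⟨s, t, ?_, ?_, ?_, ?_⟩ <;> field_simp <;> linarith
  intro hk
  refine Normalizable.torus (inv_ne_zero hl) (inv_ne_zero hm) ?_
  rw [key]
  refine H fun x₃ x₄ x₅ hx => ?_
  obtain ⟨h1, h2, h3⟩ := hk (m / l * x₃) x₄ (l / m * x₅) fun z₁ z₂ z₃ z₄ hz => by
    obtain ⟨h1, h2⟩ := hx (m ^ 2 / l * z₁) (m * z₂) (l * z₃) (l ^ 2 / m * z₄) (by
      rw [← key]
      convert hz using 1 <;> field_simp)
    field_simp at h1 h2 ⊢
    exact ⟨by linarith, by linarith⟩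
  refine ⟨?_, h2, ?_⟩
  · simpa [hl, hm] using h1
  · simpa [hl, hm] using h3

theorem shear (t : ℝ)
    (H : PencilOK u₁ (u₂ + t * u₁) (u₃ + 2 * t * u₂ + t ^ 2 * u₁)
      (u₄ + 3 * t * u₃ + 3 * t ^ 2 * u₂ + t ^ 3 * u₁) w₁ (w₂ + t * w₁)
      (w₃ + 2 * t * w₂ + t ^ 2 * w₁) (w₄ + 3 * t * w₃ + 3 * t ^ 2 * w₂ + t ^ 3 * w₁)) :
    PencilOK u₁ u₂ u₃ u₄ w₁ w₂ w₃ w₄ := by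
  have key : (fun z₁ z₂ z₃ z₄ => Pencil u₁ u₂ u₃ u₄ w₁ w₂ w₃ w₄ z₁ (z₂ + (-t) * z₁)
      (z₃ + 2 * (-t) * z₂ + (-t) ^ 2 * z₁)
      (z₄ + 3 * (-t) * z₃ + 3 * (-t) ^ 2 * z₂ + (-t) ^ 3 * z₁)) =
      Pencil u₁ (u₂ + t * u₁) (u₃ + 2 * t * u₂ + t ^ 2 * u₁)
      (u₄ + 3 * t * u₃ + 3 * t ^ 2 * u₂ + t ^ 3 * u₁) w₁ (w₂ + t * w₁)
      (w₃ + 2 * t * w₂ + t ^ 2 * w₁) (w₄ + 3 * t * w₃ + 3 * t ^ 2 * w₂ + t ^ 3 * w₁) := by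
    funext z₁ z₂ z₃ z₄
    refine propext ⟨?_, ?_⟩
    · rintro ⟨s, r, h1, h2, h3, h4⟩
      refine ⟨s, r, h1, ?_, ?_, ?_⟩
      · linear_combination h2 + t * h1
      · linear_combination h3 + 2 * t * h2 + t ^ 2 * h1
      · linear_combination h4 + 3 * t * h3 + 3 * t ^ 2 * h2 + t ^ 3 * h1
    · rintro ⟨s, r, h1, h2, h3, h4⟩
      refine ⟨s, r, h1, ?_, ?_, ?_⟩
      · linear_combination h2 - t * h1
      · linear_combination h3 - 2 * t * h2 + t ^ 2 * h1
      · linear_combination h4 - 3 * t * h3 + 3 * t ^ 2 * h2 - t ^ 3 * h1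
  intro hk
  refine Normalizable.shear (-t) ?_
  rw [key]
  refine H fun x₃ x₄ x₅ hx => ?_
  obtain ⟨h1, h2, h3⟩ := hk (x₃ + 2 * t * x₄ + t ^ 2 * x₅) (x₄ + t * x₅) x₅
    fun z₁ z₂ z₃ z₄ hz => by
    obtain ⟨h1, h2⟩ := hx z₁ (z₂ + t * z₁) (z₃ + 2 * t * z₂ + t ^ 2 * z₁)
      (z₄ + 3 * t * z₃ + 3 * t ^ 2 * z₂ + t ^ 3 * z₁) (by
      rw [← key]
      convert hz using 1 <;> ring)
    exact ⟨by linear_combination h1 - t * h2, by linear_combination h2⟩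
  subst h3
  have h2' : x₄ = 0 := by linarith
  subst h2'
  exact ⟨by linarith, rfl, rfl⟩

/-- The case in which the assumption on the kernel fails and nothing has to be normalised. -/
theorem of_kernel {x₃ x₄ x₅ : ℝ} (hx : x₃ ≠ 0 ∨ x₄ ≠ 0 ∨ x₅ ≠ 0)
    (h1 : u₂ * x₃ + 2 * u₃ * x₄ + u₄ * x₅ = 0) (h2 : u₁ * x₃ + 2 * u₂ * x₄ + u₃ * x₅ = 0)
    (h3 : w₂ * x₃ + 2 * w₃ * x₄ + w₄ * x₅ = 0) (h4 : w₁ * x₃ + 2 * w₂ * x₄ + w₃ * x₅ = 0) :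
    PencilOK u₁ u₂ u₃ u₄ w₁ w₂ w₃ w₄ := by
  intro hk
  obtain ⟨h5, h6, h7⟩ := hk x₃ x₄ x₅ (by
    rintro z₁ z₂ z₃ z₄ ⟨s, t, rfl, rfl, rfl, rfl⟩
    exact ⟨by linear_combination s * h1 + t * h3, by linear_combination s * h2 + t * h4⟩)
  tauto

theorem of_listed {Z : Set (Fin 4 → ℝ)} (hZ : IsListed Z)
    (H : ∀ z₁ z₂ z₃ z₄, Pencil u₁ u₂ u₃ u₄ w₁ w₂ w₃ w₄ z₁ z₂ z₃ z₄ ↔ ![z₁, z₂, z₃, z₄] ∈ Z) :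
    PencilOK u₁ u₂ u₃ u₄ w₁ w₂ w₃ w₄ :=
  fun _ => (Normalizable.base hZ).of_iff H

theorem comm (H : PencilOK w₁ w₂ w₃ w₄ u₁ u₂ u₃ u₄) : PencilOK u₁ u₂ u₃ u₄ w₁ w₂ w₃ w₄ := by
  refine combine (a := 0) (b := 1) (c := 1) (d := 0) (by norm_num) ?_
  convert H using 1 <;> ring

/-- The planes of the list. -/
theorem listed_zero_two : PencilOK 1 0 0 0 0 0 1 0 := by
  refine of_listed (Z := Zc {0, 2}) (Or.inl (by simp)) fun z₁ z₂ z₃ z₄ => ⟨?_, fun hz => ?_⟩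
  · rintro ⟨s, t, rfl, rfl, rfl, rfl⟩ l hl
    fin_cases l <;> simp_all
  · have h2 := hz 1 (by simp)
    have h4 := hz 3 (by simp)
    simp at h2 h4
    exact ⟨z₁, z₃, by simp, by simp [h2], by simp, by simp [h4]⟩

theorem listed_one_two : PencilOK 0 1 0 0 0 0 1 0 := by
  refine of_listed (Z := Zc {1, 2}) (Or.inl (by simp)) fun z₁ z₂ z₃ z₄ => ⟨?_, fun hz => ?_⟩
  · rintro ⟨s, t, rfl, rfl, rfl, rfl⟩ l hl
    fin_cases l <;> simp_all
  · have h2 := hz 0 (by simp)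
    have h4 := hz 3 (by simp)
    simp at h2 h4
    exact ⟨z₂, z₃, by simp [h2], by simp, by simp, by simp [h4]⟩

theorem listed_a : PencilOK 1 0 1 0 0 0 0 1 := by
  refine of_listed (Or.inr .a) fun z₁ z₂ z₃ z₄ => ⟨?_, ?_⟩
  · rintro ⟨s, t, rfl, rfl, rfl, rfl⟩
    exact ⟨s, t, by simp⟩
  · rintro ⟨s, t, h⟩
    have h1 := congrFun h 0
    have h2 := congrFun h 1
    have h3 := congrFun h 2
    have h4 := congrFun h 3
    simp at h1 h2 h3 h4
    exact ⟨s, t, by simp [h1], by simp [h2], by simp [h3], by simp [h4]⟩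

theorem listed_b : PencilOK 0 1 0 (-1) 0 0 1 0 := by
  refine of_listed (Or.inr .b) fun z₁ z₂ z₃ z₄ => ⟨?_, ?_⟩
  · rintro ⟨s, t, rfl, rfl, rfl, rfl⟩
    exact ⟨s, t, by simp⟩
  · rintro ⟨s, t, h⟩
    have h1 := congrFun h 0
    have h2 := congrFun h 1
    have h3 := congrFun h 2
    have h4 := congrFun h 3
    simp at h1 h2 h3 h4
    exact ⟨s, t, by simp [h1], by simp [h2], by simp [h3], by simp [h4]⟩

theorem listed_c {α : ℝ} (hα : α ∈ Set.Icc ((√3 - 1) / √6) ((√3 + 1) / √6)) :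
    PencilOK 1 α 0 0 0 0 α 1 := by
  refine of_listed (Or.inr (.c α hα)) fun z₁ z₂ z₃ z₄ => ⟨?_, ?_⟩
  · rintro ⟨s, t, rfl, rfl, rfl, rfl⟩
    exact ⟨s, t, by simp [mul_comm]⟩
  · rintro ⟨s, t, h⟩
    have h1 := congrFun h 0
    have h2 := congrFun h 1
    have h3 := congrFun h 2
    have h4 := congrFun h 3
    simp at h1 h2 h3 h4
    exact ⟨s, t, by simp [h1], by simp [h2, mul_comm], by simp [h3, mul_comm], by simp [h4]⟩

theorem listed_d {s α : ℝ} (hs : s ∈ Set.Ioc (0 : ℝ) 1) (hα : 3 * α ^ 2 - (s + 1) * α - s = 0) :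
    PencilOK s 0 (-α) 0 0 α 0 (-1) := by
  refine of_listed (Or.inr (.d s α hs hα)) fun z₁ z₂ z₃ z₄ => ⟨?_, ?_⟩
  · rintro ⟨x, y, rfl, rfl, rfl, rfl⟩
    exact ⟨x, y, by simp [mul_comm]⟩
  · rintro ⟨x, y, h⟩
    have h1 := congrFun h 0
    have h2 := congrFun h 1
    have h3 := congrFun h 2
    have h4 := congrFun h 3
    simp at h1 h2 h3 h4
    exact ⟨x, y, by simp [h1, mul_comm], by simp [h2, mul_comm], by simp [h3, mul_comm],
      by simp [h4]⟩

end PencilOK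

end SplitG2

/-! ### Pencils with a member that has a double root. -/

namespace SplitG2

namespace PencilOK

variable {u₁ u₂ u₃ u₄ w₁ w₂ w₃ w₄ : ℝ}

theorem smul_add {k r : ℝ} (hk : k ≠ 0)
    (H : PencilOK (k * u₁ + r * w₁) (k * u₂ + r * w₂) (k * u₃ + r * w₃) (k * u₄ + r * w₄)
      w₁ w₂ w₃ w₄) : PencilOK u₁ u₂ u₃ u₄ w₁ w₂ w₃ w₄ := by
  refine combine (a := k) (b := r) (c := 0) (d := 1) (by simpa using hk) ?_
  convert H using 1 <;> ring

theorem smul_right {k : ℝ} (hk : k ≠ 0)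
    (H : PencilOK u₁ u₂ u₃ u₄ (k * w₁) (k * w₂) (k * w₃) (k * w₄)) :
    PencilOK u₁ u₂ u₃ u₄ w₁ w₂ w₃ w₄ := by
  refine comm (smul_add (r := 0) hk (comm ?_))
  convert H using 1 <;> ring

/-- The squares of the endpoints (√3 ± 1)/√6 are (2 ± √3)/3. -/
theorem sqrt_mem_Icc {β : ℝ} (hβ : β ∈ Set.Icc ((2 - √3) / 3) ((2 + √3) / 3)) :
    √β ∈ Set.Icc ((√3 - 1) / √6) ((√3 + 1) / √6) := by
  have h3 : √3 ^ 2 = 3 := Real.sq_sqrt (by norm_num)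
  have h6 : √6 ^ 2 = 6 := Real.sq_sqrt (by norm_num)
  constructor
  · refine Real.le_sqrt_of_sq_le (le_trans (le_of_eq ?_) hβ.1)
    rw [div_pow, h6]
    linear_combination h3 / 6
  · refine Real.sqrt_le_iff.mpr ⟨by positivity, le_trans hβ.2 (le_of_eq ?_)⟩
    rw [div_pow, h6]
    linear_combination -h3 / 6

/-- The product αα' is invariant under the torus, which can make both entries equal to its square
root. -/
theorem of_mul_mem {α α' : ℝ} (hβ : α * α' ∈ Set.Icc ((2 - √3) / 3) ((2 + √3) / 3)) :
    PencilOK 1 α 0 0 0 0 α' 1 := by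
  have hlt : √3 < 2 := by
    rw [Real.sqrt_lt' (by norm_num)]
    norm_num
  have hpos : 0 < α * α' := lt_of_lt_of_le (by linarith) hβ.1
  have hα : α ≠ 0 := left_ne_zero_of_mul hpos.ne'
  have hs : √(α * α') ≠ 0 := (Real.sqrt_pos.mpr hpos).ne'
  have hsq := Real.sq_sqrt hpos.le
  have hl : √(α * α') / α ≠ 0 := div_ne_zero hs hα
  refine torus (l := √(α * α') / α) (m := 1) hl one_ne_zero ?_
  refine smul_add (r := 0) hl (smul_right (inv_ne_zero (pow_ne_zero 2 hl)) ?_)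
  convert listed_c (sqrt_mem_Icc hβ) using 1
  · field_simp; ring
  · field_simp; ring
  · ring
  · ring
  · ring
  · ring
  · field_simp; linear_combination -hsq
  · field_simp

/-- The pencil of `x²y` and `y²(y + 3cx)`. -/
theorem of_common_line {c : ℝ} (hc : c ≠ 0) : PencilOK 1 c 0 0 0 0 1 0 := by
  have hlt : √3 < 2 := by
    rw [Real.sqrt_lt' (by norm_num)]
    norm_num
  have h3 : √3 ^ 2 = 3 := Real.sq_sqrt (by norm_num)
  -- The value -3c/2 is the simple root of the Jacobian 2t³ + 3ct². Moving it to 0 gives the normal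
  -- form with product 1/9.
  refine shear (-3 * c / 2) (smul_add (k := 1) (r := 3 * c ^ 2 / 4) one_ne_zero
    (smul_right (k := -2 / (9 * c)) (by simp [hc]) ?_))
  have h1 : -c / 2 * (-2 / (9 * c)) = 1 / 9 := by field_simp
  have hm : -c / 2 * (-2 / (9 * c)) ∈ Set.Icc ((2 - √3) / 3) ((2 + √3) / 3) := by
    rw [h1]
    constructor <;> nlinarith [Real.sqrt_nonneg 3]
  convert of_mul_mem hm using 1 <;> field_simp <;> ring

/-- The pencil of `x³` and `y²(y + 3αx)`. -/
theorem of_cube {α : ℝ} (hα : α ≠ 0) : PencilOK 1 α 0 0 0 0 0 1 := by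
  have hlt : √3 < 2 := by
    rw [Real.sqrt_lt' (by norm_num)]
    norm_num
  have h3 : √3 ^ 2 = 3 := Real.sq_sqrt (by norm_num)
  -- After the swap the Jacobian is 2αt³ + t². Moving its root -1/(2α) to 0 gives the normal form
  -- with product 1.
  refine swap (comm (shear (-1 / (2 * α)) (smul_add (k := 1) (r := -1 / (4 * α ^ 3)) one_ne_zero
    (smul_right (k := -2) (by norm_num) ?_))))
  have h1 : -1 / (2 * α) * (-2 * α) = 1 := by field_simp
  have hm : -1 / (2 * α) * (-2 * α) ∈ Set.Icc ((2 - √3) / 3) ((2 + √3) / 3) := by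
    rw [h1]
    constructor <;> nlinarith [Real.sqrt_nonneg 3]
  convert of_mul_mem hm using 1 <;> field_simp <;> ring

/-- The Jacobian of the normal form is t(2α't² + (1 + 3αα')t + 2α), with one more root at infinity.
The substitution t = uα gives the quadratic for u, and the shear moves this other root to 0, which
replaces the product αα' by a new one. -/
theorem of_root {α α' u : ℝ} (hq : 2 * (α * α') * u ^ 2 + (1 + 3 * (α * α')) * u + 2 = 0)
    (hα' : α' ≠ 0) (hk : 1 + 3 * u * (α * α') ≠ 0)
    (H : PencilOK 1 (α * (1 + u)) 0 0 0 0 (α' / (1 + 3 * u * (α * α'))) 1) :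
    PencilOK 1 α 0 0 0 0 α' 1 := by
  refine shear (u * α) (smul_add (k := 1) (r := -(2 * u * α ^ 2 + u ^ 2 * α ^ 2) / α') one_ne_zero
    (smul_right (k := (1 + 3 * u * (α * α'))⁻¹) (inv_ne_zero hk) ?_))
  convert H using 1
  · ring
  · ring
  · field_simp; ring
  · field_simp
    linear_combination -α ^ 2 * u * hq
  · ring
  · ring
  · field_simp; ring
  · linear_combination inv_mul_cancel₀ hk

/-- At the endpoint β = (2 + √3)/3 one root is exactly -(3 - √3); for larger β the quadratic is
non-positive there and equals 1/2 at -3/2. -/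
theorem exists_root_large {β : ℝ} (hβ : (2 + √3) / 3 < β) :
    ∃ u, 2 * β * u ^ 2 + (1 + 3 * β) * u + 2 = 0 ∧ -3 / 2 < u ∧ u ≤ -(3 - √3) := by
  have h3 : √3 ^ 2 = 3 := Real.sq_sqrt (by norm_num)
  have h0 := Real.sqrt_nonneg 3
  have hgt : (17 : ℝ) / 10 < √3 := Real.lt_sqrt_of_sq_lt (by norm_num)
  have hlt : √3 < 9 / 5 := by
    rw [Real.sqrt_lt' (by norm_num)]
    norm_num
  obtain ⟨u, ⟨hu1, hu2⟩, hu⟩ := intermediate_value_Icc' (a := -3 / 2) (b := -(3 - √3))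
    (f := fun u => 2 * β * u ^ 2 + (1 + 3 * β) * u + 2) (by linarith) (by fun_prop)
    (show (0 : ℝ) ∈ _ from ⟨by
      nlinarith [mul_pos (sub_pos.mpr hβ) (show 0 < 9 * √3 - 15 by linarith)], by nlinarith⟩)
  refine ⟨u, hu, lt_of_le_of_ne hu1 ?_, hu2⟩
  rintro rfl
  norm_num at hu
  linarith

theorem exists_root_small {β : ℝ} (h0 : 0 < β) (hβ : β < (2 - √3) / 3) :
    ∃ u, 2 * β * u ^ 2 + (1 + 3 * β) * u + 2 = 0 ∧ u ≤ -(3 + √3) := by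
  have h3 : √3 ^ 2 = 3 := Real.sq_sqrt (by norm_num)
  have hs := Real.sqrt_nonneg 3
  have hgt : (17 : ℝ) / 10 < √3 := Real.lt_sqrt_of_sq_lt (by norm_num)
  have hle : -(1 + 3 * β) / (2 * β) ≤ -(3 + √3) := by
    rw [div_le_iff₀ (by linarith)]
    nlinarith
  obtain ⟨u, ⟨hu1, hu2⟩, hu⟩ := intermediate_value_Icc' (b := -(3 + √3))
    (f := fun u => 2 * β * u ^ 2 + (1 + 3 * β) * u + 2) hle (by fun_prop)
    (show (0 : ℝ) ∈ _ from ⟨by nlinarith, by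
      have : 2 * β * (-(1 + 3 * β) / (2 * β)) ^ 2 + (1 + 3 * β) * (-(1 + 3 * β) / (2 * β)) + 2
        = 2 := by field_simp; ring
      rw [this]; norm_num⟩)
  exact ⟨u, hu, hu2⟩

/-- Eliminating β by the quadratic expresses the new product in terms of u alone. -/
theorem root_mul {β u : ℝ} (hq : 2 * β * u ^ 2 + (1 + 3 * β) * u + 2 = 0) (h0 : u ≠ 0)
    (h3 : u + 3 ≠ 0) (h2 : 2 * u + 3 ≠ 0) :
    1 + 3 * u * β ≠ 0 ∧ β * (1 + u) / (1 + 3 * u * β) = (u + 1) * (u + 2) / (u * (u + 3)) := by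
  have hk : 1 + 3 * u * β = -(u + 3) / (2 * u + 3) := by
    rw [eq_div_iff h2]
    linear_combination 3 * hq
  have hk0 : 1 + 3 * u * β ≠ 0 := by
    rw [hk]
    exact div_ne_zero (neg_ne_zero.mpr h3) h2
  refine ⟨hk0, ?_⟩
  rw [div_eq_div_iff hk0 (mul_ne_zero h0 h3)]
  linear_combination -(1 + u) * hq

/-- Outside the interval with endpoints (2 ± √3)/3 another pair of Jacobian roots is real, and with
a suitable choice the new product falls into the interval. The two endpoints correspond to each
other under this change. -/
theorem of_mul_pos {α α' : ℝ} (hβ : 0 < α * α') : PencilOK 1 α 0 0 0 0 α' 1 := by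
  have h3 : √3 ^ 2 = 3 := Real.sq_sqrt (by norm_num)
  have hs := Real.sqrt_nonneg 3
  have hgt : (17 : ℝ) / 10 < √3 := Real.lt_sqrt_of_sq_lt (by norm_num)
  have hlt : √3 < 9 / 5 := by
    rw [Real.sqrt_lt' (by norm_num)]
    norm_num
  have hα' : α' ≠ 0 := right_ne_zero_of_mul hβ.ne'
  by_cases h1 : α * α' < (2 - √3) / 3
  · obtain ⟨u, hu, hle⟩ := exists_root_small hβ h1
    obtain ⟨hk, he⟩ := root_mul hu (by linarith) (by linarith) (by linarith)
    refine of_root hu hα' hk (of_mul_mem ?_)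
    rw [show α * (1 + u) * (α' / (1 + 3 * u * (α * α')))
      = α * α' * (1 + u) / (1 + 3 * u * (α * α')) by ring, he]
    have hp : 0 < u * (u + 3) := by nlinarith
    constructor
    · rw [div_le_div_iff₀ (by norm_num) hp]
      nlinarith
    · rw [div_le_div_iff₀ hp (by norm_num)]
      nlinarith [mul_nonneg (show 0 ≤ -(3 + √3) - u by linarith) (show 0 ≤ -u by linarith)]
  by_cases h2 : (2 + √3) / 3 < α * α'
  · obtain ⟨u, hu, hgt', hle⟩ := exists_root_large h2
    obtain ⟨hk, he⟩ := root_mul hu (by linarith) (by linarith) (by linarith)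
    refine of_root hu hα' hk (of_mul_mem ?_)
    rw [show α * (1 + u) * (α' / (1 + 3 * u * (α * α')))
      = α * α' * (1 + u) / (1 + 3 * u * (α * α')) by ring, he, ← neg_div_neg_eq ((u + 1) * (u + 2))]
    have hp : 0 < -(u * (u + 3)) := by nlinarith
    constructor
    · rw [div_le_div_iff₀ (by norm_num) hp]
      nlinarith
    · rw [div_le_div_iff₀ hp (by norm_num)]
      nlinarith
  exact of_mul_mem ⟨not_lt.mp h1, not_lt.mp h2⟩

theorem of_mul_neg {α α' : ℝ} (hβ : α * α' < 0) : PencilOK 1 α 0 0 0 0 α' 1 := by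
  have hα' : α' ≠ 0 := right_ne_zero_of_mul hβ.ne
  -- The quadratic equals 2αα' < 0 at -2 and 1/2 at -3/2. Between these points (u + 1)(u + 2) and
  -- u(u + 3) are both negative, so the new product is positive.
  obtain ⟨u, ⟨hu1, hu2⟩, hu⟩ := intermediate_value_Ioo (a := -2) (b := -3 / 2)
    (f := fun u => 2 * (α * α') * u ^ 2 + (1 + 3 * (α * α')) * u + 2) (by norm_num) (by fun_prop)
    (show (0 : ℝ) ∈ _ from ⟨by nlinarith, by nlinarith⟩)
  obtain ⟨hk, he⟩ := root_mul hu (by linarith) (by linarith) (by linarith)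
  refine of_root hu hα' hk (of_mul_pos ?_)
  rw [show α * (1 + u) * (α' / (1 + 3 * u * (α * α')))
      = α * α' * (1 + u) / (1 + 3 * u * (α * α')) by ring, he]
  refine div_pos_of_neg_of_neg ?_ ?_ <;> nlinarith

/-- The pencil contains a member with a double root at `x = 0` and one with a double root at
`y = 0`. -/
theorem of_double_roots {a b c d : ℝ} (hw : b ≠ 0 ∨ a ≠ 0) (hv : d ≠ 0 ∨ c ≠ 0) :
    PencilOK d c 0 0 0 0 b a := by
  have one (α α' : ℝ) : PencilOK 1 α 0 0 0 0 α' 1 := by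
    rcases lt_trichotomy (α * α') 0 with hβ | hβ | hβ
    · exact of_mul_neg hβ
    · rcases mul_eq_zero.mp hβ with rfl | rfl
      · by_cases hα' : α' = 0
        · subst hα'
          exact of_kernel (x₃ := 0) (x₄ := 1) (x₅ := 0) (by simp) (by simp) (by simp) (by simp)
            (by simp)
        · exact swap (comm (of_cube hα'))
      · by_cases hα : α = 0
        · subst hα
          exact of_kernel (x₃ := 0) (x₄ := 1) (x₅ := 0) (by simp) (by simp) (by simp) (by simp)
            (by simp)
        · exact of_cube hα
    · exact of_mul_pos hβ
  have two (α : ℝ) : PencilOK 1 α 0 0 0 0 1 0 := by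
    by_cases hα : α = 0
    · rw [hα]
      exact listed_zero_two
    · exact of_common_line hα
  by_cases hd : d = 0
  · subst hd
    have hc : c ≠ 0 := by tauto
    refine smul_add (r := 0) (inv_ne_zero hc) ?_
    by_cases ha : a = 0
    · subst ha
      have hb : b ≠ 0 := by tauto
      refine smul_right (inv_ne_zero hb) ?_
      convert listed_one_two using 1 <;> field_simp <;> ring
    · refine smul_right (inv_ne_zero ha) (swap (comm ?_))
      convert two (b / a) using 1 <;> field_simp <;> ring
  · refine smul_add (r := 0) (inv_ne_zero hd) ?_
    by_cases ha : a = 0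
    · subst ha
      have hb : b ≠ 0 := by tauto
      refine smul_right (inv_ne_zero hb) ?_
      convert two (c / d) using 1 <;> field_simp <;> ring
    · refine smul_right (inv_ne_zero ha) ?_
      convert one (c / d) (b / a) using 1 <;> field_simp <;> ring

theorem exists_cubic_root (b c d : ℝ) : ∃ t, t ^ 3 + b * t ^ 2 + c * t + d = 0 := by
  set M := 1 + |b| + |c| + |d| with hM
  have hb := abs_le.mp (le_refl |b|)
  have hc := abs_le.mp (le_refl |c|)
  have hd := abs_le.mp (le_refl |d|)
  have hb0 := abs_nonneg b
  have hc0 := abs_nonneg c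
  have hd0 := abs_nonneg d
  have hM1 : 1 ≤ M := by linarith
  have hMM : M ≤ M ^ 2 := by nlinarith
  have key : |b| * M ^ 2 + |c| * M + |d| ≤ M ^ 3 := by
    have h1 : |c| * M ≤ |c| * M ^ 2 := by gcongr
    have h2 : |d| * 1 ≤ |d| * M ^ 2 := by gcongr; nlinarith
    nlinarith
  have b1 : |b * M ^ 2| = |b| * M ^ 2 := by rw [abs_mul, abs_of_nonneg (sq_nonneg M)]
  have c1 : |c * M| = |c| * M := by rw [abs_mul, abs_of_nonneg (by linarith : 0 ≤ M)]
  have b2 := abs_le.mp b1.le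
  have c2 := abs_le.mp c1.le
  obtain ⟨t, -, ht⟩ := intermediate_value_Icc (a := -M) (b := M)
    (f := fun t => t ^ 3 + b * t ^ 2 + c * t + d) (by linarith) (by fun_prop)
    (show (0 : ℝ) ∈ _ from ⟨by nlinarith, by nlinarith⟩)
  exact ⟨t, ht⟩

/-- The shear moves the simple root -m/2 of the Jacobian 2t + m to 0. -/
theorem of_square_cube (m : ℝ) : PencilOK 0 1 m 0 0 0 0 1 := by
  refine shear (-m / 2) (smul_add (k := 1) (r := 3 * m ^ 2 / 4) one_ne_zero (swap (comm ?_)))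
  convert listed_zero_two using 1 <;> ring

/-- The Jacobian is t² + q. For q < 0 a real root gives a second member with a double root; for q >
0 there is none at a finite point, and scaling gives family (a). -/
theorem of_normal_cube (q : ℝ) : PencilOK 1 0 q 0 0 0 0 1 := by
  rcases lt_trichotomy q 0 with hq | rfl | hq
  · have ht := Real.sq_sqrt (neg_pos.mpr hq).le
    have h0 := (Real.sqrt_pos.mpr (neg_pos.mpr hq)).ne'
    refine shear √(-q) (smul_add (k := 1) (r := -(3 * √(-q) * q + √(-q) ^ 3)) one_ne_zero ?_)
    convert of_cube h0 using 1
    · ring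
    · ring
    · linear_combination ht
    · ring
    · ring
    · ring
    · ring
  · exact of_kernel (x₃ := 0) (x₄ := 1) (x₅ := 0) (by simp) (by simp) (by simp) (by simp) (by simp)
  · have ht := Real.sq_sqrt hq.le
    have h0 := (Real.sqrt_pos.mpr hq).ne'
    refine torus (l := 1) (m := √q) one_ne_zero h0 (smul_add (r := 0) (inv_ne_zero hq.ne')
      (smul_right h0 ?_))
    convert listed_a using 1
    · rw [ht]; field_simp; ring
    · ring
    · field_simp; ring
    · ring
    · ring
    · ring
    · ring
    · field_simp

/-- The Jacobian is 3t² - κ, so the sign of κ decides between family (b), the coordinate plane and a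
further member with a double root. -/
theorem of_common_square (κ : ℝ) : PencilOK 0 1 0 κ 0 0 1 0 := by
  rcases lt_trichotomy κ 0 with hκ | rfl | hκ
  · have hp : 0 < -κ⁻¹ := neg_pos.mpr (inv_lt_zero.mpr hκ)
    have ht := Real.sq_sqrt hp.le
    have h0 := (Real.sqrt_pos.mpr hp).ne'
    refine torus (l := √(-κ⁻¹)) (m := 1) h0 one_ne_zero (smul_right (inv_ne_zero h0) ?_)
    convert listed_b using 1 <;>
      first | ring1 | (rw [mul_one]; exact inv_mul_cancel₀ h0) | (rw [ht]; field_simp [hκ.ne])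
  · exact listed_one_two
  · have ht := Real.sq_sqrt (show 0 ≤ κ / 3 by linarith)
    refine shear √(κ / 3) (smul_add (k := 1) (r := -2 * √(κ / 3)) one_ne_zero ?_)
    convert of_double_roots (a := 3 * √(κ / 3)) (b := 1) (c := 1) (d := 0) (by simp) (by simp)
      using 1
    · ring
    · ring
    · ring
    · linear_combination -3 * ht
    · ring
    · ring
    · ring

/-- The pencil contains a member with a double root at `x = 0`. -/
theorem of_double_root {a b : ℝ} (hw : b ≠ 0 ∨ a ≠ 0) : PencilOK u₁ u₂ u₃ u₄ 0 0 b a := by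
  by_cases hb : b = 0
  · subst hb
    have ha : a ≠ 0 := by tauto
    refine smul_right (inv_ne_zero ha) (smul_add (k := 1) (r := -u₄) one_ne_zero ?_)
    by_cases h1 : u₁ = 0
    · subst h1
      by_cases h2 : u₂ = 0
      · subst h2
        exact of_kernel (x₃ := 1) (x₄ := 0) (x₅ := 0) (by simp) (by simp) (by simp) (by simp)
          (by simp)
      · refine smul_add (r := 0) (inv_ne_zero h2) ?_
        convert of_square_cube (u₃ / u₂) using 1 <;> field_simp <;> ring
    · refine smul_add (r := 0) (inv_ne_zero h1) (shear (-u₂ / u₁) (smul_add (k := 1)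
        (r := 3 * u₂ * u₃ / u₁ ^ 2 - 2 * u₂ ^ 3 / u₁ ^ 3) one_ne_zero ?_))
      convert of_normal_cube (u₃ / u₁ - u₂ ^ 2 / u₁ ^ 2) using 1 <;> field_simp <;> ring
  -- The member is x²(3by + ax) up to scale; the shear moves its simple root so that it becomes x²y.
  · refine smul_right (inv_ne_zero hb) (shear (-(b⁻¹ * a) / 3) ?_)
    suffices H : ∀ v₁ v₂ v₃ v₄, PencilOK v₁ v₂ v₃ v₄ 0 0 1 0 by
      convert H u₁ (u₂ + (-(b⁻¹ * a) / 3) * u₁) (u₃ + 2 * (-(b⁻¹ * a) / 3) * u₂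
        + (-(b⁻¹ * a) / 3) ^ 2 * u₁) (u₄ + 3 * (-(b⁻¹ * a) / 3) * u₃
        + 3 * (-(b⁻¹ * a) / 3) ^ 2 * u₂ + (-(b⁻¹ * a) / 3) ^ 3 * u₁) using 1 <;> field_simp <;> ring
    intro v₁ v₂ v₃ v₄
    refine smul_add (k := 1) (r := -v₃) one_ne_zero ?_
    by_cases h1 : v₁ = 0
    · subst h1
      by_cases h2 : v₂ = 0
      · subst h2
        exact of_kernel (x₃ := 1) (x₄ := 0) (x₅ := 0) (by simp) (by simp) (by simp) (by simp)
          (by simp)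
      · refine smul_add (r := 0) (inv_ne_zero h2) ?_
        convert of_common_square (v₄ / v₂) using 1 <;> field_simp <;> ring
    · refine smul_add (r := 0) (inv_ne_zero h1) ?_
      suffices H : ∀ x₂ x₄, PencilOK 1 x₂ 0 x₄ 0 0 1 0 by
        convert H (v₂ / v₁) (v₄ / v₁) using 1 <;> field_simp <;> ring
      intro x₂ x₄
      -- Twice this cubic is the Jacobian 2t³ + 3x₂t² - x₄; a real root of it yields a second member
      -- with a double root.
      obtain ⟨t, ht⟩ := exists_cubic_root (3 * x₂ / 2) 0 (-x₄ / 2)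
      refine shear t (smul_add (k := 1) (r := -(2 * t * x₂ + t ^ 2)) one_ne_zero ?_)
      convert of_double_roots (a := 3 * t) (b := 1) (c := x₂ + t) (d := 1) (by simp) (by simp)
        using 1
      · ring
      · ring
      · ring
      · linear_combination -2 * ht
      · ring
      · ring
      · ring

end PencilOK

end SplitG2

/-! ### The Jacobian of a pencil, and hyperplanes of cubics. -/

namespace SplitG2

/-- The Jacobian of the pencil is the product of `a y² + 2b xy + c x²` and
`a' y² + 2b' xy + c' x²`. -/
structure FactoredJacobian (u₁ u₂ u₃ u₄ w₁ w₂ w₃ w₄ a b c a' b' c' : ℝ) : Prop where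
  e12 : u₁ * w₂ - u₂ * w₁ = a * a'
  e13 : u₁ * w₃ - u₃ * w₁ = a * b' + b * a'
  e23 : 3 * (u₂ * w₃ - u₃ * w₂) + (u₁ * w₄ - u₄ * w₁) = a * c' + c * a' + 4 * b * b'
  e24 : u₂ * w₄ - u₄ * w₂ = b * c' + c * b'
  e34 : u₃ * w₄ - u₄ * w₃ = c * c'

/-- The Jacobian is covariant, so both quadratic factors undergo the same substitution as the
cubics. -/
theorem FactoredJacobian.shear {u₁ u₂ u₃ u₄ w₁ w₂ w₃ w₄ a b c a' b' c' : ℝ}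
    (H : FactoredJacobian u₁ u₂ u₃ u₄ w₁ w₂ w₃ w₄ a b c a' b' c') (t : ℝ) :
    FactoredJacobian u₁ (u₂ + t * u₁) (u₃ + 2 * t * u₂ + t ^ 2 * u₁)
      (u₄ + 3 * t * u₃ + 3 * t ^ 2 * u₂ + t ^ 3 * u₁) w₁ (w₂ + t * w₁)
      (w₃ + 2 * t * w₂ + t ^ 2 * w₁) (w₄ + 3 * t * w₃ + 3 * t ^ 2 * w₂ + t ^ 3 * w₁)
      a (b + a * t) (c + 2 * b * t + a * t ^ 2) a' (b' + a' * t)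
      (c' + 2 * b' * t + a' * t ^ 2) where
  e12 := by linear_combination H.e12
  e13 := by linear_combination H.e13 + 2 * t * H.e12
  e23 := by linear_combination H.e23 + 6 * t * H.e13 + 6 * t ^ 2 * H.e12
  e24 := by linear_combination H.e24 + t * H.e23 + 3 * t ^ 2 * H.e13 + 2 * t ^ 3 * H.e12
  e34 := by
    linear_combination H.e34 + 2 * t * H.e24 + t ^ 2 * H.e23 + 2 * t ^ 3 * H.e13 + t ^ 4 * H.e12

theorem FactoredJacobian.swap {u₁ u₂ u₃ u₄ w₁ w₂ w₃ w₄ a b c a' b' c' : ℝ}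
    (H : FactoredJacobian u₁ u₂ u₃ u₄ w₁ w₂ w₃ w₄ a b c a' b' c') :
    FactoredJacobian w₄ w₃ w₂ w₁ u₄ u₃ u₂ u₁ c b a c' b' a' where
  e12 := by linear_combination H.e34
  e13 := by linear_combination H.e24
  e23 := by linear_combination H.e23
  e24 := by linear_combination H.e13
  e34 := by linear_combination H.e12

namespace PencilOK

variable {u₁ u₂ u₃ u₄ w₁ w₂ w₃ w₄ : ℝ}

/-- The two middle Plücker coordinates of the pencil have a product fixed by the Plücker relation,
while `e23` fixes the weighted sum. Scaling turns this into the quadratic equation for α in family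
(d). -/
theorem of_diagonal {a b c d : ℝ} (ha : 0 < a) (hb : 0 < b) (hc : 0 < c) (hd : 0 < d)
    (H : FactoredJacobian u₁ u₂ u₃ u₄ w₁ w₂ w₃ w₄ b 0 a d 0 c) :
    PencilOK u₁ u₂ u₃ u₄ w₁ w₂ w₃ w₄ := by
  -- Interchanging the two factors of the Jacobian achieves s ≤ 1.
  wlog hle : a * d ≤ b * c generalizing a b c d with W
  · refine W hc hd ha hb ?_ (by linarith)
    obtain ⟨h1, h2, h3, h4, h5⟩ := H
    exact ⟨by linarith, by linarith, by linarith, by linarith, by linarith⟩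
  obtain ⟨h12, h13, h23, h24, h34⟩ := H
  have hpl : (u₁ * w₄ - u₄ * w₁) * (u₂ * w₃ - u₃ * w₂) = -(a * b * c * d) := by
    linear_combination (u₂ * w₄ - u₄ * w₂) * h13 - (u₃ * w₄ - u₄ * w₃) * h12 - b * d * h34
  obtain ⟨p, hp⟩ : ∃ p, p = u₂ * w₃ - u₃ * w₂ := ⟨_, rfl⟩
  obtain ⟨q, hq⟩ : ∃ q, q = u₁ * w₄ - u₄ * w₁ := ⟨_, rfl⟩
  rw [← hp, ← hq] at hpl h23
  have hne : q * p ≠ 0 := by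
    rw [hpl]
    exact neg_ne_zero.mpr (by positivity)
  -- Neither of the two middle Plücker coordinates vanishes, so both can be divided by below.
  have hq0 := left_ne_zero_of_mul hne
  have hp0 := right_ne_zero_of_mul hne
  have hm : 0 < a / b := by positivity
  have hm2 := Real.sq_sqrt hm.le
  have hm0 := (Real.sqrt_pos.mpr hm).ne'
  have hs : a * d / (b * c) ∈ Set.Ioc (0 : ℝ) 1 :=
    ⟨by positivity, (div_le_one (by positivity)).mpr hle⟩
  have hα : 3 * (p / (b * c)) ^ 2 - (a * d / (b * c) + 1) * (p / (b * c)) - a * d / (b * c) = 0 := by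
    field_simp
    linear_combination p * h23 - hpl
  refine combine (a := -w₂) (b := u₂) (c := -w₁) (d := u₁) ?_ ?_
  · have : 0 < b * d := by positivity
    intro h0
    linarith
  suffices K : PencilOK (-(b * d)) 0 p 0 0 (b * d) 0 q by
    convert K using 1 <;> linarith
  refine torus (l := 1) (m := √(a / b)) one_ne_zero hm0 (smul_add (k := -1 / (b * c)) (r := 0)
    (div_ne_zero (by norm_num) (by positivity)) (smul_right (k := -√(a / b) / q)
    (div_ne_zero (neg_ne_zero.mpr hm0) hq0) ?_))
  have hpq : p / (b * c) = -(a * d) / q := by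
    rw [div_eq_div_iff (by positivity) hq0]
    linear_combination hpl
  convert listed_d hs hα using 1
  · rw [hm2]; field_simp; ring
  · ring
  · ring
  · ring
  · ring
  · rw [hpq]; field_simp; rw [hm2]; field_simp
  · ring
  · field_simp

/-- Two definite quadratics can be diagonalised simultaneously, here by a shear, a swap and a second
shear. -/
theorem of_definite {k A B C : ℝ} (hk : 0 < k) (hA : 0 < A) (hB : B ^ 2 < A * C)
    (H : FactoredJacobian u₁ u₂ u₃ u₄ w₁ w₂ w₃ w₄ 1 0 k A B C) :
    PencilOK u₁ u₂ u₃ u₄ w₁ w₂ w₃ w₄ := by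
  -- The condition that one shear parameter r removes both mixed terms; its discriminant (Ak - C)² +
  -- 4B²k is non-negative.
  obtain ⟨t, ht⟩ : ∃ t, -B * (t * t) + (A * k - C) * t + B * k = 0 := by
    by_cases hB0 : B = 0
    · exact ⟨0, by simp [hB0]⟩
    · refine exists_quadratic_eq_zero (neg_ne_zero.mpr hB0)
        ⟨√(discrim (-B) (A * k - C) (B * k)), (Real.mul_self_sqrt ?_).symm⟩
      rw [discrim]
      nlinarith [mul_nonneg hk.le (sq_nonneg B), sq_nonneg (A * k - C)]
  have hkt : 0 < k + t ^ 2 := by positivity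
  have hkt0 := hkt.ne'
  -- This r removes the mixed term of the first factor; the equation for t makes it remove that of
  -- the second as well.
  obtain ⟨r, hr⟩ : ∃ r, r * (k + t ^ 2) = -t := ⟨-t / (k + t ^ 2), by field_simp⟩
  have hD : 0 < C + 2 * B * t + A * t ^ 2 := by
    have : 0 < A * (C + 2 * B * t + A * t ^ 2) := by nlinarith [sq_nonneg (A * t + B)]
    exact pos_of_mul_pos_right this hA.le
  have hoff : B + A * t + (C + 2 * B * t + A * t ^ 2) * r = 0 := by
    have : (k + t ^ 2) * (B + A * t + (C + 2 * B * t + A * t ^ 2) * r) = 0 := by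
      linear_combination (C + 2 * B * t + A * t ^ 2) * hr + ht
    exact (mul_eq_zero.mp this).resolve_left hkt0
  have hE : 0 < A + (B + A * t) * r := by
    have : (C + 2 * B * t + A * t ^ 2) * (A + (B + A * t) * r) = A * C - B ^ 2 := by
      linear_combination (B + A * t) * hoff
    exact pos_of_mul_pos_right (by rw [this]; linarith) hD.le
  have hF : 0 < 1 + t * r := by
    have : (k + t ^ 2) * (1 + t * r) = k := by linear_combination t * hr
    exact pos_of_mul_pos_right (by rw [this]; exact hk) hkt.le
  refine shear t (swap (comm (shear r (of_diagonal hF hkt hE hD ?_))))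
  convert (H.shear t).swap.shear r using 1 <;>
    first | ring1 | linear_combination -hr | linear_combination -r * hr | linear_combination -hoff
          | linear_combination -r * hoff

/-- A complex root a + bi of the Jacobian gives a real quadratic factor. The shear by a centres it
to y² + b²x², and the complementary factor is definite because it too has no real root. -/
theorem of_no_root (h12 : 0 < u₁ * w₂ - u₂ * w₁)
    (H : ∀ t : ℝ, (u₁ * w₂ - u₂ * w₁) * t ^ 4 + 2 * (u₁ * w₃ - u₃ * w₁) * t ^ 3
      + (3 * (u₂ * w₃ - u₃ * w₂) + (u₁ * w₄ - u₄ * w₁)) * t ^ 2 + 2 * (u₂ * w₄ - u₄ * w₂) * t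
      + (u₃ * w₄ - u₄ * w₃) ≠ 0) : PencilOK u₁ u₂ u₃ u₄ w₁ w₂ w₃ w₄ := by
  obtain ⟨p, hp⟩ : ∃ p, p = u₁ * w₂ - u₂ * w₁ := ⟨_, rfl⟩
  obtain ⟨q, hq⟩ : ∃ q, q = u₁ * w₃ - u₃ * w₁ := ⟨_, rfl⟩
  obtain ⟨S, hS⟩ : ∃ S, S = 3 * (u₂ * w₃ - u₃ * w₂) + (u₁ * w₄ - u₄ * w₁) := ⟨_, rfl⟩
  obtain ⟨r, hr⟩ : ∃ r, r = u₂ * w₄ - u₄ * w₂ := ⟨_, rfl⟩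
  obtain ⟨s, hs⟩ : ∃ s, s = u₃ * w₄ - u₄ * w₃ := ⟨_, rfl⟩
  rw [← hp] at h12
  rw [← hp, ← hq, ← hS, ← hr, ← hs] at H
  obtain ⟨z, hz⟩ : ∃ z : ℂ, p * z ^ 4 + 2 * q * z ^ 3 + S * z ^ 2 + 2 * r * z + s = 0 := by
    obtain ⟨z, hz⟩ := IsAlgClosed.exists_root (Polynomial.C (p : ℂ) * Polynomial.X ^ 4
      + Polynomial.C (2 * q : ℂ) * Polynomial.X ^ 3 + Polynomial.C (S : ℂ) * Polynomial.X ^ 2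
      + Polynomial.C (2 * r : ℂ) * Polynomial.X + Polynomial.C (s : ℂ)) (by
        rw [show Polynomial.degree _ = 4 by compute_degree!; exact h12.ne']
        norm_num)
    exact ⟨z, by simpa [Polynomial.IsRoot] using hz⟩
  obtain ⟨a, b⟩ := z
  have hre := congrArg Complex.re hz
  have him := congrArg Complex.im hz
  simp [pow_succ] at hre him
  have hb : b ≠ 0 := by
    rintro rfl
    refine H a ?_
    linear_combination hre
  -- Real part of the quartic at a + bi, followed by the imaginary part divided by 2b.
  have e1 : p * b ^ 4 - (S + 6 * a * q + 6 * a ^ 2 * p) * b ^ 2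
      + (p * a ^ 4 + 2 * q * a ^ 3 + S * a ^ 2 + 2 * r * a + s) = 0 := by linear_combination hre
  have e2 : r + S * a + 3 * q * a ^ 2 + 2 * p * a ^ 3 = (q + 2 * a * p) * b ^ 2 := by
    have : (2 * b) * (r + S * a + 3 * q * a ^ 2 + 2 * p * a ^ 3 - (q + 2 * a * p) * b ^ 2) = 0 := by
      linear_combination him
    rcases mul_eq_zero.mp this with h0 | h0
    · exact absurd h0 (by simpa using hb)
    · linarith
  have hk : 0 < b ^ 2 := by positivity
  obtain ⟨C, hC⟩ : ∃ C, C = S + 6 * a * q + 6 * a ^ 2 * p - b ^ 2 * p := ⟨_, rfl⟩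
  refine shear a (of_definite (k := b ^ 2) (A := p) (B := q + 2 * a * p) (C := C) hk h12 ?_ ?_)
  · by_contra! hle
    obtain ⟨y, hy⟩ := exists_quadratic_eq_zero (a := p) (b := 2 * (q + 2 * a * p)) (c := C) h12.ne'
      ⟨√(discrim p (2 * (q + 2 * a * p)) C), (Real.mul_self_sqrt (by rw [discrim]; linarith)).symm⟩
    refine H (y + a) ?_
    linear_combination (y ^ 2 + b ^ 2) * hy + 2 * y * e2 + e1 - (y ^ 2 + b ^ 2) * hC
  · constructor
    · linear_combination -hp
    · linear_combination -hq - 2 * a * hp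
    · linear_combination -hS - 6 * a * hq - 6 * a ^ 2 * hp - hC
    · linear_combination -hr - a * hS - 3 * a ^ 2 * hq - 2 * a ^ 3 * hp + e2
    · linear_combination -hs - 2 * a * hr - a ^ 2 * hS - 2 * a ^ 3 * hq - a ^ 4 * hp + e1 - b ^ 2 * hC

/-- If the first minor vanishes, some non-zero member has z₁ = z₂ = 0, that is, a double root at x =
0. -/
theorem of_first_minor (H : ∀ x y : ℝ, x * u₁ + y * w₁ = 0 → x * u₂ + y * w₂ = 0 →
    x * u₃ + y * w₃ = 0 → x * u₄ + y * w₄ = 0 → x = 0 ∧ y = 0)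
    (h12 : u₁ * w₂ - u₂ * w₁ = 0) : PencilOK u₁ u₂ u₃ u₄ w₁ w₂ w₃ w₄ := by
  obtain ⟨x, y, hxy, h1, h2⟩ : ∃ x y, (x ≠ 0 ∨ y ≠ 0) ∧ x * u₁ + y * w₁ = 0 ∧
      x * u₂ + y * w₂ = 0 := by
    by_cases h1 : u₁ = 0 ∧ w₁ = 0
    · by_cases h2 : u₂ = 0 ∧ w₂ = 0
      · exact ⟨1, 0, by simp, by simp [h1], by simp [h2]⟩
      · exact ⟨-w₂, u₂, by simp; tauto, by simp [h1], by ring⟩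
    · exact ⟨-w₁, u₁, by simp; tauto, by ring, by linear_combination h12⟩
  have hne : x * u₃ + y * w₃ ≠ 0 ∨ x * u₄ + y * w₄ ≠ 0 := by
    by_contra! h0
    have := H x y h1 h2 h0.1 h0.2
    tauto
  by_cases hy : y = 0
  · have hx : x ≠ 0 := by tauto
    refine combine (a := 0) (b := 1) (c := x) (d := y) (by simpa using hx) ?_
    rw [h1, h2]
    exact of_double_root hne
  · refine combine (a := 1) (b := 0) (c := x) (d := y) (by simpa using hy) ?_
    rw [h1, h2]
    exact of_double_root hne

/-- A real Jacobian root t turns the last minor to zero after the shear by t, and the swap makes it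
the first minor. Without real roots `of_no_root` applies, up to exchanging the generators. -/
theorem of_independent (H : ∀ x y : ℝ, x * u₁ + y * w₁ = 0 → x * u₂ + y * w₂ = 0 →
    x * u₃ + y * w₃ = 0 → x * u₄ + y * w₄ = 0 → x = 0 ∧ y = 0) :
    PencilOK u₁ u₂ u₃ u₄ w₁ w₂ w₃ w₄ := by
  by_cases h12 : u₁ * w₂ - u₂ * w₁ = 0
  · exact of_first_minor H h12
  by_cases hroot : ∀ t : ℝ, (u₁ * w₂ - u₂ * w₁) * t ^ 4 + 2 * (u₁ * w₃ - u₃ * w₁) * t ^ 3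
      + (3 * (u₂ * w₃ - u₃ * w₂) + (u₁ * w₄ - u₄ * w₁)) * t ^ 2 + 2 * (u₂ * w₄ - u₄ * w₂) * t
      + (u₃ * w₄ - u₄ * w₃) ≠ 0
  · rcases lt_or_gt_of_ne h12 with h | h
    · refine comm (of_no_root (by linarith) fun t ht => hroot t ?_)
      linear_combination -ht
    · exact of_no_root h hroot
  · push Not at hroot
    obtain ⟨t, ht⟩ := hroot
    refine shear t (swap (of_first_minor (fun x y h4 h3 h2 h1 => ?_) ?_))
    · have k2 : x * u₂ + y * w₂ = 0 := by linear_combination h2 - t * h1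
      have k3 : x * u₃ + y * w₃ = 0 := by linear_combination h3 - 2 * t * k2 - t ^ 2 * h1
      exact H x y h1 k2 k3 (by linear_combination h4 - 3 * t * k3 - 3 * t ^ 2 * k2 - t ^ 3 * h1)
    · linear_combination -ht

end PencilOK

theorem normalizable_swap {n₁ n₂ n₃ n₄ : ℝ}
    (H : Normalizable fun z₁ z₂ z₃ z₄ => n₄ * z₁ + n₃ * z₂ + n₂ * z₃ + n₁ * z₄ = 0) :
    Normalizable fun z₁ z₂ z₃ z₄ => n₁ * z₁ + n₂ * z₂ + n₃ * z₃ + n₄ * z₄ = 0 := by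
  refine Normalizable.swap (H.of_iff fun z₁ z₂ z₃ z₄ => ?_)
  constructor <;> intro h <;> linarith

theorem normalizable_torus {n₁ n₂ n₃ n₄ l m : ℝ} (hl : l ≠ 0) (hm : m ≠ 0)
    (H : Normalizable fun z₁ z₂ z₃ z₄ =>
      m ^ 2 / l * n₁ * z₁ + m * n₂ * z₂ + l * n₃ * z₃ + l ^ 2 / m * n₄ * z₄ = 0) :
    Normalizable fun z₁ z₂ z₃ z₄ => n₁ * z₁ + n₂ * z₂ + n₃ * z₃ + n₄ * z₄ = 0 := by
  refine Normalizable.torus hl hm (H.of_iff fun z₁ z₂ z₃ z₄ => ?_)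
  rw [show n₁ * (m ^ 2 / l * z₁) + n₂ * (m * z₂) + n₃ * (l * z₃) + n₄ * (l ^ 2 / m * z₄)
    = m ^ 2 / l * n₁ * z₁ + m * n₂ * z₂ + l * n₃ * z₃ + l ^ 2 / m * n₄ * z₄ by ring]

theorem normalizable_shear {n₁ n₂ n₃ n₄ : ℝ} (t : ℝ)
    (H : Normalizable fun z₁ z₂ z₃ z₄ => (n₁ + t * n₂ + t ^ 2 * n₃ + t ^ 3 * n₄) * z₁
      + (n₂ + 2 * t * n₃ + 3 * t ^ 2 * n₄) * z₂ + (n₃ + 3 * t * n₄) * z₃ + n₄ * z₄ = 0) :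
    Normalizable fun z₁ z₂ z₃ z₄ => n₁ * z₁ + n₂ * z₂ + n₃ * z₃ + n₄ * z₄ = 0 := by
  refine Normalizable.shear t (H.of_iff fun z₁ z₂ z₃ z₄ => ?_)
  constructor <;> intro h <;> linear_combination h

theorem normalizable_hyperplane_listed_first :
    Normalizable fun z₁ _ _ _ => z₁ = 0 := by
  refine (Normalizable.base (Z := Zc {1, 2, 3}) (Or.inl (by simp))).of_iff fun z₁ z₂ z₃ z₄ => ?_
  constructor
  · rintro rfl l hl
    fin_cases l <;> simp_all
  · intro h
    simpa using h 0 (by simp)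

theorem normalizable_hyperplane_listed_second :
    Normalizable fun _ z₂ _ _ => z₂ = 0 := by
  refine (Normalizable.base (Z := Zc {0, 2, 3}) (Or.inl (by simp))).of_iff fun z₁ z₂ z₃ z₄ => ?_
  constructor
  · rintro rfl l hl
    fin_cases l <;> simp_all
  · intro h
    simpa using h 1 (by simp)

theorem normalizable_hyperplane_special {κ : ℝ} (hκ : κ = 1 ∨ κ = -1) :
    Normalizable fun z₁ _ z₃ _ => z₃ = κ * z₁ := by
  refine (Normalizable.base (Or.inr (.e κ hκ))).of_iff fun z₁ z₂ z₃ z₄ => ?_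
  constructor
  · rintro rfl
    exact ⟨z₁, z₂, z₄, rfl⟩
  · rintro ⟨x, y, z, h⟩
    have h1 := congrFun h 0
    have h3 := congrFun h 2
    simp at h1 h3
    rw [h1, h3]

/-- Scaling y changes the ratio of the two coefficients by a positive square, so only its sign
survives. -/
theorem normalizable_hyperplane_mid {q p : ℝ} (hp : p ≠ 0) :
    Normalizable fun z₁ z₂ z₃ z₄ => q * z₁ + 0 * z₂ + p * z₃ + 0 * z₄ = 0 := by
  by_cases hq : q = 0
  · subst hq
    refine normalizable_swap (normalizable_hyperplane_listed_second.of_iff fun z₁ z₂ z₃ z₄ => ?_)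
    simp [hp]
  · obtain ⟨κ, hκ, m, hm, h⟩ : ∃ κ : ℝ, (κ = 1 ∨ κ = -1) ∧ ∃ m : ℝ, m ≠ 0 ∧ m ^ 2 * q = -κ * p := by
      rcases lt_or_gt_of_ne (div_ne_zero hp hq) with h | h
      · have h' : 0 < -(p / q) := by linarith
        refine ⟨1, Or.inl rfl, √(-(p / q)), (Real.sqrt_pos.mpr h').ne', ?_⟩
        rw [Real.sq_sqrt h'.le]
        field_simp
      · refine ⟨-1, Or.inr rfl, √(p / q), (Real.sqrt_pos.mpr h).ne', ?_⟩
        rw [Real.sq_sqrt h.le]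
        field_simp
    refine normalizable_torus (l := 1) (m := m) one_ne_zero hm
      ((normalizable_hyperplane_special hκ).of_iff fun z₁ z₂ z₃ z₄ => ?_)
    constructor
    · intro h0
      have : p * (z₃ - κ * z₁) = 0 := by linear_combination h0 - z₁ * h
      rcases mul_eq_zero.mp this with h1 | h1
      · exact absurd h1 hp
      · linarith
    · rintro rfl
      linear_combination z₁ * h

/-- After the swap, completing the square removes the z₂-coefficient if n₂ ≠ 0; otherwise the
equation reduces to z₂ = 0 or z₁ = 0. -/
theorem normalizable_hyperplane_of_first {n₂ n₃ n₄ : ℝ} (hn : n₂ ≠ 0 ∨ n₃ ≠ 0 ∨ n₄ ≠ 0) :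
    Normalizable fun z₁ z₂ z₃ z₄ => 0 * z₁ + n₂ * z₂ + n₃ * z₃ + n₄ * z₄ = 0 := by
  refine normalizable_swap ?_
  by_cases h2 : n₂ = 0
  · subst h2
    by_cases h3 : n₃ = 0
    · subst h3
      refine normalizable_hyperplane_listed_first.of_iff fun z₁ z₂ z₃ z₄ => ?_
      have h4 : n₄ ≠ 0 := by tauto
      simp [h4]
    · refine normalizable_shear (-n₄ / n₃) (normalizable_hyperplane_listed_second.of_iff
        fun z₁ z₂ z₃ z₄ => ?_)
      have h0 : n₄ + -n₄ / n₃ * n₃ = 0 := by field_simp; ring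
      simp [h3]
  · refine normalizable_shear (-n₃ / (2 * n₂)) ((normalizable_hyperplane_mid
      (q := n₄ + -n₃ / (2 * n₂) * n₃ + (-n₃ / (2 * n₂)) ^ 2 * n₂) h2).of_iff fun z₁ z₂ z₃ z₄ => ?_)
    have h0 : n₃ + 2 * (-n₃ / (2 * n₂)) * n₂ = 0 := by field_simp; ring
    simp [h0]

/-- The shear by t changes the coefficient of z₁ to n₁ + tn₂ + t²n₃ + t³n₄, which has a real zero
when n₄ ≠ 0. -/
theorem normalizable_hyperplane {n₁ n₂ n₃ n₄ : ℝ} (hn : n₁ ≠ 0 ∨ n₂ ≠ 0 ∨ n₃ ≠ 0 ∨ n₄ ≠ 0) :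
    Normalizable fun z₁ z₂ z₃ z₄ => n₁ * z₁ + n₂ * z₂ + n₃ * z₃ + n₄ * z₄ = 0 := by
  by_cases h4 : n₄ = 0
  · subst h4
    refine normalizable_swap (normalizable_hyperplane_of_first ?_)
    tauto
  · obtain ⟨t, ht⟩ := PencilOK.exists_cubic_root (n₃ / n₄) (n₂ / n₄) (n₁ / n₄)
    have h0 : n₁ + t * n₂ + t ^ 2 * n₃ + t ^ 3 * n₄ = 0 := by
      field_simp at ht
      linear_combination ht
    refine normalizable_shear t ?_
    rw [h0]
    exact normalizable_hyperplane_of_first (by tauto)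

/-- A subspace of `ℝ⁴` without kernel is equivalent to a listed one. -/
theorem normalizable_of_noKernel (Z : Submodule ℝ (Fin 4 → ℝ))
    (hk : NoKernel fun z₁ z₂ z₃ z₄ => ![z₁, z₂, z₃, z₄] ∈ Z) :
    Normalizable fun z₁ z₂ z₃ z₄ => ![z₁, z₂, z₃, z₄] ∈ Z := by
  have h4 : Module.finrank ℝ Z ≤ 4 := by simpa using Submodule.finrank_le Z
  obtain h | h | h | h : Module.finrank ℝ Z ≤ 1 ∨ Module.finrank ℝ Z = 2 ∨
    Module.finrank ℝ Z = 3 ∨ Module.finrank ℝ Z = 4 := by omega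
  · exfalso
    obtain ⟨v, hv⟩ := finrank_le_one_iff.mp h
    -- Two equations in three unknowns have a non-zero solution; the zero row only makes the matrix
    -- square.
    obtain ⟨x, hx, h1, h2⟩ : ∃ x : Fin 3 → ℝ, x ≠ 0 ∧ v.1 1 * x 0 + 2 * v.1 2 * x 1 + v.1 3 * x 2 = 0 ∧
        v.1 0 * x 0 + 2 * v.1 1 * x 1 + v.1 2 * x 2 = 0 := by
      obtain ⟨x, hx, hx0⟩ := Matrix.exists_mulVec_eq_zero_iff.mpr
        (show Matrix.det !![v.1 1, 2 * v.1 2, v.1 3; v.1 0, 2 * v.1 1, v.1 2; 0, 0, 0] = 0 by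
          simp [Matrix.det_fin_three])
      have h1 := congrFun hx0 0
      have h2 := congrFun hx0 1
      simp [Matrix.mulVec, dotProduct, Fin.sum_univ_three] at h1 h2
      exact ⟨x, hx, h1, h2⟩
    obtain ⟨e0, e1, e2⟩ := hk (x 0) (x 1) (x 2) fun z₁ z₂ z₃ z₄ hz => by
      obtain ⟨c, hc⟩ := hv ⟨_, hz⟩
      have hc' := congrArg Subtype.val hc
      have c0 := congrFun hc' 0
      have c1 := congrFun hc' 1
      have c2 := congrFun hc' 2
      have c3 := congrFun hc' 3
      simp at c0 c1 c2 c3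
      rw [← c0, ← c1, ← c2, ← c3]
      exact ⟨by linear_combination c * h1, by linear_combination c * h2⟩
    refine hx (funext fun i => ?_)
    fin_cases i <;> assumption
  · obtain ⟨b⟩ : Nonempty (Module.Basis (Fin 2) ℝ Z) := ⟨Module.finBasisOfFinrankEq ℝ Z h⟩
    have hiff : ∀ z₁ z₂ z₃ z₄, ![z₁, z₂, z₃, z₄] ∈ Z ↔ Pencil ((b 0).1 0) ((b 0).1 1) ((b 0).1 2)
        ((b 0).1 3) ((b 1).1 0) ((b 1).1 1) ((b 1).1 2) ((b 1).1 3) z₁ z₂ z₃ z₄ := by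
      intro z₁ z₂ z₃ z₄
      constructor
      · intro hz
        have hc := congrArg Subtype.val (b.sum_repr ⟨_, hz⟩)
        rw [Fin.sum_univ_two] at hc
        exact ⟨b.repr ⟨_, hz⟩ 0, b.repr ⟨_, hz⟩ 1, (congrFun hc 0).symm, (congrFun hc 1).symm,
          (congrFun hc 2).symm, (congrFun hc 3).symm⟩
      · rintro ⟨s, t, rfl, rfl, rfl, rfl⟩
        convert (s • b 0 + t • b 1).2 using 1
        ext i
        fin_cases i <;> simp
    refine Normalizable.of_iff (PencilOK.of_independent (fun x y h0 h1 h2 h3 => ?_) ?_) hiff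
    · have hxy : x • b 0 + y • b 1 = 0 := by
        ext i
        fin_cases i <;> simpa
      have := Fintype.linearIndependent_iff.mp b.linearIndependent ![x, y]
        (by simpa [Fin.sum_univ_two] using hxy)
      exact ⟨this 0, this 1⟩
    · have : Pencil ((b 0).1 0) ((b 0).1 1) ((b 0).1 2)
        ((b 0).1 3) ((b 1).1 0) ((b 1).1 1) ((b 1).1 2) ((b 1).1 3)
        = fun z₁ z₂ z₃ z₄ => ![z₁, z₂, z₃, z₄] ∈ Z := by
        funext z₁ z₂ z₃ z₄
        exact propext (hiff z₁ z₂ z₃ z₄).symm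
      rwa [this]
  · have hlt : Z < ⊤ := by
      refine lt_top_iff_ne_top.mpr ?_
      rintro rfl
      simp at h
    obtain ⟨f, hf, hle⟩ := Submodule.exists_le_ker_of_lt_top Z hlt
    have hker : Module.finrank ℝ (LinearMap.ker f) ≤ 3 := by
      have h1 : LinearMap.ker f ≠ ⊤ := by simpa [LinearMap.ker_eq_top] using hf
      have h2 := Submodule.finrank_lt (lt_top_iff_ne_top.mpr h1).ne
      simp at h2
      omega
    have heq : Z = LinearMap.ker f := Submodule.eq_of_le_of_finrank_le hle (by omega)
    have happ : ∀ z : Fin 4 → ℝ, f z = f (Pi.single 0 1) * z 0 + f (Pi.single 1 1) * z 1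
        + f (Pi.single 2 1) * z 2 + f (Pi.single 3 1) * z 3 := by
      intro z
      conv_lhs => rw [pi_eq_sum_univ' z]
      simp [Fin.sum_univ_four, mul_comm]
    refine (normalizable_hyperplane (n₁ := f (Pi.single 0 1)) (n₂ := f (Pi.single 1 1))
      (n₃ := f (Pi.single 2 1)) (n₄ := f (Pi.single 3 1)) ?_).of_iff fun z₁ z₂ z₃ z₄ => ?_
    · by_contra! h0
      refine hf (LinearMap.ext fun z => ?_)
      rw [happ, h0.1, h0.2.1, h0.2.2.1, h0.2.2.2]
      simp
    · rw [heq, LinearMap.mem_ker, happ]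
      simp
  · have : Z = ⊤ := Submodule.eq_top_of_finrank_eq (by simpa using h)
    refine (Normalizable.base (Z := Set.univ) (Or.inl (by simp))).of_iff fun z₁ z₂ z₃ z₄ => ?_
    simp [this]

end SplitG2

/-! ### From membership conditions to entries of the list. -/

namespace SplitG2

variable {V : Type*} [AddCommGroup V] [Module ℝ V] {e : Module.Basis (Fin 7) ℝ V}
  {h : LieSubalgebra ℝ (Module.End ℝ V)} {φ : V ≃ₗ[ℝ] (Fin 7 → ℝ)}

theorem hElem_mem_iff (A : Matrix (Fin 2) (Fin 2) ℝ) (z : Fin 4 → ℝ) (c : ℝ) :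
    hElem (frameBasis φ) A z c ∈ h ↔
      Mem φ h (A 0 0) (A 0 1) (A 1 0) (A 1 1) (z 0) (z 1) (z 2) (z 3) c := by
  rw [hElem_frameBasis, Mem]

theorem hElem_add (A B : Matrix (Fin 2) (Fin 2) ℝ) (z w : Fin 4 → ℝ) (c d : ℝ) :
    hElem (frameBasis φ) A z c + hElem (frameBasis φ) B w d
      = hElem (frameBasis φ) (A + B) (z + w) (c + d) := by
  simp only [hElem_frameBasis, ← coordEnd_add, ← hRat_add, Matrix.add_apply, Pi.add_apply]

theorem hElem_smul (t : ℝ) (A : Matrix (Fin 2) (Fin 2) ℝ) (z : Fin 4 → ℝ) (c : ℝ) :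
    t • hElem (frameBasis φ) A z c = hElem (frameBasis φ) (t • A) (t • z) (t * c) := by
  simp only [hElem_frameBasis, ← coordEnd_smul, ← hRat_smul, Matrix.smul_apply, Pi.smul_apply,
    smul_eq_mul]

theorem Good.exists_hElem (G : Good e h φ) {X : Module.End ℝ V} (hX : X ∈ h) :
    ∃ A z c, X = hElem (frameBasis φ) A z c := by
  obtain ⟨a₁, a₂, a₃, a₄, z₁, z₂, z₃, z₄, c, rfl⟩ := G.exists_params hX
  exact ⟨!![a₁, a₂; a₃, a₄], ![z₁, z₂, z₃, z₄], c, by rw [hElem_frameBasis]; simp⟩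

theorem matrix_eta (A : Matrix (Fin 2) (Fin 2) ℝ) : !![A 0 0, A 0 1; A 1 0, A 1 1] = A :=
  (Matrix.eta_fin_two A).symm

theorem vector_eta (z : Fin 4 → ℝ) : ![z 0, z 1, z 2, z 3] = z := by
  ext i
  fin_cases i <;> rfl

theorem Good.eq_semi (G : Good e h φ) {a : Set (Matrix (Fin 2) (Fin 2) ℝ)} {Z : Set (Fin 4 → ℝ)}
    (h0 : Z.Nonempty) (H : ∀ a₁ a₂ a₃ a₄ z₁ z₂ z₃ z₄ c, Mem φ h a₁ a₂ a₃ a₄ z₁ z₂ z₃ z₄ c ↔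
      !![a₁, a₂; a₃, a₄] ∈ a ∧ ![z₁, z₂, z₃, z₄] ∈ Z) :
    glProjection (frameBasis φ) h = a ∧
      (h : Set (Module.End ℝ V)) = semi (frameBasis φ) a Z := by
  have key : ∀ A z c, hElem (frameBasis φ) A z c ∈ h ↔ A ∈ a ∧ z ∈ Z := by
    intro A z c
    rw [hElem_mem_iff, H, matrix_eta, vector_eta]
  constructor
  · ext A
    simp only [glProjection, Set.mem_ofPred_eq, key]
    obtain ⟨z, hz⟩ := h0
    exact ⟨fun ⟨_, _, hA, _⟩ => hA, fun hA => ⟨z, 0, hA, hz⟩⟩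
  · ext X
    constructor
    · intro hX
      obtain ⟨A, z, c, rfl⟩ := G.exists_hElem hX
      have := (key _ _ _).mp hX
      exact ⟨A, this.1, z, this.2, c, by rw [hElem_add, add_zero, zero_add, zero_add]⟩
    · rintro ⟨A, hA, z, hz, c, rfl⟩
      rw [hElem_add, add_zero, zero_add, zero_add]
      exact (key _ _ _).mpr ⟨hA, hz⟩

theorem Good.eq_twistedSemi (G : Good e h φ) {A₀ : Matrix (Fin 2) (Fin 2) ℝ} {z₀ : Fin 4 → ℝ}
    {Z : Set (Fin 4 → ℝ)} (h0 : (0 : Fin 4 → ℝ) ∈ Z)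
    (H : ∀ a₁ a₂ a₃ a₄ z₁ z₂ z₃ z₄ c, Mem φ h a₁ a₂ a₃ a₄ z₁ z₂ z₃ z₄ c ↔
      ∃ t : ℝ, !![a₁, a₂; a₃, a₄] = t • A₀ ∧ ![z₁, z₂, z₃, z₄] - t • z₀ ∈ Z) :
    glProjection (frameBasis φ) h = line A₀ ∧
      (h : Set (Module.End ℝ V)) = twistedSemi (frameBasis φ) A₀ z₀ Z := by
  have key : ∀ A z c, hElem (frameBasis φ) A z c ∈ h ↔ ∃ t : ℝ, A = t • A₀ ∧ z - t • z₀ ∈ Z := by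
    intro A z c
    rw [hElem_mem_iff, H, matrix_eta, vector_eta]
  constructor
  · ext A
    simp only [glProjection, Set.mem_ofPred_eq, key]
    refine ⟨fun ⟨_, _, t, hA, _⟩ => ⟨t, hA⟩, fun ⟨t, hA⟩ => ⟨t • z₀, 0, t, hA, by simpa using h0⟩⟩
  · ext X
    constructor
    · intro hX
      obtain ⟨A, z, c, rfl⟩ := G.exists_hElem hX
      obtain ⟨t, rfl, hz⟩ := (key _ _ _).mp hX
      refine ⟨t, _, hz, c, ?_⟩
      rw [hElem_smul, hElem_add]
      simp
    · rintro ⟨t, z, hz, c, rfl⟩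
      rw [hElem_smul, hElem_add]
      exact (key _ _ _).mpr ⟨t, by simp, by simpa using hz⟩

/-- The conclusion of the classification. -/
def Classified (e : Module.Basis (Fin 7) ℝ V) (h : LieSubalgebra ℝ (Module.End ℝ V)) : Prop :=
  ∃ ψ, Good e h ψ ∧ InList (frameBasis ψ) (glProjection (frameBasis ψ) h) h

section Center

variable {a₁ a₂ a₃ a₄ z₁ z₂ z₃ z₄ c b₁ b₂ b₃ b₄ w₁ w₂ w₃ w₄ d : ℝ}

theorem Mem.congr (hx : Mem φ h a₁ a₂ a₃ a₄ z₁ z₂ z₃ z₄ c) (e1 : b₁ = a₁) (e2 : b₂ = a₂)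
    (e3 : b₃ = a₃) (e4 : b₄ = a₄) (f1 : w₁ = z₁) (f2 : w₂ = z₂) (f3 : w₃ = z₃) (f4 : w₄ = z₄)
    (e5 : d = c) : Mem φ h b₁ b₂ b₃ b₄ w₁ w₂ w₃ w₄ d := by
  rw [e1, e2, e3, e4, f1, f2, f3, f4, e5]
  exact hx

/-- Once the centre lies in 𝔥, the last parameter is irrelevant. -/
theorem Mem.center (hc : Mem φ h 0 0 0 0 0 0 0 0 1) (hx : Mem φ h a₁ a₂ a₃ a₄ z₁ z₂ z₃ z₄ c)
    (d : ℝ) : Mem φ h a₁ a₂ a₃ a₄ z₁ z₂ z₃ z₄ d := by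
  convert hx.add (hc.smul (d - c)) using 1 <;> ring

theorem Mem.center_of_ne (hx : Mem φ h 0 0 0 0 0 0 0 0 c) (h0 : c ≠ 0) :
    Mem φ h 0 0 0 0 0 0 0 0 1 := by
  convert hx.smul c⁻¹ using 1 <;> simp [h0]

end Center

end SplitG2

/-! ### The centre of the nilradical: nilpotent algebras. -/

namespace SplitG2

variable {V : Type*} [AddCommGroup V] [Module ℝ V] {e : Module.Basis (Fin 7) ℝ V}
  {h : LieSubalgebra ℝ (Module.End ℝ V)} {φ : V ≃ₗ[ℝ] (Fin 7 → ℝ)}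

/-- The invariant symplectic form on binary cubics. -/
def cubicForm (z w : Fin 4 → ℝ) : ℝ :=
  -(z 0 * w 3 - z 3 * w 0) + 3 * (z 1 * w 2 - z 2 * w 1)

/-- The form is non-degenerate and embeds an isotropic subspace into its own annihilator. -/
theorem finrank_le_two_of_isotropic {Z : Submodule ℝ (Fin 4 → ℝ)}
    (H : ∀ z ∈ Z, ∀ w ∈ Z, cubicForm z w = 0) : Module.finrank ℝ Z ≤ 2 := by
  let J : (Fin 4 → ℝ) →ₗ[ℝ] Module.Dual ℝ (Fin 4 → ℝ) := LinearMap.mk₂ ℝ cubicForm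
    (fun x y z => by simp only [cubicForm, Pi.add_apply]; ring)
    (fun c x z => by simp only [cubicForm, Pi.smul_apply, smul_eq_mul]; ring)
    (fun x y z => by simp only [cubicForm, Pi.add_apply]; ring)
    (fun c x z => by simp only [cubicForm, Pi.smul_apply, smul_eq_mul]; ring)
  have hJ : Function.Injective J := by
    refine (injective_iff_map_eq_zero J).mpr fun z hz => ?_
    have hz' : ∀ w, cubicForm z w = 0 := fun w => LinearMap.congr_fun hz w
    have h0 := hz' ![1, 0, 0, 0]
    have h1 := hz' ![0, 1, 0, 0]
    have h2 := hz' ![0, 0, 1, 0]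
    have h3 := hz' ![0, 0, 0, 1]
    simp [cubicForm] at h0 h1 h2 h3
    ext i
    fin_cases i <;> simp_all
  have hle : Z.map J ≤ Z.dualAnnihilator := by
    rintro _ ⟨z, hz, rfl⟩
    rw [Submodule.mem_dualAnnihilator]
    exact fun w hw => H z hz w hw
  have h1 := Submodule.finrank_mono hle
  rw [← (Submodule.equivMapOfInjective J hJ Z).finrank_eq] at h1
  have h2 := Subspace.finrank_add_finrank_dualAnnihilator_eq Z
  simp at h2
  omega

/-- A subspace of dimension at most two cannot map onto ℝ³. -/
theorem exists_annihilator {Z : Submodule ℝ (Fin 4 → ℝ)} (hZ : Module.finrank ℝ Z ≤ 2)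
    (g : (Fin 4 → ℝ) →ₗ[ℝ] (Fin 3 → ℝ)) :
    ∃ k : Fin 3 → ℝ, k ≠ 0 ∧ ∀ z ∈ Z, k 0 * g z 0 + k 1 * g z 1 + k 2 * g z 2 = 0 := by
  have hlt : Z.map g < ⊤ := by
    refine lt_top_iff_ne_top.mpr fun htop => ?_
    have h1 := Submodule.finrank_map_le g Z
    rw [htop, finrank_top] at h1
    simp at h1
    omega
  obtain ⟨f, hf, hle⟩ := Submodule.exists_le_ker_of_lt_top _ hlt
  have happ : ∀ x : Fin 3 → ℝ, f x = f (Pi.single 0 1) * x 0 + f (Pi.single 1 1) * x 1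
      + f (Pi.single 2 1) * x 2 := by
    intro x
    conv_lhs => rw [pi_eq_sum_univ' x]
    simp [Fin.sum_univ_three, mul_comm]
  refine ⟨fun i => f (Pi.single i 1), fun h0 => hf (LinearMap.ext fun x => ?_), fun z hz => ?_⟩
  · have e0 := congrFun h0 0
    have e1 := congrFun h0 1
    have e2 := congrFun h0 2
    simp only [Pi.zero_apply] at e0 e1 e2
    rw [happ, e0, e1, e2]
    simp
  · rw [← happ]
    exact hle ⟨z, hz, rfl⟩

/-- If `h` is nilpotent, it contains the centre of the nilradical of `𝔭₂`. -/
theorem Good.center_of_nilpotent (G : Good e h φ)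
    (hA : ∀ a₁ a₂ a₃ a₄ z₁ z₂ z₃ z₄ c, Mem φ h a₁ a₂ a₃ a₄ z₁ z₂ z₃ z₄ c →
      a₁ = 0 ∧ a₂ = 0 ∧ a₃ = 0 ∧ a₄ = 0) : Mem φ h 0 0 0 0 0 0 0 0 1 := by
  by_contra hcen
  have hc : ∀ c, Mem φ h 0 0 0 0 0 0 0 0 c → c = 0 := fun c hm => by
    by_contra h0
    exact hcen (hm.center_of_ne h0)
  let Z : Submodule ℝ (Fin 4 → ℝ) :=
    { carrier := {z | ∃ c, Mem φ h 0 0 0 0 (z 0) (z 1) (z 2) (z 3) c}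
      zero_mem' := ⟨0, Mem.zero⟩
      add_mem' := by
        rintro z w ⟨c, hz⟩ ⟨d, hw⟩
        exact ⟨c + d, by simpa using hz.add hw⟩
      smul_mem' := by
        rintro t z ⟨c, hz⟩
        exact ⟨t * c, by simpa using hz.smul t⟩ }
  have hiso : ∀ z ∈ Z, ∀ w ∈ Z, cubicForm z w = 0 := by
    rintro z ⟨c, hz⟩ w ⟨d, hw⟩
    refine hc _ ((hz.lie hw).congr ?_ ?_ ?_ ?_ ?_ ?_ ?_ ?_ ?_) <;> simp [cubicForm]
  have hdim := finrank_le_two_of_isotropic hiso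
  -- All 𝔤𝔩(2,ℝ)-parts vanish, hence so do p, q and r. The four remaining rows of interest are the
  -- windows of length four in the sequence s₀, …, s₆.
  have hcurv : ∀ {p₀ p₁ p₂ p₃ p₄ q₀ q₁ q₂ q₃ q₄ s₀ s₁ s₂ s₃ s₄ s₅ s₆ r₁ r₂ r₃ r₄ v₁ v₂ v₃ v₄ w},
      Curv φ h p₀ p₁ p₂ p₃ p₄ q₀ q₁ q₂ q₃ q₄ s₀ s₁ s₂ s₃ s₄ s₅ s₆ r₁ r₂ r₃ r₄ v₁ v₂ v₃ v₄ w →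
      (p₀ = 0 ∧ p₁ = 0 ∧ p₂ = 0 ∧ p₃ = 0 ∧ p₄ = 0) ∧ (q₀ = 0 ∧ q₁ = 0 ∧ q₂ = 0 ∧ q₃ = 0 ∧ q₄ = 0) ∧
      (r₁ = 0 ∧ r₂ = 0 ∧ r₃ = 0 ∧ r₄ = 0) ∧ Mem φ h 0 0 0 0 s₀ s₁ s₂ s₃ v₁ ∧
      Mem φ h 0 0 0 0 s₁ s₂ s₃ s₄ v₂ ∧ Mem φ h 0 0 0 0 s₂ s₃ s₄ s₅ v₃ ∧
      Mem φ h 0 0 0 0 s₃ s₄ s₅ s₆ v₄ := by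
    intro p₀ p₁ p₂ p₃ p₄ q₀ q₁ q₂ q₃ q₄ s₀ s₁ s₂ s₃ s₄ s₅ s₆ r₁ r₂ r₃ r₄ v₁ v₂ v₃ v₄ w C
    obtain ⟨rfl, rfl, rfl, rfl⟩ := hA _ _ _ _ _ _ _ _ _ C.m37
    obtain ⟨rfl, rfl, -, -⟩ := hA _ _ _ _ _ _ _ _ _ C.m36
    obtain ⟨rfl, rfl, -, -⟩ := hA _ _ _ _ _ _ _ _ _ C.m57
    obtain ⟨rfl, rfl, -, -⟩ := hA _ _ _ _ _ _ _ _ _ C.m56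
    obtain ⟨rfl, rfl, rfl, rfl⟩ := hA _ _ _ _ _ _ _ _ _ C.m67
    have m37 := C.m37
    have m36 := C.m36
    have m57 := C.m57
    have m56 := C.m56
    simp only [sub_zero, add_zero] at m37 m36 m57 m56
    exact ⟨by simp, by simp, by simp, m37, m36, m57, m56⟩
  have hform : ∀ b₁ b₂ b₃ b₄ : ℝ,
      (∀ s₀ s₁ s₂ s₃ s₄ s₅ s₆ v₁ v₂ v₃ v₄, Mem φ h 0 0 0 0 s₀ s₁ s₂ s₃ v₁ →
        Mem φ h 0 0 0 0 s₁ s₂ s₃ s₄ v₂ → Mem φ h 0 0 0 0 s₂ s₃ s₄ s₅ v₃ →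
        Mem φ h 0 0 0 0 s₃ s₄ s₅ s₆ v₄ → b₁ * s₀ + b₂ * s₁ + b₃ * s₂ + b₄ * s₃ = 0 ∧
        b₁ * s₁ + b₂ * s₂ + b₃ * s₃ + b₄ * s₄ = 0 ∧ b₁ * s₂ + b₂ * s₃ + b₃ * s₄ + b₄ * s₅ = 0 ∧
        b₁ * s₃ + b₂ * s₄ + b₃ * s₅ + b₄ * s₆ = 0) →
      ∀ z ∈ Z, b₁ * z 0 + b₂ * z 1 + b₃ * z 2 + b₄ * z 3 = 0 := by
    rintro b₁ b₂ b₃ b₄ hb z ⟨c, hz⟩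
    have := G.linForm_eq_zero ![0, 0, 0, 0, b₁, b₂, b₃, b₄, 0] (fun p₀ p₁ p₂ p₃ p₄ q₀ q₁ q₂ q₃ q₄
      s₀ s₁ s₂ s₃ s₄ s₅ s₆ r₁ r₂ r₃ r₄ v₁ v₂ v₃ v₄ w C => by
        obtain ⟨⟨rfl, rfl, rfl, rfl, rfl⟩, ⟨rfl, rfl, rfl, rfl, rfl⟩, ⟨rfl, rfl, rfl, rfl⟩,
          m37, m36, m57, m56⟩ := hcurv C
        obtain ⟨e1, e2, e3, e4⟩ := hb _ _ _ _ _ _ _ _ _ _ _ m37 m36 m57 m56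
        -- By the Hankel form of the windows, this combination of the four rows has zero ℝ⁴-part; it
        -- is central and therefore zero.
        have hv : b₁ * v₁ + b₂ * v₂ + b₃ * v₃ + b₄ * v₄ = 0 := by
          refine hc _ (((((m37.smul b₁).add (m36.smul b₂)).add (m57.smul b₃)).add
            (m56.smul b₄)).congr ?_ ?_ ?_ ?_ ?_ ?_ ?_ ?_ ?_) <;> linarith
        simp [linForm]
        exact ⟨e1, e2, e3, e4, hv⟩) hz
    simpa [linForm] using this
  obtain ⟨k, hk0, hk⟩ := exists_annihilator hdim
    (LinearMap.pi ![LinearMap.proj 0, LinearMap.proj 1, LinearMap.proj 2])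
  obtain ⟨k', hk0', hk'⟩ := exists_annihilator hdim
    (LinearMap.pi ![LinearMap.proj 1, LinearMap.proj 2, LinearMap.proj 3])
  simp at hk hk'
  have hkm : ∀ {z₁ z₂ z₃ z₄ c}, Mem φ h 0 0 0 0 z₁ z₂ z₃ z₄ c →
      k 0 * z₁ + k 1 * z₂ + k 2 * z₃ = 0 := fun {z₁ z₂ z₃ z₄ c} hm => by
    simpa using hk ![z₁, z₂, z₃, z₄] ⟨c, by simpa using hm⟩
  have hkm' : ∀ {z₁ z₂ z₃ z₄ c}, Mem φ h 0 0 0 0 z₁ z₂ z₃ z₄ c →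
      k' 0 * z₂ + k' 1 * z₃ + k' 2 * z₄ = 0 := fun {z₁ z₂ z₃ z₄ c} hm => by
    simpa using hk' ![z₁, z₂, z₃, z₄] ⟨c, by simpa using hm⟩
  -- A form that annihilates both the first and the last three coordinates of Z would be a kernel
  -- vector in the middle block.
  have hker : ∀ k : Fin 3 → ℝ, k ≠ 0 → (∀ z ∈ Z, k 0 * z 0 + k 1 * z 1 + k 2 * z 2 = 0) →
      ¬ ∀ z ∈ Z, k 0 * z 1 + k 1 * z 2 + k 2 * z 3 = 0 := by
    intro k hk0 h1 h2
    obtain ⟨e0, e1, e2⟩ := G.middle_eq_zero (x₃ := k 0) (x₄ := k 1 / 2) (x₅ := k 2)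
      fun a₁ a₂ a₃ a₄ z₁ z₂ z₃ z₄ c hm => by
        obtain ⟨rfl, rfl, rfl, rfl⟩ := hA _ _ _ _ _ _ _ _ _ hm
        have hz : ![z₁, z₂, z₃, z₄] ∈ Z := ⟨c, by simpa using hm⟩
        have f1 := h1 _ hz
        have f2 := h2 _ hz
        simp at f1 f2
        exact ⟨by linarith, by linarith, 0, by ring, by ring, by ring⟩
    refine hk0 (funext fun i => ?_)
    fin_cases i <;> simp <;> linarith
  -- If k killed the last triple of every such sequence, Berger's criterion would make it kill the
  -- last three coordinates of Z.
  obtain ⟨s₀, s₁, s₂, s₃, s₄, s₅, s₆, v₁, v₂, v₃, v₄, m37, m36, m57, m56, hs⟩ :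
      ∃ s₀ s₁ s₂ s₃ s₄ s₅ s₆ v₁ v₂ v₃ v₄, Mem φ h 0 0 0 0 s₀ s₁ s₂ s₃ v₁ ∧
        Mem φ h 0 0 0 0 s₁ s₂ s₃ s₄ v₂ ∧ Mem φ h 0 0 0 0 s₂ s₃ s₄ s₅ v₃ ∧
        Mem φ h 0 0 0 0 s₃ s₄ s₅ s₆ v₄ ∧ k 0 * s₄ + k 1 * s₅ + k 2 * s₆ ≠ 0 := by
    by_contra! hno
    refine hker k hk0 hk fun z hz => ?_
    have := hform 0 (k 0) (k 1) (k 2) (fun s₀ s₁ s₂ s₃ s₄ s₅ s₆ v₁ v₂ v₃ v₄ m37 m36 m57 m56 => by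
      have f2 := hkm m36
      have f3 := hkm m57
      have f4 := hkm m56
      have f5 := hno _ _ _ _ _ _ _ _ _ _ _ m37 m36 m57 m56
      exact ⟨by linarith, by linarith, by linarith, by linarith⟩) z hz
    linarith
  obtain ⟨s₀', s₁', s₂', s₃', s₄', s₅', s₆', v₁', v₂', v₃', v₄', m37', m36', m57', m56', hs'⟩ :
      ∃ s₀ s₁ s₂ s₃ s₄ s₅ s₆ v₁ v₂ v₃ v₄, Mem φ h 0 0 0 0 s₀ s₁ s₂ s₃ v₁ ∧
        Mem φ h 0 0 0 0 s₁ s₂ s₃ s₄ v₂ ∧ Mem φ h 0 0 0 0 s₂ s₃ s₄ s₅ v₃ ∧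
        Mem φ h 0 0 0 0 s₃ s₄ s₅ s₆ v₄ ∧ k' 0 * s₀ + k' 1 * s₁ + k' 2 * s₂ ≠ 0 := by
    by_contra! hno
    refine hker k' hk0' (fun z hz => ?_) hk'
    have := hform (k' 0) (k' 1) (k' 2) 0 (fun s₀ s₁ s₂ s₃ s₄ s₅ s₆ v₁ v₂ v₃ v₄ m37 m36 m57 m56 => by
      have f2 := hkm' m37
      have f3 := hkm' m36
      have f4 := hkm' m57
      have f5 := hno _ _ _ _ _ _ _ _ _ _ _ m37 m36 m57 m56
      exact ⟨by linarith, by linarith, by linarith, by linarith⟩) z hz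
    linarith
  -- The outer windows of the two sequences show that T is onto. As Z has dimension at most two, T
  -- is injective.
  let T : Z →ₗ[ℝ] (Fin 2 → ℝ) := LinearMap.pi ![
    (k 0 • LinearMap.proj 1 + k 1 • LinearMap.proj 2 + k 2 • LinearMap.proj 3) ∘ₗ Z.subtype,
    (k' 0 • LinearMap.proj 0 + k' 1 • LinearMap.proj 1 + k' 2 • LinearMap.proj 2) ∘ₗ Z.subtype]
  have hT0 : ∀ z, T z 0 = k 0 * z.1 1 + k 1 * z.1 2 + k 2 * z.1 3 := fun z => by simp [T]
  have hT1 : ∀ z, T z 1 = k' 0 * z.1 0 + k' 1 * z.1 1 + k' 2 * z.1 2 := fun z => by simp [T]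
  have hsurj : Function.Surjective T := by
    intro y
    refine ⟨(y 0 / (k 0 * s₄ + k 1 * s₅ + k 2 * s₆)) • ⟨![s₃, s₄, s₅, s₆], v₄, by simpa using m56⟩
      + (y 1 / (k' 0 * s₀' + k' 1 * s₁' + k' 2 * s₂')) •
        ⟨![s₀', s₁', s₂', s₃'], v₁', by simpa using m37'⟩, ?_⟩
    have f1 := hkm m36'
    have f2 := hkm' m57
    rw [map_add, map_smul, map_smul]
    ext i
    fin_cases i
    · simp [hT0, f1, hs]
    · simp [hT1, f2, hs']
  have hinj : Function.Injective T := by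
    refine (LinearMap.injective_iff_surjective_of_finrank_eq_finrank ?_).mpr hsurj
    have := LinearMap.finrank_le_finrank_of_surjective (f := T) hsurj
    simp at this ⊢
    omega
  have hz0 : ∀ z ∈ Z, k 0 * z 1 + k 1 * z 2 + k 2 * z 3 = 0 →
      k' 0 * z 0 + k' 1 * z 1 + k' 2 * z 2 = 0 → z = 0 := by
    intro z hz h1 h2
    have : (⟨z, hz⟩ : Z) = 0 := hinj (by
      ext i
      fin_cases i
      · simpa [hT0] using h1
      · simpa [hT1] using h2)
    exact congrArg Subtype.val this
  -- The inner windows lie in the kernel of T, so only the two ends of a sequence can survive.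
  have hmid : ∀ s₀ s₁ s₂ s₃ s₄ s₅ s₆ v₁ v₂ v₃ v₄, Mem φ h 0 0 0 0 s₀ s₁ s₂ s₃ v₁ →
      Mem φ h 0 0 0 0 s₁ s₂ s₃ s₄ v₂ → Mem φ h 0 0 0 0 s₂ s₃ s₄ s₅ v₃ →
      Mem φ h 0 0 0 0 s₃ s₄ s₅ s₆ v₄ → s₁ = 0 ∧ s₂ = 0 ∧ s₃ = 0 ∧ s₄ = 0 ∧ s₅ = 0 := by
    intro s₀ s₁ s₂ s₃ s₄ s₅ s₆ v₁ v₂ v₃ v₄ m37 m36 m57 m56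
    have h1 := hz0 ![s₁, s₂, s₃, s₄] ⟨v₂, by simpa using m36⟩ (by simpa using hkm m57)
      (by simpa using hkm' m37)
    have h2 := hz0 ![s₂, s₃, s₄, s₅] ⟨v₃, by simpa using m57⟩ (by simpa using hkm m56)
      (by simpa using hkm' m36)
    exact ⟨congrFun h1 0, congrFun h1 1, congrFun h1 2, congrFun h1 3, congrFun h2 3⟩
  obtain ⟨rfl, rfl, rfl, rfl, rfl⟩ := hmid _ _ _ _ _ _ _ _ _ _ _ m37 m36 m57 m56
  obtain ⟨rfl, rfl, rfl, rfl, rfl⟩ := hmid _ _ _ _ _ _ _ _ _ _ _ m37' m36' m57' m56'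
  -- Z would contain multiples of the first and the fourth basis vector, which pair non-trivially.
  have := hiso ![s₀', 0, 0, 0] ⟨v₁', by simpa using m37'⟩ ![0, 0, 0, s₆] ⟨v₄, by simpa using m56⟩
  simp [cubicForm] at this
  rcases this with rfl | rfl
  · simp at hs'
  · simp at hs

end SplitG2

/-! ### The centre of the nilradical: diagonal projection. -/

namespace SplitG2

variable {V : Type*} [AddCommGroup V] [Module ℝ V] {e : Module.Basis (Fin 7) ℝ V}
  {h : LieSubalgebra ℝ (Module.End ℝ V)} {φ : V ≃ₗ[ℝ] (Fin 7 → ℝ)}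

/-- The projection of `h` to `𝔤𝔩(2,ℝ)` consists of diagonal matrices. -/
def IsDiagonal (φ : V ≃ₗ[ℝ] (Fin 7 → ℝ)) (h : LieSubalgebra ℝ (Module.End ℝ V)) : Prop :=
  ∀ a₁ a₂ a₃ a₄ z₁ z₂ z₃ z₄ c, Mem φ h a₁ a₂ a₃ a₄ z₁ z₂ z₃ z₄ c → a₂ = 0 ∧ a₃ = 0

theorem IsDiagonal.curv (hD : IsDiagonal φ h)
    {p₀ p₁ p₂ p₃ p₄ q₀ q₁ q₂ q₃ q₄ s₀ s₁ s₂ s₃ s₄ s₅ s₆ r₁ r₂ r₃ r₄ v₁ v₂ v₃ v₄ w : ℝ}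
    (C : Curv φ h p₀ p₁ p₂ p₃ p₄ q₀ q₁ q₂ q₃ q₄ s₀ s₁ s₂ s₃ s₄ s₅ s₆ r₁ r₂ r₃ r₄ v₁ v₂ v₃ v₄ w) :
    (p₀ = 0 ∧ p₁ = 0 ∧ p₂ = 0 ∧ p₃ = 0) ∧ (q₁ = 0 ∧ q₂ = 0 ∧ q₃ = 0 ∧ q₄ = 0) ∧ r₂ = 0 ∧ r₃ = 0 := by
  obtain ⟨h1, h2⟩ := hD _ _ _ _ _ _ _ _ _ C.m37
  obtain ⟨h3, h4⟩ := hD _ _ _ _ _ _ _ _ _ C.m36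
  obtain ⟨h5, h6⟩ := hD _ _ _ _ _ _ _ _ _ C.m57
  obtain ⟨h7, h8⟩ := hD _ _ _ _ _ _ _ _ _ C.m56
  obtain ⟨h9, h10⟩ := hD _ _ _ _ _ _ _ _ _ C.m67
  exact ⟨⟨h2, h4, h6, h8⟩, ⟨h1, h3, h5, h7⟩, h9, h10⟩

/-- Without the centre, the given element forces z₁ = 0 on 𝔥; the curvature rows then give a₄ = 0
and z₂ = 0, so the first vector of the middle block is a common eigenvector. -/
theorem Good.center_of_last_pure (G : Good e h φ) (hD : IsDiagonal φ h)
    (hE : Mem φ h 0 0 0 0 0 0 0 1 0) : Mem φ h 0 0 0 0 0 0 0 0 1 := by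
  by_contra hcen
  have hc : ∀ c, Mem φ h 0 0 0 0 0 0 0 0 c → c = 0 := fun c hm => by
    by_contra h0
    exact hcen (hm.center_of_ne h0)
  -- Bracketing with the fourth vector gives a multiple of that vector plus z₁ times the centre.
  have hz1 : ∀ {a₁ a₂ a₃ a₄ z₁ z₂ z₃ z₄ c}, Mem φ h a₁ a₂ a₃ a₄ z₁ z₂ z₃ z₄ c → z₁ = 0 := by
    intro a₁ a₂ a₃ a₄ z₁ z₂ z₃ z₄ c hm
    obtain ⟨rfl, rfl⟩ := hD _ _ _ _ _ _ _ _ _ hm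
    exact hc _ ((hE.smul (2 * a₁ - a₄)).sub (hm.lie hE) |>.congr (by ring) (by ring) (by ring)
      (by ring) (by ring) (by ring) (by ring) (by ring) (by ring))
  have hcurv : ∀ {p₀ p₁ p₂ p₃ p₄ q₀ q₁ q₂ q₃ q₄ s₀ s₁ s₂ s₃ s₄ s₅ s₆ r₁ r₂ r₃ r₄ v₁ v₂ v₃ v₄ w},
      Curv φ h p₀ p₁ p₂ p₃ p₄ q₀ q₁ q₂ q₃ q₄ s₀ s₁ s₂ s₃ s₄ s₅ s₆ r₁ r₂ r₃ r₄ v₁ v₂ v₃ v₄ w →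
      ((p₀ = 0 ∧ p₁ = 0 ∧ p₂ = 0 ∧ p₃ = 0) ∧ (q₀ = 0 ∧ q₁ = 0 ∧ q₂ = 0 ∧ q₃ = 0 ∧ q₄ = 0) ∧
      (r₁ = 0 ∧ r₂ = 0 ∧ r₃ = 0 ∧ r₄ = 0)) ∧ (s₀ = 0 ∧ s₁ = 0 ∧ s₂ = 0 ∧ s₃ = 0) ∧
      (v₁ = 0 ∧ v₂ = 0) ∧ Mem φ h 0 0 0 0 0 0 s₄ s₅ v₃ := by
    intro p₀ p₁ p₂ p₃ p₄ q₀ q₁ q₂ q₃ q₄ s₀ s₁ s₂ s₃ s₄ s₅ s₆ r₁ r₂ r₃ r₄ v₁ v₂ v₃ v₄ w C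
    obtain ⟨⟨rfl, rfl, rfl, rfl⟩, ⟨rfl, rfl, rfl, rfl⟩, rfl, rfl⟩ := hD.curv C
    obtain rfl := hz1 C.m27
    obtain rfl := hc _ C.m27
    obtain rfl := hz1 C.m37
    obtain rfl := hz1 C.m36
    obtain rfl := hz1 C.m57
    obtain rfl := hz1 C.m67
    have h3 := hz1 C.m56
    obtain rfl : s₃ = r₁ := by linarith
    have m36 := C.m36
    have m57 := C.m57
    obtain rfl : s₃ = 0 := by
      have := hc (-3 * s₃ ^ 2) ((m36.lie m57).congr (by ring) (by ring) (by ring) (by ring)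
        (by ring) (by ring) (by ring) (by ring) (by ring))
      simpa using this
    obtain rfl := hc v₂ ((m36.sub (hE.smul s₄)).congr (by ring) (by ring) (by ring) (by ring)
        (by ring) (by ring) (by ring) (by ring) (by ring))
    exact ⟨by simp, by simp, by simp, m57⟩
  have ha4 : ∀ {a₁ a₂ a₃ a₄ z₁ z₂ z₃ z₄ c}, Mem φ h a₁ a₂ a₃ a₄ z₁ z₂ z₃ z₄ c → a₄ = 0 := by
    intro a₁ a₂ a₃ a₄ z₁ z₂ z₃ z₄ c hm
    have := G.linForm_eq_zero ![0, 0, 0, 1, 0, 0, 0, 0, 0] (fun p₀ p₁ p₂ p₃ p₄ q₀ q₁ q₂ q₃ q₄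
      s₀ s₁ s₂ s₃ s₄ s₅ s₆ r₁ r₂ r₃ r₄ v₁ v₂ v₃ v₄ w C => by
        obtain ⟨⟨⟨rfl, rfl, rfl, rfl⟩, ⟨rfl, rfl, rfl, rfl, rfl⟩, ⟨rfl, rfl, rfl, rfl⟩⟩, -⟩ :=
          hcurv C
        simp [linForm]) hm
    simpa [linForm] using this
  have hz2 : ∀ {a₁ a₂ a₃ a₄ z₁ z₂ z₃ z₄ c}, Mem φ h a₁ a₂ a₃ a₄ z₁ z₂ z₃ z₄ c → z₂ = 0 := by
    intro a₁ a₂ a₃ a₄ z₁ z₂ z₃ z₄ c hm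
    by_contra h2
    have := G.linForm_eq_zero ![0, 0, 0, 0, 0, 1, 0, 0, 0] (fun p₀ p₁ p₂ p₃ p₄ q₀ q₁ q₂ q₃ q₄
      s₀ s₁ s₂ s₃ s₄ s₅ s₆ r₁ r₂ r₃ r₄ v₁ v₂ v₃ v₄ w C => by
        obtain ⟨⟨⟨rfl, rfl, rfl, rfl⟩, ⟨rfl, rfl, rfl, rfl, rfl⟩, ⟨rfl, rfl, rfl, rfl⟩⟩,
          ⟨rfl, rfl, rfl, rfl⟩, ⟨rfl, rfl⟩, hY⟩ := hcurv C
        obtain ⟨rfl, rfl⟩ := hD _ _ _ _ _ _ _ _ _ hm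
        obtain rfl := ha4 hm
        have := hc (3 * z₂ * s₄) ((((hm.lie hY).sub (hY.smul a₁)).sub (hE.smul (a₁ * s₅))).congr
          (by ring) (by ring) (by ring) (by ring) (by ring) (by ring) (by ring) (by ring)
          (by rw [hz1 hm]; ring))
        have h4 : s₄ = 0 := by simpa [h2] using this
        simp [linForm, h4]) hm
    exact h2 (by simpa [linForm] using this)
  obtain ⟨h1, -⟩ := G.middle_eq_zero (x₃ := 1) (x₄ := 0) (x₅ := 0)
    fun a₁ a₂ a₃ a₄ z₁ z₂ z₃ z₄ c hm => by
      obtain ⟨rfl, rfl⟩ := hD _ _ _ _ _ _ _ _ _ hm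
      rw [hz1 hm, hz2 hm]
      exact ⟨by ring, by ring, a₁ - a₄, by ring, by ring, by ring⟩
  exact one_ne_zero h1

/-- A unipotent change of frame removes the central part r. -/
theorem Good.center_of_last (G : Good e h φ) (hD : IsDiagonal φ h) {p r : ℝ} (hp : p ≠ 0)
    (hE : Mem φ h 0 0 0 0 0 0 0 p r) : Mem φ h 0 0 0 0 0 0 0 0 1 := by
  obtain ⟨ψ, G', hψ⟩ := G.unip (-(r / p)) 0 0 0 0
  have h1 := G'.center_of_last_pure (fun a₁ a₂ a₃ a₄ z₁ z₂ z₃ z₄ c hm =>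
    hD _ _ _ _ _ _ _ _ _ ((hψ _ _ _ _ _ _ _ _ _).mp hm)) ((hψ _ _ _ _ _ _ _ _ _).mpr
      ((hE.smul p⁻¹).congr (by ring) (by ring) (by ring) (by ring) (by ring) (by ring) (by ring)
        (by field_simp; ring) (by field_simp; ring)))
  exact ((hψ _ _ _ _ _ _ _ _ _).mp h1).congr (by ring) (by ring) (by ring) (by ring) (by ring)
    (by ring) (by ring) (by ring) (by ring)

theorem Good.swap_diagonal (G : Good e h φ) (hD : IsDiagonal φ h) :
    ∃ ψ, Good e h ψ ∧ IsDiagonal ψ h ∧ ∀ a₁ a₂ a₃ a₄ z₁ z₂ z₃ z₄ c,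
      Mem ψ h a₁ a₂ a₃ a₄ z₁ z₂ z₃ z₄ c ↔
        Mem φ h a₄ a₃ a₂ a₁ (-z₄) (-z₃) (-z₂) (-z₁) (-c) := by
  obtain ⟨ψ, G', hψ⟩ := G.swap
  refine ⟨ψ, G', fun a₁ a₂ a₃ a₄ z₁ z₂ z₃ z₄ c hm => ?_, hψ⟩
  exact (hD _ _ _ _ _ _ _ _ _ ((hψ _ _ _ _ _ _ _ _ _).mp hm)).symm

/-- If the projection of `h` is diagonal, then `h` contains the centre of the nilradical of
`𝔭₂`. -/
theorem Good.center_of_diagonal (G : Good e h φ) (hD : IsDiagonal φ h) :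
    Mem φ h 0 0 0 0 0 0 0 0 1 := by
  by_contra hcen
  have hc : ∀ c, Mem φ h 0 0 0 0 0 0 0 0 c → c = 0 := fun c hm => by
    by_contra h0
    exact hcen (hm.center_of_ne h0)
  have hcurv : ∀ {p₀ p₁ p₂ p₃ p₄ q₀ q₁ q₂ q₃ q₄ s₀ s₁ s₂ s₃ s₄ s₅ s₆ r₁ r₂ r₃ r₄ v₁ v₂ v₃ v₄ w},
      Curv φ h p₀ p₁ p₂ p₃ p₄ q₀ q₁ q₂ q₃ q₄ s₀ s₁ s₂ s₃ s₄ s₅ s₆ r₁ r₂ r₃ r₄ v₁ v₂ v₃ v₄ w →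
      (p₀ = 0 ∧ p₁ = 0 ∧ p₂ = 0 ∧ p₃ = 0 ∧ p₄ = 0) ∧ (q₀ = 0 ∧ q₁ = 0 ∧ q₂ = 0 ∧ q₃ = 0 ∧ q₄ = 0) ∧
      (r₁ = 0 ∧ r₂ = 0 ∧ r₃ = 0 ∧ r₄ = 0) := by
    intro p₀ p₁ p₂ p₃ p₄ q₀ q₁ q₂ q₃ q₄ s₀ s₁ s₂ s₃ s₄ s₅ s₆ r₁ r₂ r₃ r₄ v₁ v₂ v₃ v₄ w C
    obtain ⟨⟨rfl, rfl, rfl, rfl⟩, ⟨rfl, rfl, rfl, rfl⟩, rfl, rfl⟩ := hD.curv C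
    -- The row m16 has only its fourth cubic coefficient p₄ and a central part left. The row m27 is
    -- its mirror image.
    obtain rfl : p₄ = 0 := by
      by_contra hp
      exact hcen (G.center_of_last hD hp C.m16)
    obtain rfl : q₀ = 0 := by
      by_contra hq
      obtain ⟨ψ, G', hD', hψ⟩ := G.swap_diagonal hD
      have h1 := G'.center_of_last hD' (neg_ne_zero.mpr hq) ((hψ _ _ _ _ _ _ _ _ _).mpr
        (C.m27.congr (d := - -r₄) rfl rfl rfl rfl (by ring) (by ring) (by ring) (by ring) (by ring)))
      refine hcen ((((hψ _ _ _ _ _ _ _ _ _).mp h1).smul (-1)).congr ?_ ?_ ?_ ?_ ?_ ?_ ?_ ?_ ?_) <;>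
        ring
    obtain rfl := hc _ C.m16
    obtain rfl := hc _ C.m27
    simp
  -- With all p, q and r zero, no curvature value has a part in 𝔤𝔩(2,ℝ), so Berger's criterion makes
  -- 𝔥 nilpotent.
  refine hcen (G.center_of_nilpotent fun a₁ a₂ a₃ a₄ z₁ z₂ z₃ z₄ c hm => ?_)
  obtain ⟨h2, h3⟩ := hD _ _ _ _ _ _ _ _ _ hm
  have h1 := G.linForm_eq_zero ![1, 0, 0, 0, 0, 0, 0, 0, 0] (fun p₀ p₁ p₂ p₃ p₄ q₀ q₁ q₂ q₃ q₄
    s₀ s₁ s₂ s₃ s₄ s₅ s₆ r₁ r₂ r₃ r₄ v₁ v₂ v₃ v₄ w C => by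
      obtain ⟨⟨rfl, rfl, rfl, rfl, rfl⟩, ⟨rfl, rfl, rfl, rfl, rfl⟩, ⟨rfl, rfl, rfl, rfl⟩⟩ :=
        hcurv C
      simp [linForm]) hm
  have h4 := G.linForm_eq_zero ![0, 0, 0, 1, 0, 0, 0, 0, 0] (fun p₀ p₁ p₂ p₃ p₄ q₀ q₁ q₂ q₃ q₄
    s₀ s₁ s₂ s₃ s₄ s₅ s₆ r₁ r₂ r₃ r₄ v₁ v₂ v₃ v₄ w C => by
      obtain ⟨⟨rfl, rfl, rfl, rfl, rfl⟩, ⟨rfl, rfl, rfl, rfl, rfl⟩, ⟨rfl, rfl, rfl, rfl⟩⟩ :=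
        hcurv C
      simp [linForm]) hm
  simp [linForm] at h1 h4
  exact ⟨h1, h2, h3, h4⟩

end SplitG2

/-! ### Scalar projection. -/

namespace SplitG2

variable {V : Type*} [AddCommGroup V] [Module ℝ V] {e : Module.Basis (Fin 7) ℝ V}
  {h : LieSubalgebra ℝ (Module.End ℝ V)} {φ : V ≃ₗ[ℝ] (Fin 7 → ℝ)}

/-- The projection of `h` to `𝔤𝔩(2,ℝ)` is `0` or `ℝ·I`, and in the second case `I` itself lies
in `h`. -/
structure IsScalar (φ : V ≃ₗ[ℝ] (Fin 7 → ℝ)) (h : LieSubalgebra ℝ (Module.End ℝ V)) : Prop where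
  scalar : ∀ a₁ a₂ a₃ a₄ z₁ z₂ z₃ z₄ c, Mem φ h a₁ a₂ a₃ a₄ z₁ z₂ z₃ z₄ c →
    a₂ = 0 ∧ a₃ = 0 ∧ a₄ = a₁
  center : Mem φ h 0 0 0 0 0 0 0 0 1
  cases : (∀ a₁ a₂ a₃ a₄ z₁ z₂ z₃ z₄ c, Mem φ h a₁ a₂ a₃ a₄ z₁ z₂ z₃ z₄ c → a₁ = 0) ∨
    Mem φ h 1 0 0 1 0 0 0 0 0

theorem matrix_eq_iff {a₁ a₂ a₃ a₄ b₁ b₂ b₃ b₄ : ℝ} :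
    (!![a₁, a₂; a₃, a₄] : Matrix (Fin 2) (Fin 2) ℝ) = !![b₁, b₂; b₃, b₄] ↔
      a₁ = b₁ ∧ a₂ = b₂ ∧ a₃ = b₃ ∧ a₄ = b₄ := by
  constructor
  · intro h
    exact ⟨congrFun (congrFun h 0) 0, congrFun (congrFun h 0) 1, congrFun (congrFun h 1) 0,
      congrFun (congrFun h 1) 1⟩
  · rintro ⟨rfl, rfl, rfl, rfl⟩
    rfl

theorem IsListed.nonempty {Z : Set (Fin 4 → ℝ)} (hZ : IsListed Z) : (0 : Fin 4 → ℝ) ∈ Z := by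
  rcases hZ with hZ | hZ
  · simp only [Set.mem_insert_iff, Set.mem_singleton_iff] at hZ
    rcases hZ with rfl | rfl | rfl | rfl | rfl <;> simp [Zc]
  · cases hZ with
    | a => exact ⟨0, 0, by ext i; fin_cases i <;> simp⟩
    | b => exact ⟨0, 0, by ext i; fin_cases i <;> simp⟩
    | c α hα => exact ⟨0, 0, by ext i; fin_cases i <;> simp⟩
    | d s α hs hα => exact ⟨0, 0, by ext i; fin_cases i <;> simp⟩
    | e κ hκ => exact ⟨0, 0, 0, by ext i; fin_cases i <;> simp⟩

theorem IsScalar.classified_of_listed (S : IsScalar φ h) (G : Good e h φ) {Z : Set (Fin 4 → ℝ)}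
    (hZ : IsListed Z) (H : ∀ z₁ z₂ z₃ z₄, Mem φ h 0 0 0 0 z₁ z₂ z₃ z₄ 0 ↔ ![z₁, z₂, z₃, z₄] ∈ Z) :
    Classified e h := by
  rcases S.cases with h0 | hI
  · obtain ⟨h1, h2⟩ := G.eq_semi (a := {0}) ⟨0, hZ.nonempty⟩ fun a₁ a₂ a₃ a₄ z₁ z₂ z₃ z₄ c => by
      rw [← H, Set.mem_singleton_iff, show (0 : Matrix (Fin 2) (Fin 2) ℝ) = !![0, 0; 0, 0] from
        Matrix.eta_fin_two 0, matrix_eq_iff]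
      constructor
      · intro hm
        obtain ⟨rfl, rfl, rfl⟩ := S.scalar _ _ _ _ _ _ _ _ _ hm
        obtain rfl := h0 _ _ _ _ _ _ _ _ _ hm
        exact ⟨by simp, S.center.center hm 0⟩
      · rintro ⟨⟨rfl, rfl, rfl, rfl⟩, hm⟩
        exact S.center.center hm c
    exact ⟨φ, G, .case5 (Or.inl h1) ⟨Z, hZ, by rw [h1]; exact h2⟩⟩
  · obtain ⟨h1, h2⟩ := G.eq_semi (a := line 1) ⟨0, hZ.nonempty⟩
      fun a₁ a₂ a₃ a₄ z₁ z₂ z₃ z₄ c => by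
      rw [← H]
      constructor
      · intro hm
        obtain ⟨rfl, rfl, rfl⟩ := S.scalar _ _ _ _ _ _ _ _ _ hm
        refine ⟨⟨a₄, ?_⟩, S.center.center ((hm.sub (hI.smul a₄)).congr (by ring) (by ring) (by ring)
          (by ring) (by ring) (by ring) (by ring) (by ring) rfl) 0⟩
        ext i j
        fin_cases i <;> fin_cases j <;> simp
      · rintro ⟨⟨t, ht⟩, hm⟩
        rw [Matrix.one_fin_two, Matrix.smul_of, Matrix.smul_cons, Matrix.smul_cons] at ht
        simp only [Matrix.smul_empty, matrix_eq_iff, Matrix.smul_cons, smul_eq_mul, mul_one,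
          mul_zero] at ht
        obtain ⟨rfl, rfl, rfl, rfl⟩ := ht
        exact S.center.center ((hm.add (hI.smul a₄)).congr (by ring) (by ring) (by ring)
          (by ring) (by ring) (by ring) (by ring) (by ring) rfl) c
    exact ⟨φ, G, .case5 (Or.inr h1) ⟨Z, hZ, by rw [h1]; exact h2⟩⟩

/-- Each move of `Normalizable` is realised by a change of adapted frame that keeps the projection
scalar and the centre in 𝔥. -/
theorem Normalizable.classified {P : ℝ → ℝ → ℝ → ℝ → Prop} (hP : Normalizable P) :
    ∀ {φ : V ≃ₗ[ℝ] (Fin 7 → ℝ)}, Good e h φ → IsScalar φ h →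
      (∀ z₁ z₂ z₃ z₄, Mem φ h 0 0 0 0 z₁ z₂ z₃ z₄ 0 ↔ P z₁ z₂ z₃ z₄) → Classified e h := by
  induction hP with
  | base hZ => exact fun G S H => S.classified_of_listed G hZ H
  | @swap P _ ih =>
    intro φ G S H
    obtain ⟨ψ, G', hψ⟩ := G.swap
    refine ih G' ⟨fun a₁ a₂ a₃ a₄ z₁ z₂ z₃ z₄ c hm => ?_, ?_, ?_⟩ fun z₁ z₂ z₃ z₄ => ?_
    · obtain ⟨h1, h2, h3⟩ := S.scalar _ _ _ _ _ _ _ _ _ ((hψ _ _ _ _ _ _ _ _ _).mp hm)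
      exact ⟨h2, h1, h3.symm⟩
    · rw [hψ]
      exact (S.center.smul (-1)).congr (by ring) (by ring) (by ring) (by ring) (by ring) (by ring)
        (by ring) (by ring) (by ring)
    · refine S.cases.imp (fun h0 a₁ a₂ a₃ a₄ z₁ z₂ z₃ z₄ c hm => ?_) fun hI => ?_
      · obtain ⟨-, -, h3⟩ := S.scalar _ _ _ _ _ _ _ _ _ ((hψ _ _ _ _ _ _ _ _ _).mp hm)
        rw [h3]
        exact h0 _ _ _ _ _ _ _ _ _ ((hψ _ _ _ _ _ _ _ _ _).mp hm)
      · rw [hψ]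
        simpa using hI
    · refine Iff.trans ?_ (H _ _ _ _)
      rw [hψ]
      simp
  | @torus P l m hl hm _ ih =>
    intro φ G S H
    obtain ⟨ψ, G', hψ⟩ := G.torus hl hm
    refine ih G' ⟨fun a₁ a₂ a₃ a₄ z₁ z₂ z₃ z₄ c hm => ?_, ?_, ?_⟩ fun z₁ z₂ z₃ z₄ => ?_
    · obtain ⟨h1, h2, h3⟩ := S.scalar _ _ _ _ _ _ _ _ _ ((hψ _ _ _ _ _ _ _ _ _).mp hm)
      simp_all
    · rw [hψ]
      exact (S.center.smul (l * m)).congr (by ring) (by ring) (by ring) (by ring) (by ring)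
        (by ring) (by ring) (by ring) (by ring)
    · refine S.cases.imp (fun h0 a₁ a₂ a₃ a₄ z₁ z₂ z₃ z₄ c hm => ?_) fun hI => ?_
      · exact h0 _ _ _ _ _ _ _ _ _ ((hψ _ _ _ _ _ _ _ _ _).mp hm)
      · rw [hψ]
        simpa using hI
    · refine Iff.trans ?_ (H _ _ _ _)
      rw [hψ]
      simp
  | @shear P t _ ih =>
    intro φ G S H
    obtain ⟨ψ, G', hψ⟩ := G.shear t
    refine ih G' ⟨fun a₁ a₂ a₃ a₄ z₁ z₂ z₃ z₄ c hm => ?_, ?_, ?_⟩ fun z₁ z₂ z₃ z₄ => ?_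
    · obtain ⟨h1, h2, h3⟩ := S.scalar _ _ _ _ _ _ _ _ _ ((hψ _ _ _ _ _ _ _ _ _).mp hm)
      subst h2
      have h4 : a₄ = a₁ := by linarith
      subst h4
      exact ⟨by linarith, rfl, rfl⟩
    · rw [hψ]
      simpa using S.center
    · refine S.cases.imp (fun h0 a₁ a₂ a₃ a₄ z₁ z₂ z₃ z₄ c hm => ?_) fun hI => ?_
      · have h1 := h0 _ _ _ _ _ _ _ _ _ ((hψ _ _ _ _ _ _ _ _ _).mp hm)
        obtain ⟨-, rfl, -⟩ := S.scalar _ _ _ _ _ _ _ _ _ ((hψ _ _ _ _ _ _ _ _ _).mp hm)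
        linarith
      · rw [hψ]
        simpa using hI
    · refine Iff.trans ?_ (H _ _ _ _)
      rw [hψ]
      simp

theorem IsScalar.classified (S : IsScalar φ h) (G : Good e h φ) : Classified e h := by
  let Z : Submodule ℝ (Fin 4 → ℝ) :=
    { carrier := {z | Mem φ h 0 0 0 0 (z 0) (z 1) (z 2) (z 3) 0}
      zero_mem' := Mem.zero
      add_mem' := fun {z w} hz hw => by simpa using Mem.add hz hw
      smul_mem' := fun t z hz => by simpa using Mem.smul t hz }
  have hZ : ∀ z₁ z₂ z₃ z₄, Mem φ h 0 0 0 0 z₁ z₂ z₃ z₄ 0 ↔ ![z₁, z₂, z₃, z₄] ∈ Z :=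
    fun _ _ _ _ => Iff.rfl
  have hmem : ∀ a₁ a₂ a₃ a₄ z₁ z₂ z₃ z₄ c, Mem φ h a₁ a₂ a₃ a₄ z₁ z₂ z₃ z₄ c →
      ![z₁, z₂, z₃, z₄] ∈ Z := by
    intro a₁ a₂ a₃ a₄ z₁ z₂ z₃ z₄ c hm
    obtain ⟨rfl, rfl, rfl⟩ := S.scalar _ _ _ _ _ _ _ _ _ hm
    rcases S.cases with h0 | hI
    · obtain rfl := h0 _ _ _ _ _ _ _ _ _ hm
      exact S.center.center hm 0
    · exact S.center.center ((hm.sub (hI.smul a₄)).congr (by simp) (by simp) (by simp)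
        (by simp) (by simp) (by simp) (by simp) (by simp) rfl) 0
  refine (normalizable_of_noKernel Z fun x₃ x₄ x₅ hx => G.middle_eq_zero
    fun a₁ a₂ a₃ a₄ z₁ z₂ z₃ z₄ c hm => ?_).classified G S hZ
  obtain ⟨h1, h2⟩ := hx _ _ _ _ (hmem _ _ _ _ _ _ _ _ _ hm)
  obtain ⟨rfl, rfl, rfl⟩ := S.scalar _ _ _ _ _ _ _ _ _ hm
  exact ⟨h1, h2, 0, by ring, by ring, by ring⟩

/-- The classification if `h` projects to scalar matrices. -/
theorem Good.classified_of_scalar (G : Good e h φ)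
    (hs : ∀ a₁ a₂ a₃ a₄ z₁ z₂ z₃ z₄ c, Mem φ h a₁ a₂ a₃ a₄ z₁ z₂ z₃ z₄ c →
      a₂ = 0 ∧ a₃ = 0 ∧ a₄ = a₁) : Classified e h := by
  have hc := G.center_of_diagonal fun a₁ a₂ a₃ a₄ z₁ z₂ z₃ z₄ c hm =>
    ⟨(hs _ _ _ _ _ _ _ _ _ hm).1, (hs _ _ _ _ _ _ _ _ _ hm).2.1⟩
  by_cases h0 : ∀ a₁ a₂ a₃ a₄ z₁ z₂ z₃ z₄ c, Mem φ h a₁ a₂ a₃ a₄ z₁ z₂ z₃ z₄ c → a₁ = 0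
  · exact IsScalar.classified ⟨hs, hc, Or.inl h0⟩ G
  push Not at h0
  obtain ⟨a₁, a₂, a₃, a₄, z₁, z₂, z₃, z₄, c, hm, ha⟩ := h0
  obtain ⟨rfl, rfl, rfl⟩ := hs _ _ _ _ _ _ _ _ _ hm
  -- The matrix a₄I acts on ℝ⁴ as multiplication by a₄, so its nilradical part can be conjugated
  -- away.
  obtain ⟨ψ, G', hψ⟩ := G.unip (-(z₁ / a₄)) (-(z₂ / a₄)) (-(z₃ / a₄)) (-(z₄ / a₄)) 0
  refine IsScalar.classified (φ := ψ) ⟨fun b₁ b₂ b₃ b₄ w₁ w₂ w₃ w₄ d hm' => hs _ _ _ _ _ _ _ _ _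
    ((hψ _ _ _ _ _ _ _ _ _).mp hm'), ?_, Or.inr ?_⟩ G'
  · rw [hψ]
    exact hc.congr (by ring) (by ring) (by ring) (by ring) (by ring) (by ring)
        (by ring) (by ring) (by ring)
  · rw [hψ]
    refine hc.center ((hm.smul a₄⁻¹).congr ?_ ?_ ?_ ?_ ?_ ?_ ?_ ?_ rfl) _ <;> field_simp <;> ring

end SplitG2

/-! ### Coordinate subspaces and two-dimensional diagonal projection. -/

namespace SplitG2

variable {V : Type*} [AddCommGroup V] [Module ℝ V] {e : Module.Basis (Fin 7) ℝ V}
  {h : LieSubalgebra ℝ (Module.End ℝ V)} {φ : V ≃ₗ[ℝ] (Fin 7 → ℝ)}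

theorem mem_Zc {S : Set (Fin 4)} {z₁ z₂ z₃ z₄ : ℝ} : ![z₁, z₂, z₃, z₄] ∈ Zc S ↔
    (0 ∉ S → z₁ = 0) ∧ (1 ∉ S → z₂ = 0) ∧ (2 ∉ S → z₃ = 0) ∧ (3 ∉ S → z₄ = 0) := by
  constructor
  · exact fun h => ⟨h 0, h 1, h 2, h 3⟩
  · rintro ⟨h0, h1, h2, h3⟩ l
    fin_cases l <;> assumption

theorem zero_mem_Zc (S : Set (Fin 4)) : (0 : Fin 4 → ℝ) ∈ Zc S := fun _ _ => rfl

theorem mem_line_iff {a₁ a₂ a₃ a₄ μ : ℝ} :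
    !![a₁, a₂; a₃, a₄] ∈ line !![1, 0; 0, μ] ↔ a₂ = 0 ∧ a₃ = 0 ∧ a₄ = μ * a₁ := by
  have hs : ∀ t : ℝ, t • (!![1, 0; 0, μ] : Matrix (Fin 2) (Fin 2) ℝ) = !![t, 0; 0, t * μ] := by
    intro t
    ext i j
    fin_cases i <;> fin_cases j <;> simp
  constructor
  · rintro ⟨t, ht⟩
    rw [hs, matrix_eq_iff] at ht
    obtain ⟨rfl, rfl, rfl, rfl⟩ := ht
    exact ⟨rfl, rfl, mul_comm _ _⟩
  · rintro ⟨rfl, rfl, rfl⟩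
    exact ⟨a₁, by rw [hs, mul_comm]⟩

theorem exists_smul_iff {a₁ a₂ a₃ a₄ μ : ℝ} {p : ℝ → Prop} :
    (∃ t : ℝ, !![a₁, a₂; a₃, a₄] = t • !![1, 0; 0, μ] ∧ p t) ↔
      a₂ = 0 ∧ a₃ = 0 ∧ a₄ = μ * a₁ ∧ p a₁ := by
  have hs : ∀ t : ℝ, t • (!![1, 0; 0, μ] : Matrix (Fin 2) (Fin 2) ℝ) = !![t, 0; 0, t * μ] := by
    intro t
    ext i j
    fin_cases i <;> fin_cases j <;> simp
  simp only [hs, matrix_eq_iff]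
  constructor
  · rintro ⟨t, ⟨rfl, rfl, rfl, rfl⟩, h⟩
    exact ⟨rfl, rfl, mul_comm _ _, h⟩
  · rintro ⟨rfl, rfl, rfl, h⟩
    exact ⟨a₁, ⟨rfl, rfl, rfl, mul_comm _ _⟩, h⟩

/-- A diagonal non-scalar element separates the coordinates of the nilradical. -/
theorem Mem.separate {α δ d₁ d₂ d₃ d₄ d z₁ z₂ z₃ z₄ c : ℝ} (hc : Mem φ h 0 0 0 0 0 0 0 0 1)
    (hD : Mem φ h α 0 0 δ d₁ d₂ d₃ d₄ d) (hne : δ ≠ α) (hz : Mem φ h 0 0 0 0 z₁ z₂ z₃ z₄ c) :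
    Mem φ h 0 0 0 0 z₁ 0 0 0 0 ∧ Mem φ h 0 0 0 0 0 z₂ 0 0 0 ∧ Mem φ h 0 0 0 0 0 0 z₃ 0 0 ∧
      Mem φ h 0 0 0 0 0 0 0 z₄ 0 := by
  -- The element diag(α, δ) has eigenvalues 2δ - α, δ, α, 2α - δ on ℝ⁴, in arithmetic progression.
  -- Three factors of the form ad - k isolate one coordinate; the constants below are products of
  -- eigenvalue differences.
  have step : ∀ (k : ℝ) {w₁ w₂ w₃ w₄ c' : ℝ}, Mem φ h 0 0 0 0 w₁ w₂ w₃ w₄ c' →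
      Mem φ h 0 0 0 0 ((2 * δ - α - k) * w₁) ((δ - k) * w₂) ((α - k) * w₃)
        ((2 * α - δ - k) * w₄) 0 := by
    intro k w₁ w₂ w₃ w₄ c' hw
    exact hc.center (((hD.lie hw).sub (hw.smul k)).congr (by ring) (by ring) (by ring) (by ring)
      (by ring) (by ring) (by ring) (by ring) rfl) 0
  have h0 : δ - α ≠ 0 := sub_ne_zero.mpr hne
  refine ⟨?_, ?_, ?_, ?_⟩
  · refine ((step δ (step α (step (2 * α - δ) hz))).smul (6 * (δ - α) ^ 3)⁻¹).congr
      (by ring) (by ring) (by ring) (by ring) ?_ ?_ ?_ ?_ ?_ <;> field_simp <;> ring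
  · refine ((step (2 * δ - α) (step α (step (2 * α - δ) hz))).smul (-2 * (δ - α) ^ 3)⁻¹).congr
      (by ring) (by ring) (by ring) (by ring) ?_ ?_ ?_ ?_ ?_ <;> field_simp <;> ring
  · refine ((step (2 * δ - α) (step δ (step (2 * α - δ) hz))).smul (2 * (δ - α) ^ 3)⁻¹).congr
      (by ring) (by ring) (by ring) (by ring) ?_ ?_ ?_ ?_ ?_ <;> field_simp <;> ring
  · refine ((step (2 * δ - α) (step δ (step α hz))).smul (-6 * (δ - α) ^ 3)⁻¹).congr
      (by ring) (by ring) (by ring) (by ring) ?_ ?_ ?_ ?_ ?_ <;> field_simp <;> ring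

/-- Under a diagonal projection, each basis vector of the middle block becomes a common eigenvector
once two neighbouring coordinates vanish on 𝔥. -/
theorem Good.hits (G : Good e h φ) (hD : IsDiagonal φ h) :
    (¬ ∀ a₁ a₂ a₃ a₄ z₁ z₂ z₃ z₄ c, Mem φ h a₁ a₂ a₃ a₄ z₁ z₂ z₃ z₄ c → z₁ = 0 ∧ z₂ = 0) ∧
    (¬ ∀ a₁ a₂ a₃ a₄ z₁ z₂ z₃ z₄ c, Mem φ h a₁ a₂ a₃ a₄ z₁ z₂ z₃ z₄ c → z₂ = 0 ∧ z₃ = 0) ∧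
    (¬ ∀ a₁ a₂ a₃ a₄ z₁ z₂ z₃ z₄ c, Mem φ h a₁ a₂ a₃ a₄ z₁ z₂ z₃ z₄ c → z₃ = 0 ∧ z₄ = 0) := by
  refine ⟨fun H => ?_, fun H => ?_, fun H => ?_⟩
  · refine one_ne_zero (G.middle_eq_zero (x₃ := 1) (x₄ := 0) (x₅ := 0)
      fun a₁ a₂ a₃ a₄ z₁ z₂ z₃ z₄ c hm => ?_).1
    obtain ⟨rfl, rfl⟩ := hD _ _ _ _ _ _ _ _ _ hm
    obtain ⟨rfl, rfl⟩ := H _ _ _ _ _ _ _ _ _ hm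
    exact ⟨by ring, by ring, a₁ - a₄, by ring, by ring, by ring⟩
  · refine one_ne_zero (G.middle_eq_zero (x₃ := 0) (x₄ := 1) (x₅ := 0)
      fun a₁ a₂ a₃ a₄ z₁ z₂ z₃ z₄ c hm => ?_).2.1
    obtain ⟨rfl, rfl⟩ := hD _ _ _ _ _ _ _ _ _ hm
    obtain ⟨rfl, rfl⟩ := H _ _ _ _ _ _ _ _ _ hm
    exact ⟨by ring, by ring, 0, by ring, by ring, by ring⟩
  · refine one_ne_zero (G.middle_eq_zero (x₃ := 0) (x₄ := 0) (x₅ := 1)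
      fun a₁ a₂ a₃ a₄ z₁ z₂ z₃ z₄ c hm => ?_).2.2
    obtain ⟨rfl, rfl⟩ := hD _ _ _ _ _ _ _ _ _ hm
    obtain ⟨rfl, rfl⟩ := H _ _ _ _ _ _ _ _ _ hm
    exact ⟨by ring, by ring, a₄ - a₁, by ring, by ring, by ring⟩

/-- The nilradical part of `h` is spanned by the basis vectors that it contains. -/
theorem Mem.iff_coordinates {α δ d₁ d₂ d₃ d₄ d : ℝ} (hc : Mem φ h 0 0 0 0 0 0 0 0 1)
    (hD : Mem φ h α 0 0 δ d₁ d₂ d₃ d₄ d) (hne : δ ≠ α) (z₁ z₂ z₃ z₄ c : ℝ) :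
    Mem φ h 0 0 0 0 z₁ z₂ z₃ z₄ c ↔
      (¬ Mem φ h 0 0 0 0 1 0 0 0 0 → z₁ = 0) ∧ (¬ Mem φ h 0 0 0 0 0 1 0 0 0 → z₂ = 0) ∧
      (¬ Mem φ h 0 0 0 0 0 0 1 0 0 → z₃ = 0) ∧ (¬ Mem φ h 0 0 0 0 0 0 0 1 0 → z₄ = 0) := by
  constructor
  · intro hz
    obtain ⟨h1, h2, h3, h4⟩ := Mem.separate hc hD hne hz
    refine ⟨fun hn => ?_, fun hn => ?_, fun hn => ?_, fun hn => ?_⟩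
    · by_contra h0
      exact hn ((h1.smul z₁⁻¹).congr (by ring) (by ring) (by ring) (by ring) (by field_simp)
        (by ring) (by ring) (by ring) (by ring))
    · by_contra h0
      exact hn ((h2.smul z₂⁻¹).congr (by ring) (by ring) (by ring) (by ring) (by ring)
        (by field_simp) (by ring) (by ring) (by ring))
    · by_contra h0
      exact hn ((h3.smul z₃⁻¹).congr (by ring) (by ring) (by ring) (by ring) (by ring) (by ring)
        (by field_simp) (by ring) (by ring))
    · by_contra h0
      exact hn ((h4.smul z₄⁻¹).congr (by ring) (by ring) (by ring) (by ring) (by ring) (by ring)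
        (by ring) (by field_simp) (by ring))
  · rintro ⟨h1, h2, h3, h4⟩
    have k1 : Mem φ h 0 0 0 0 z₁ 0 0 0 0 := by
      by_cases hm : Mem φ h 0 0 0 0 1 0 0 0 0
      · simpa using hm.smul z₁
      · rw [h1 hm]
        exact Mem.zero
    have k2 : Mem φ h 0 0 0 0 0 z₂ 0 0 0 := by
      by_cases hm : Mem φ h 0 0 0 0 0 1 0 0 0
      · simpa using hm.smul z₂
      · rw [h2 hm]
        exact Mem.zero
    have k3 : Mem φ h 0 0 0 0 0 0 z₃ 0 0 := by
      by_cases hm : Mem φ h 0 0 0 0 0 0 1 0 0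
      · simpa using hm.smul z₃
      · rw [h3 hm]
        exact Mem.zero
    have k4 : Mem φ h 0 0 0 0 0 0 0 z₄ 0 := by
      by_cases hm : Mem φ h 0 0 0 0 0 0 0 1 0
      · simpa using hm.smul z₄
      · rw [h4 hm]
        exact Mem.zero
    exact hc.center (((k1.add k2).add (k3.add k4)).congr (by ring) (by ring) (by ring) (by ring)
      (by ring) (by ring) (by ring) (by ring) rfl) c

/-- `h` is the semidirect product of the diagonal matrices and a coordinate subspace. -/
def IsDiagonalShape (φ : V ≃ₗ[ℝ] (Fin 7 → ℝ)) (h : LieSubalgebra ℝ (Module.End ℝ V))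
    (I₁ I₂ I₃ I₄ : Prop) : Prop :=
  ∀ a₁ a₂ a₃ a₄ z₁ z₂ z₃ z₄ c, Mem φ h a₁ a₂ a₃ a₄ z₁ z₂ z₃ z₄ c ↔
    (a₂ = 0 ∧ a₃ = 0) ∧ (¬I₁ → z₁ = 0) ∧ (¬I₂ → z₂ = 0) ∧ (¬I₃ → z₃ = 0) ∧ (¬I₄ → z₄ = 0)

theorem mem_diag2_iff {a₁ a₂ a₃ a₄ : ℝ} : !![a₁, a₂; a₃, a₄] ∈ diag2 ↔ a₂ = 0 ∧ a₃ = 0 := by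
  constructor
  · rintro ⟨a, d, hA⟩
    obtain ⟨-, h2, h3, -⟩ := matrix_eq_iff.mp hA
    exact ⟨h2, h3⟩
  · rintro ⟨rfl, rfl⟩
    exact ⟨_, _, rfl⟩

theorem IsDiagonalShape.classified_of_mem {I₁ I₂ I₃ I₄ : Prop} (H : IsDiagonalShape φ h I₁ I₂ I₃ I₄)
    (G : Good e h φ) {S : Set (Fin 4)} (hS : Zc S ∈ ({Set.univ, Zc {0, 2}, Zc {1, 2}, Zc {0, 1, 2},
      Zc {0, 1, 3}} : Set (Set (Fin 4 → ℝ)))) (h0 : 0 ∈ S ↔ I₁) (h1 : 1 ∈ S ↔ I₂) (h2 : 2 ∈ S ↔ I₃)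
    (h3 : 3 ∈ S ↔ I₄) : Classified e h := by
  obtain ⟨k1, k2⟩ := G.eq_semi (a := diag2) (Z := Zc S) ⟨0, zero_mem_Zc S⟩
    fun a₁ a₂ a₃ a₄ z₁ z₂ z₃ z₄ c => by rw [H, mem_diag2_iff, mem_Zc, h0, h1, h2, h3]
  exact ⟨φ, G, .case3 k1 ⟨_, hS, by rw [k1]; exact k2⟩⟩

theorem Zc_univ : Zc Set.univ = Set.univ := by
  ext z
  simp [Zc]

/-- `Good.hits` forbids two neighbouring missing coordinates, and the swap reverses their order. Up
to this reversal exactly the listed sets remain. -/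
theorem IsDiagonalShape.classified {I₁ I₂ I₃ I₄ : Prop} (H : IsDiagonalShape φ h I₁ I₂ I₃ I₄)
    (G : Good e h φ) : Classified e h := by
  have hD : IsDiagonal φ h := fun a₁ a₂ a₃ a₄ z₁ z₂ z₃ z₄ c hm => ((H _ _ _ _ _ _ _ _ _).mp hm).1
  obtain ⟨k1, k2, k3⟩ := G.hits hD
  have t1 : I₁ ∨ I₂ := by
    by_contra! hn
    refine k1 fun a₁ a₂ a₃ a₄ z₁ z₂ z₃ z₄ c hm => ?_
    have := (H _ _ _ _ _ _ _ _ _).mp hm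
    tauto
  have t2 : I₂ ∨ I₃ := by
    by_contra! hn
    refine k2 fun a₁ a₂ a₃ a₄ z₁ z₂ z₃ z₄ c hm => ?_
    have := (H _ _ _ _ _ _ _ _ _).mp hm
    tauto
  have t3 : I₃ ∨ I₄ := by
    by_contra! hn
    refine k3 fun a₁ a₂ a₃ a₄ z₁ z₂ z₃ z₄ c hm => ?_
    have := (H _ _ _ _ _ _ _ _ _).mp hm
    tauto
  obtain ⟨ψ, G', hψ⟩ := G.swap
  have H' : IsDiagonalShape ψ h I₄ I₃ I₂ I₁ := fun a₁ a₂ a₃ a₄ z₁ z₂ z₃ z₄ c => by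
    rw [hψ, H]
    simp only [neg_eq_zero]
    tauto
  by_cases i₂ : I₂ <;> by_cases i₃ : I₃
  · by_cases i₁ : I₁
    · by_cases i₄ : I₄
      · exact H.classified_of_mem G (S := Set.univ) (by simp [Zc_univ]) (by simpa) (by simpa)
          (by simpa) (by simpa)
      · exact H.classified_of_mem G (S := {0, 1, 2}) (by simp) (by simpa) (by simpa) (by simpa)
          (by simpa)
    · by_cases i₄ : I₄
      · exact H'.classified_of_mem G' (S := {0, 1, 2}) (by simp) (by simpa) (by simpa) (by simpa)
          (by simpa)
      · exact H.classified_of_mem G (S := {1, 2}) (by simp) (by simpa) (by simpa) (by simpa)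
          (by simpa)
  · have i₄ : I₄ := by tauto
    by_cases i₁ : I₁
    · exact H.classified_of_mem G (S := {0, 1, 3}) (by simp) (by simpa) (by simpa) (by simpa)
        (by simpa)
    · exact H'.classified_of_mem G' (S := {0, 2}) (by simp) (by simpa) (by simpa) (by simpa)
        (by simpa)
  · have i₁ : I₁ := by tauto
    by_cases i₄ : I₄
    · exact H'.classified_of_mem G' (S := {0, 1, 3}) (by simp) (by simpa) (by simpa) (by simpa)
        (by simpa)
    · exact H.classified_of_mem G (S := {0, 2}) (by simp) (by simpa) (by simpa) (by simpa)
        (by simpa)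
  · tauto

/-- The classification if `h` projects onto the diagonal matrices. -/
theorem Good.classified_of_diagonal (G : Good e h φ) (hD : IsDiagonal φ h)
    {a₁ a₄ b₁ b₄ z₁ z₂ z₃ z₄ c w₁ w₂ w₃ w₄ d : ℝ} (hx : Mem φ h a₁ 0 0 a₄ z₁ z₂ z₃ z₄ c)
    (hy : Mem φ h b₁ 0 0 b₄ w₁ w₂ w₃ w₄ d) (hne : a₁ * b₄ - a₄ * b₁ ≠ 0) : Classified e h := by
  have hc := G.center_of_diagonal hD
  -- The matrix diag(1, 3) has the non-zero eigenvalues 5, 3, 1, -1 on ℝ⁴, so its nilradical part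
  -- can be conjugated away.
  obtain ⟨x₁, x₂, x₃, x₄, x, hX⟩ : ∃ x₁ x₂ x₃ x₄ x, Mem φ h 1 0 0 3 x₁ x₂ x₃ x₄ x := by
    refine ⟨_, _, _, _, _, (((hx.smul (b₄ - 3 * b₁)).add (hy.smul (3 * a₁ - a₄))).smul
      (a₁ * b₄ - a₄ * b₁)⁻¹).congr ?_ (by ring) (by ring) ?_ rfl rfl rfl rfl rfl⟩
    · rw [show (b₄ - 3 * b₁) * a₁ + (3 * a₁ - a₄) * b₁ = a₁ * b₄ - a₄ * b₁ by ring,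
        inv_mul_cancel₀ hne]
    · rw [show (b₄ - 3 * b₁) * a₄ + (3 * a₁ - a₄) * b₄ = (a₁ * b₄ - a₄ * b₁) * 3 by ring,
        inv_mul_cancel_left₀ hne]
  obtain ⟨ψ, G', hψ⟩ := G.unip (-x₁ / 5) (-x₂ / 3) (-x₃) x₄ 0
  have hD' : IsDiagonal ψ h := fun a₁ a₂ a₃ a₄ z₁ z₂ z₃ z₄ c hm =>
    hD _ _ _ _ _ _ _ _ _ ((hψ _ _ _ _ _ _ _ _ _).mp hm)
  have hc' := G'.center_of_diagonal hD'
  have hX' : Mem ψ h 1 0 0 3 0 0 0 0 0 := by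
    rw [hψ]
    exact hc.center (hX.congr rfl rfl rfl rfl (by ring) (by ring) (by ring) (by ring) rfl) _
  have hn : ∀ {a₁ a₂ a₃ a₄ z₁ z₂ z₃ z₄ c}, Mem ψ h a₁ a₂ a₃ a₄ z₁ z₂ z₃ z₄ c →
      Mem ψ h 0 0 0 0 z₁ z₂ z₃ z₄ 0 := by
    intro a₁ a₂ a₃ a₄ z₁ z₂ z₃ z₄ c hm
    obtain ⟨rfl, rfl⟩ := hD' _ _ _ _ _ _ _ _ _ hm
    obtain ⟨h1, h2, h3, h4⟩ := Mem.separate hc' hX' (by norm_num) (hX'.lie hm |>.congr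
      (by ring) (by ring) (by ring) (by ring) rfl rfl rfl rfl rfl)
    exact ((((h1.smul (1 / 5)).add (h2.smul (1 / 3))).add (h3.add (h4.smul (-1)))).congr
      (by ring) (by ring) (by ring) (by ring) (by ring) (by ring) (by ring) (by ring) (by ring))
  have hsub : ∀ {a₁ a₂ a₃ a₄ z₁ z₂ z₃ z₄ c}, Mem ψ h a₁ a₂ a₃ a₄ z₁ z₂ z₃ z₄ c →
      Mem ψ h a₁ 0 0 a₄ 0 0 0 0 0 := by
    intro a₁ a₂ a₃ a₄ z₁ z₂ z₃ z₄ c hm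
    obtain ⟨rfl, rfl⟩ := hD' _ _ _ _ _ _ _ _ _ hm
    exact hc'.center ((hm.sub (hn hm)).congr (by ring) (by ring) (by ring) (by ring) (by ring)
      (by ring) (by ring) (by ring) rfl) _
  have hx' := hsub ((hψ a₁ 0 0 a₄ (z₁ + (2 * a₄ - a₁) * (-x₁ / 5)) (z₂ + a₄ * (-x₂ / 3))
    (z₃ + a₁ * -x₃) (z₄ + (2 * a₁ - a₄) * x₄) 0).mpr (hc.center (hx.congr rfl rfl rfl rfl (by ring)
      (by ring) (by ring) (by ring) rfl) _))
  have hy' := hsub ((hψ b₁ 0 0 b₄ (w₁ + (2 * b₄ - b₁) * (-x₁ / 5)) (w₂ + b₄ * (-x₂ / 3))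
    (w₃ + b₁ * -x₃) (w₄ + (2 * b₁ - b₄) * x₄) 0).mpr (hc.center (hy.congr rfl rfl rfl rfl (by ring)
      (by ring) (by ring) (by ring) rfl) _))
  have hall : ∀ s t, Mem ψ h s 0 0 t 0 0 0 0 0 := by
    intro s t
    refine (((hx'.smul (s * b₄ - t * b₁)).add (hy'.smul (t * a₁ - s * a₄))).smul
      (a₁ * b₄ - a₄ * b₁)⁻¹).congr ?_ (by ring) (by ring) ?_ (by ring) (by ring) (by ring)
      (by ring) (by ring)
    · rw [show (s * b₄ - t * b₁) * a₁ + (t * a₁ - s * a₄) * b₁ = (a₁ * b₄ - a₄ * b₁) * s by ring,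
        inv_mul_cancel_left₀ hne]
    · rw [show (s * b₄ - t * b₁) * a₄ + (t * a₁ - s * a₄) * b₄ = (a₁ * b₄ - a₄ * b₁) * t by ring,
        inv_mul_cancel_left₀ hne]
  refine IsDiagonalShape.classified (φ := ψ) (I₁ := Mem ψ h 0 0 0 0 1 0 0 0 0)
    (I₂ := Mem ψ h 0 0 0 0 0 1 0 0 0) (I₃ := Mem ψ h 0 0 0 0 0 0 1 0 0)
    (I₄ := Mem ψ h 0 0 0 0 0 0 0 1 0) (fun a₁ a₂ a₃ a₄ z₁ z₂ z₃ z₄ c => ?_) G'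
  rw [← Mem.iff_coordinates hc' hX' (by norm_num) z₁ z₂ z₃ z₄ c]
  constructor
  · exact fun hm => ⟨hD' _ _ _ _ _ _ _ _ _ hm, hc'.center (hn hm) c⟩
  · rintro ⟨⟨rfl, rfl⟩, hm⟩
    simpa using hm.add (hall a₁ a₄)

end SplitG2

/-! ### One-dimensional diagonal projection: the condition of Berger's criterion. -/

namespace SplitG2

variable {V : Type*} [AddCommGroup V] [Module ℝ V] {e : Module.Basis (Fin 7) ℝ V}
  {h : LieSubalgebra ℝ (Module.End ℝ V)} {φ : V ≃ₗ[ℝ] (Fin 7 → ℝ)}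

/-- `h` is spanned by `h(diag(1, μ), (d₁, d₂, 0, 0), 0)`, a coordinate subspace and the centre. -/
structure IsLineShape (φ : V ≃ₗ[ℝ] (Fin 7 → ℝ)) (h : LieSubalgebra ℝ (Module.End ℝ V))
    (μ d₁ d₂ : ℝ) (I₁ I₂ I₃ I₄ : Prop) : Prop where
  mem_iff : ∀ a₁ a₂ a₃ a₄ z₁ z₂ z₃ z₄ c, Mem φ h a₁ a₂ a₃ a₄ z₁ z₂ z₃ z₄ c ↔
    (a₂ = 0 ∧ a₃ = 0 ∧ a₄ = μ * a₁) ∧ (¬I₁ → z₁ = a₁ * d₁) ∧ (¬I₂ → z₂ = a₁ * d₂) ∧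
      (¬I₃ → z₃ = 0) ∧ (¬I₄ → z₄ = 0)

namespace IsLineShape

variable {μ d₁ d₂ : ℝ} {I₁ I₂ I₃ I₄ : Prop}

theorem isDiagonal (S : IsLineShape φ h μ d₁ d₂ I₁ I₂ I₃ I₄) : IsDiagonal φ h :=
  fun _ _ _ _ _ _ _ _ _ hm =>
    ⟨((S.mem_iff _ _ _ _ _ _ _ _ _).mp hm).1.1, ((S.mem_iff _ _ _ _ _ _ _ _ _).mp hm).1.2.1⟩

/-- The condition that Berger's criterion imposes. -/
theorem berger (S : IsLineShape φ h μ d₁ d₂ I₁ I₂ I₃ I₄) (G : Good e h φ) :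
    ∃ p r s t : ℝ, (p ≠ 0 ∨ r ≠ 0) ∧ μ * p = 0 ∧ (¬I₁ → s - r + μ * r = p * d₁) ∧
      (¬I₂ → s = 0 ∧ t = p * d₂) ∧ (¬I₃ → s = 0 ∧ t = 0) ∧ (¬I₄ → p = 0 ∧ s - r + μ * r = 0) := by
  by_contra! hno
  have h1 : Mem φ h 1 0 0 μ d₁ d₂ 0 0 0 := by
    rw [S.mem_iff]
    simp
  have := G.linForm_eq_zero ![1, 0, 0, 0, 0, 0, 0, 0, 0] (fun p₀ p₁ p₂ p₃ p₄ q₀ q₁ q₂ q₃ q₄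
    s₀ s₁ s₂ s₃ s₄ s₅ s₆ r₁ r₂ r₃ r₄ v₁ v₂ v₃ v₄ w C => by
      obtain ⟨⟨rfl, rfl, rfl, rfl⟩, ⟨rfl, rfl, rfl, rfl⟩, rfl, rfl⟩ := S.isDiagonal.curv C
      have m67 := (S.mem_iff _ _ _ _ _ _ _ _ _).mp C.m67
      obtain rfl := m67.1.2.2
      obtain ⟨-, -, -, -, a4⟩ := (S.mem_iff _ _ _ _ _ _ _ _ _).mp C.m16
      obtain ⟨-, -, -, -, b4⟩ := (S.mem_iff _ _ _ _ _ _ _ _ _).mp C.m37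
      obtain ⟨-, -, -, c3, -⟩ := (S.mem_iff _ _ _ _ _ _ _ _ _).mp C.m36
      obtain ⟨-, -, d2, d3, -⟩ := (S.mem_iff _ _ _ _ _ _ _ _ _).mp C.m57
      obtain ⟨⟨-, -, e0⟩, e1, e2, -⟩ := (S.mem_iff _ _ _ _ _ _ _ _ _).mp C.m56
      -- For a diagonal projection p₄ and r₁ are the only possible values of a₁ on the curvature
      -- rows. The remaining rows give the stated equations with s = s₃ and t = s₄.
      have hpr : p₄ = 0 ∧ r₁ = 0 := by
        by_contra hpr
        obtain ⟨i4, h4⟩ := hno p₄ r₁ s₃ s₄ (not_and_or.mp hpr) e0.symm (fun i => by linarith [e1 i])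
          (fun i => ⟨by simpa using d2 i, by linarith [e2 i]⟩) (fun i => ⟨by simpa using c3 i, d3 i⟩)
        exact h4 (by simpa using a4 i4) (by linarith [b4 i4])
      simp [linForm, hpr])
    h1
  simp [linForm] at this

theorem classified_pure_of_mem (S : IsLineShape φ h μ 0 0 I₁ I₂ I₃ I₄) (G : Good e h φ)
    (hμ : μ ∈ Set.Ico (-1 : ℝ) 1) {J : Set (Fin 4)} (hJ : Zc J ∈ ({Set.univ, Zc {1, 2}, Zc {0, 1, 2},
      Zc {0, 1, 3}, Zc {0, 2, 3}, Zc {1, 2, 3}} : Set (Set (Fin 4 → ℝ)))) (h0 : 0 ∈ J ↔ I₁)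
    (h1 : 1 ∈ J ↔ I₂) (h2 : 2 ∈ J ↔ I₃) (h3 : 3 ∈ J ↔ I₄) : Classified e h := by
  obtain ⟨k1, k2⟩ := G.eq_semi (a := line !![1, 0; 0, μ]) (Z := Zc J) ⟨0, zero_mem_Zc J⟩
    fun a₁ a₂ a₃ a₄ z₁ z₂ z₃ z₄ c => by
      rw [S.mem_iff, mem_line_iff, mem_Zc, h0, h1, h2, h3]
      simp only [mul_zero]
  exact ⟨φ, G, .case4a μ hμ k1 ⟨_, hJ, by rw [k1]; exact k2⟩⟩

theorem classified_pure (S : IsLineShape φ h μ 0 0 I₁ I₂ I₃ I₄) (G : Good e h φ)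
    (hμ : μ ∈ Set.Ico (-1 : ℝ) 1) : Classified e h := by
  obtain ⟨k1, k2, k3⟩ := G.hits S.isDiagonal
  have t1 : I₁ ∨ I₂ := by
    by_contra! hn
    refine k1 fun a₁ a₂ a₃ a₄ z₁ z₂ z₃ z₄ c hm => ?_
    have := (S.mem_iff _ _ _ _ _ _ _ _ _).mp hm
    simp only [mul_zero] at this
    tauto
  have t2 : I₂ ∨ I₃ := by
    by_contra! hn
    refine k2 fun a₁ a₂ a₃ a₄ z₁ z₂ z₃ z₄ c hm => ?_
    have := (S.mem_iff _ _ _ _ _ _ _ _ _).mp hm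
    simp only [mul_zero] at this
    tauto
  have t3 : I₃ ∨ I₄ := by
    by_contra! hn
    refine k3 fun a₁ a₂ a₃ a₄ z₁ z₂ z₃ z₄ c hm => ?_
    have := (S.mem_iff _ _ _ _ _ _ _ _ _).mp hm
    tauto
  -- If p ≠ 0, then μ = 0 and I₄. If p = 0, then r ≠ 0, and the cases s ≠ 0 and s = 0 give the first
  -- two alternatives, since (μ - 1)r ≠ 0.
  have t4 : (I₂ ∧ I₃) ∨ (I₁ ∧ I₄) ∨ (μ = 0 ∧ I₄) := by
    obtain ⟨p, r, s, t, hpr, hp, b1, b2, b3, b4⟩ := S.berger G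
    simp only [mul_zero] at b1 b2
    by_cases hp0 : p = 0
    · have hr : r ≠ 0 := hpr.resolve_left (not_not.mpr hp0)
      by_cases hs : s = 0
      · have h0 : s - r + μ * r ≠ 0 := by
          rw [hs, show 0 - r + μ * r = (μ - 1) * r by ring]
          exact mul_ne_zero (by linarith [hμ.2]) hr
        exact Or.inr (Or.inl ⟨not_not.mp fun i => h0 (b1 i), not_not.mp fun i => h0 (b4 i).2⟩)
      · exact Or.inl ⟨not_not.mp fun i => hs (b2 i).1, not_not.mp fun i => hs (b3 i).1⟩
    · exact Or.inr (Or.inr ⟨by simpa [hp0] using hp, not_not.mp fun i => hp0 (b4 i).1⟩)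
  by_cases i₂ : I₂ <;> by_cases i₃ : I₃
  · by_cases i₁ : I₁
    · by_cases i₄ : I₄
      · exact S.classified_pure_of_mem G hμ (J := Set.univ) (by simp [Zc_univ]) (by simpa) (by simpa)
          (by simpa) (by simpa)
      · exact S.classified_pure_of_mem G hμ (J := {0, 1, 2}) (by simp) (by simpa) (by simpa)
          (by simpa) (by simpa)
    · by_cases i₄ : I₄
      · exact S.classified_pure_of_mem G hμ (J := {1, 2, 3}) (by simp) (by simpa) (by simpa)
          (by simpa) (by simpa)
      · exact S.classified_pure_of_mem G hμ (J := {1, 2}) (by simp) (by simpa) (by simpa) (by simpa)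
          (by simpa)
  · have i₄ : I₄ := by tauto
    by_cases i₁ : I₁
    · exact S.classified_pure_of_mem G hμ (J := {0, 1, 3}) (by simp) (by simpa) (by simpa)
        (by simpa) (by simpa)
    · obtain rfl : μ = 0 := by tauto
      obtain ⟨k1, k2⟩ := G.eq_semi (a := line !![1, 0; 0, 0]) (Z := Zc {1, 3}) ⟨0, zero_mem_Zc _⟩
        fun a₁ a₂ a₃ a₄ z₁ z₂ z₃ z₄ c => by
          rw [S.mem_iff, mem_line_iff, mem_Zc]
          simp [i₁, i₂, i₃, i₄]
      exact ⟨φ, G, .case4c k1 (Or.inl (by rw [k1]; exact k2))⟩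
  · have i₁ : I₁ := by tauto
    have i₄ : I₄ := by tauto
    exact S.classified_pure_of_mem G hμ (J := {0, 2, 3}) (by simp) (by simpa) (by simpa)
        (by simpa) (by simpa)
  · tauto

/-- Here μp = 0 gives p = 0, and the missing first coordinate gives s = r/2 ≠ 0, which forces I₂ and
I₃. -/
theorem classified_twisted_half (S : IsLineShape φ h (1 / 2) 1 0 False I₂ I₃ I₄) (G : Good e h φ) :
    Classified e h := by
  have t4 : I₂ ∧ I₃ := by
    obtain ⟨p, r, s, t, hpr, hp, b1, b2, b3, -⟩ := S.berger G
    obtain rfl : p = 0 := by linarith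
    have h1 := b1 not_false
    have hs : s ≠ 0 := by
      rintro rfl
      have : r = 0 := by linarith
      tauto
    tauto
  obtain ⟨i₂, i₃⟩ := t4
  have key : ∃ J ∈ ({Zc {1, 2}, Zc {1, 2, 3}} : Set (Set (Fin 4 → ℝ))),
      (0 : Fin 4 → ℝ) ∈ J ∧ ∀ a₁ a₂ a₃ a₄ z₁ z₂ z₃ z₄ c, Mem φ h a₁ a₂ a₃ a₄ z₁ z₂ z₃ z₄ c ↔
      ∃ t : ℝ, !![a₁, a₂; a₃, a₄] = t • !![1, 0; 0, 1 / 2] ∧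
        ![z₁, z₂, z₃, z₄] - t • ![1, 0, 0, 0] ∈ J := by
    by_cases i₄ : I₄
    · refine ⟨Zc {1, 2, 3}, by simp, zero_mem_Zc _, fun a₁ a₂ a₃ a₄ z₁ z₂ z₃ z₄ c => ?_⟩
      rw [S.mem_iff, exists_smul_iff]
      simp [mem_Zc, i₂, i₃, i₄, sub_eq_zero, and_assoc]
    · refine ⟨Zc {1, 2}, by simp, zero_mem_Zc _, fun a₁ a₂ a₃ a₄ z₁ z₂ z₃ z₄ c => ?_⟩
      rw [S.mem_iff, exists_smul_iff]
      simp [mem_Zc, i₂, i₃, i₄, sub_eq_zero, and_assoc]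
  obtain ⟨J, hJ, hJ0, hm⟩ := key
  obtain ⟨k1, k2⟩ := G.eq_twistedSemi hJ0 hm
  exact ⟨φ, G, .case4b k1 ⟨J, hJ, k2⟩⟩

/-- The missing second coordinate gives s = 0 and t = p. Then p ≠ 0 requires I₃, r ≠ 0 requires I₁,
and either requires I₄. -/
theorem classified_twisted_zero (S : IsLineShape φ h 0 0 1 I₁ False I₃ I₄) (G : Good e h φ) :
    Classified e h := by
  have t4 : I₄ ∧ (I₁ ∨ I₃) := by
    obtain ⟨p, r, s, t, hpr, -, b1, b2, b3, b4⟩ := S.berger G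
    obtain ⟨rfl, rfl⟩ := b2 not_false
    simp only [mul_zero, mul_one, zero_mul, add_zero, zero_sub, neg_eq_zero] at b1 b3 b4
    tauto
  obtain ⟨i₄, t⟩ := t4
  have key : ∃ J ∈ ({Zc {0, 3}, Zc {2, 3}, Zc {0, 2, 3}} : Set (Set (Fin 4 → ℝ))),
      (0 : Fin 4 → ℝ) ∈ J ∧ ∀ a₁ a₂ a₃ a₄ z₁ z₂ z₃ z₄ c, Mem φ h a₁ a₂ a₃ a₄ z₁ z₂ z₃ z₄ c ↔
      ∃ t : ℝ, !![a₁, a₂; a₃, a₄] = t • !![1, 0; 0, 0] ∧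
        ![z₁, z₂, z₃, z₄] - t • ![0, 1, 0, 0] ∈ J := by
    by_cases i₁ : I₁ <;> by_cases i₃ : I₃
    · refine ⟨Zc {0, 2, 3}, by simp, zero_mem_Zc _, fun a₁ a₂ a₃ a₄ z₁ z₂ z₃ z₄ c => ?_⟩
      rw [S.mem_iff, exists_smul_iff]
      simp [mem_Zc, i₁, i₃, i₄, sub_eq_zero, and_assoc]
    · refine ⟨Zc {0, 3}, by simp, zero_mem_Zc _, fun a₁ a₂ a₃ a₄ z₁ z₂ z₃ z₄ c => ?_⟩
      rw [S.mem_iff, exists_smul_iff]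
      simp [mem_Zc, i₁, i₃, i₄, sub_eq_zero, and_assoc]
    · refine ⟨Zc {2, 3}, by simp, zero_mem_Zc _, fun a₁ a₂ a₃ a₄ z₁ z₂ z₃ z₄ c => ?_⟩
      rw [S.mem_iff, exists_smul_iff]
      simp [mem_Zc, i₁, i₃, i₄, sub_eq_zero, and_assoc]
    · tauto
  obtain ⟨J, hJ, hJ0, hm⟩ := key
  obtain ⟨k1, k2⟩ := G.eq_twistedSemi hJ0 hm
  exact ⟨φ, G, .case4c k1 (Or.inr ⟨J, hJ, k2⟩)⟩

end IsLineShape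

end SplitG2

/-! ### Reduction of a diagonal projection to the normal shapes. -/

namespace SplitG2

variable {V : Type*} [AddCommGroup V] [Module ℝ V] {e : Module.Basis (Fin 7) ℝ V}
  {h : LieSubalgebra ℝ (Module.End ℝ V)} {φ : V ≃ₗ[ℝ] (Fin 7 → ℝ)}

namespace IsLineShape

variable {μ d₁ d₂ : ℝ} {I₁ I₂ I₃ I₄ : Prop}

theorem of_mem (hc : Mem φ h 0 0 0 0 0 0 0 0 1) (hD : IsDiagonal φ h) (hμ : μ ≠ 1)
    (hall : ∀ a₁ a₂ a₃ a₄ z₁ z₂ z₃ z₄ c, Mem φ h a₁ a₂ a₃ a₄ z₁ z₂ z₃ z₄ c → a₄ = μ * a₁)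
    (hx : Mem φ h 1 0 0 μ d₁ d₂ 0 0 0) :
    IsLineShape φ h μ d₁ d₂ (Mem φ h 0 0 0 0 1 0 0 0 0) (Mem φ h 0 0 0 0 0 1 0 0 0)
      (Mem φ h 0 0 0 0 0 0 1 0 0) (Mem φ h 0 0 0 0 0 0 0 1 0) where
  mem_iff a₁ a₂ a₃ a₄ z₁ z₂ z₃ z₄ c := by
    have hco := Mem.iff_coordinates hc hx hμ (z₁ - a₁ * d₁) (z₂ - a₁ * d₂) z₃ z₄ c
    simp only [sub_eq_zero] at hco
    rw [← hco]
    constructor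
    · intro hm
      obtain ⟨rfl, rfl⟩ := hD _ _ _ _ _ _ _ _ _ hm
      obtain rfl := hall _ _ _ _ _ _ _ _ _ hm
      exact ⟨⟨rfl, rfl, rfl⟩, (hm.sub (hx.smul a₁)).congr (by ring) (by ring) (by ring) (by ring)
        (by ring) (by ring) (by ring) (by ring) (by ring)⟩
    · rintro ⟨⟨rfl, rfl, rfl⟩, hm⟩
      exact (hm.add (hx.smul a₁)).congr (by ring) (by ring) (by ring) (by ring)
        (by ring) (by ring) (by ring) (by ring) (by ring)

/-- A multiple of a basis vector that lies in 𝔥 can be subtracted from the generator. -/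
theorem drop_first (S : IsLineShape φ h μ d₁ d₂ I₁ I₂ I₃ I₄) (h1 : I₁) :
    IsLineShape φ h μ 0 d₂ I₁ I₂ I₃ I₄ where
  mem_iff a₁ a₂ a₃ a₄ z₁ z₂ z₃ z₄ c := by
    rw [S.mem_iff]
    simp [h1]

theorem drop_second (S : IsLineShape φ h μ d₁ d₂ I₁ I₂ I₃ I₄) (h2 : I₂) :
    IsLineShape φ h μ d₁ 0 I₁ I₂ I₃ I₄ where
  mem_iff a₁ a₂ a₃ a₄ z₁ z₂ z₃ z₄ c := by
    rw [S.mem_iff]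
    simp [h2]

theorem torus (S : IsLineShape φ h μ d₁ d₂ I₁ I₂ I₃ I₄) (G : Good e h φ) {l m : ℝ} (hl : l ≠ 0)
    (hm : m ≠ 0) : ∃ ψ, Good e h ψ ∧ IsLineShape ψ h μ (l / m ^ 2 * d₁) (d₂ / m) I₁ I₂ I₃ I₄ := by
  obtain ⟨ψ, G', hψ⟩ := G.torus hl hm
  refine ⟨ψ, G', ⟨fun a₁ a₂ a₃ a₄ z₁ z₂ z₃ z₄ c => ?_⟩⟩
  have e1 : m ^ 2 / l * z₁ = a₁ * d₁ ↔ z₁ = a₁ * (l / m ^ 2 * d₁) := by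
    field_simp
  have e2 : m * z₂ = a₁ * d₂ ↔ z₂ = a₁ * (d₂ / m) := by
    field_simp
  rw [hψ, S.mem_iff, e1, e2]
  simp [hl, hm]

/-- The classification if `h` projects onto `ℝ·diag(1, μ)`. -/
theorem classified (S : IsLineShape φ h μ d₁ d₂ I₁ I₂ I₃ I₄) (G : Good e h φ)
    (hμ : μ ∈ Set.Ico (-1 : ℝ) 1) (h1 : μ ≠ 1 / 2 → d₁ = 0) (h2 : μ ≠ 0 → d₂ = 0) :
    Classified e h := by
  by_cases hd₁ : d₁ = 0 ∨ I₁
  · have S' : IsLineShape φ h μ 0 d₂ I₁ I₂ I₃ I₄ := by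
      rcases hd₁ with rfl | hI
      · exact S
      · exact S.drop_first hI
    by_cases hd₂ : d₂ = 0 ∨ I₂
    · have S'' : IsLineShape φ h μ 0 0 I₁ I₂ I₃ I₄ := by
        rcases hd₂ with rfl | hI
        · exact S'
        · exact S'.drop_second hI
      exact S''.classified_pure G hμ
    · push Not at hd₂
      obtain rfl : μ = 0 := by
        by_contra h0
        exact hd₂.1 (h2 h0)
      obtain ⟨ψ, G', T⟩ := S'.torus G (l := 1) one_ne_zero hd₂.1
      rw [mul_zero, div_self hd₂.1, eq_false hd₂.2] at T
      exact T.classified_twisted_zero G'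
  · push Not at hd₁
    obtain rfl : μ = 1 / 2 := by
      by_contra h0
      exact hd₁.1 (h1 h0)
    obtain rfl := h2 (by norm_num)
    obtain ⟨ψ, G', T⟩ := S.torus G (m := 1) (inv_ne_zero hd₁.1) one_ne_zero
    rw [one_pow, div_one, inv_mul_cancel₀ hd₁.1, eq_false hd₁.2, zero_div] at T
    exact T.classified_twisted_half G'

end IsLineShape

/-- The bounds on μ = δ/α come from |δ| ≤ |α| and δ ≠ α; the swap arranges this inequality where
needed. -/
theorem exists_line_generator
    (hrk : ∀ a₁ a₂ a₃ a₄ z₁ z₂ z₃ z₄ c b₁ b₂ b₃ b₄ w₁ w₂ w₃ w₄ d,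
      Mem φ h a₁ a₂ a₃ a₄ z₁ z₂ z₃ z₄ c → Mem φ h b₁ b₂ b₃ b₄ w₁ w₂ w₃ w₄ d →
        a₁ * b₄ - a₄ * b₁ = 0)
    {α δ x₁ x₂ x₃ x₄ x : ℝ} (hx : Mem φ h α 0 0 δ x₁ x₂ x₃ x₄ x) (hne : δ ≠ α)
    (hle : |δ| ≤ |α|) : ∃ μ ∈ Set.Ico (-1 : ℝ) 1, (∃ y₁ y₂ y₃ y₄ y, Mem φ h 1 0 0 μ y₁ y₂ y₃ y₄ y) ∧
      ∀ a₁ a₂ a₃ a₄ z₁ z₂ z₃ z₄ c, Mem φ h a₁ a₂ a₃ a₄ z₁ z₂ z₃ z₄ c → a₄ = μ * a₁ := by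
  have hα : α ≠ 0 := by
    rintro rfl
    rw [abs_zero] at hle
    exact hne (abs_nonpos_iff.mp hle)
  have hle' : |δ / α| ≤ 1 := by
    rw [abs_div]
    exact div_le_one_of_le₀ hle (abs_nonneg _)
  refine ⟨δ / α, ⟨(abs_le.mp hle').1, lt_of_le_of_ne (abs_le.mp hle').2 fun h1 => hne ?_⟩,
    ⟨_, _, _, _, _, (hx.smul α⁻¹).congr (by field_simp) (by ring) (by ring) (by ring) rfl rfl rfl
      rfl rfl⟩, fun a₁ a₂ a₃ a₄ z₁ z₂ z₃ z₄ c hm => ?_⟩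
  · rwa [div_eq_one_iff_eq hα] at h1
  · have := hrk _ _ _ _ _ _ _ _ _ _ _ _ _ _ _ _ _ _ hx hm
    field_simp
    linarith

theorem Good.classified_of_line (G : Good e h φ) (hD : IsDiagonal φ h) {μ y₁ y₂ y₃ y₄ y : ℝ}
    (hμ : μ ∈ Set.Ico (-1 : ℝ) 1) (hy : Mem φ h 1 0 0 μ y₁ y₂ y₃ y₄ y)
    (hall : ∀ a₁ a₂ a₃ a₄ z₁ z₂ z₃ z₄ c, Mem φ h a₁ a₂ a₃ a₄ z₁ z₂ z₃ z₄ c → a₄ = μ * a₁) :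
    Classified e h := by
  have hc := G.center_of_diagonal hD
  -- The eigenvalues on ℝ⁴ are 2μ - 1, μ, 1 and 2 - μ; the last two never vanish. At μ = 1/2 or μ =
  -- 0 the convention of division by zero leaves the resonant coordinate in place.
  obtain ⟨ψ, G', hψ⟩ := G.unip (-y₁ / (2 * μ - 1)) (-y₂ / μ) (-y₃) (-y₄ / (2 - μ)) 0
  have hD' : IsDiagonal ψ h := fun a₁ a₂ a₃ a₄ z₁ z₂ z₃ z₄ c hm =>
    hD _ _ _ _ _ _ _ _ _ ((hψ _ _ _ _ _ _ _ _ _).mp hm)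
  have h4 : 2 - μ ≠ 0 := by linarith [hμ.2]
  have hy' : Mem ψ h 1 0 0 μ (y₁ + (2 * μ - 1) * (-y₁ / (2 * μ - 1))) (y₂ + μ * (-y₂ / μ)) 0 0 0 := by
    rw [hψ]
    exact hc.center (hy.congr rfl rfl rfl rfl (by ring) (by ring) (by ring)
      (by field_simp; ring) rfl) _
  refine (IsLineShape.of_mem (G'.center_of_diagonal hD') hD' hμ.2.ne
    (fun a₁ a₂ a₃ a₄ z₁ z₂ z₃ z₄ c hm => hall _ _ _ _ _ _ _ _ _ ((hψ _ _ _ _ _ _ _ _ _).mp hm))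
    hy').classified G' hμ (fun h0 => ?_) fun h0 => ?_
  · have : 2 * μ - 1 ≠ 0 := fun h1 => h0 (by linarith)
    rw [mul_div_cancel₀ _ this]
    ring
  · rw [mul_div_cancel₀ _ h0]
    ring

/-- The classification if the projection of `h` to `𝔤𝔩(2,ℝ)` is diagonal. -/
theorem Good.classified_of_isDiagonal (G : Good e h φ) (hD : IsDiagonal φ h) : Classified e h := by
  by_cases hs : ∀ a₁ a₂ a₃ a₄ z₁ z₂ z₃ z₄ c, Mem φ h a₁ a₂ a₃ a₄ z₁ z₂ z₃ z₄ c → a₄ = a₁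
  · exact G.classified_of_scalar fun a₁ a₂ a₃ a₄ z₁ z₂ z₃ z₄ c hm =>
      ⟨(hD _ _ _ _ _ _ _ _ _ hm).1, (hD _ _ _ _ _ _ _ _ _ hm).2, hs _ _ _ _ _ _ _ _ _ hm⟩
  by_cases hrk : ∀ a₁ a₂ a₃ a₄ z₁ z₂ z₃ z₄ c b₁ b₂ b₃ b₄ w₁ w₂ w₃ w₄ d,
      Mem φ h a₁ a₂ a₃ a₄ z₁ z₂ z₃ z₄ c → Mem φ h b₁ b₂ b₃ b₄ w₁ w₂ w₃ w₄ d →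
        a₁ * b₄ - a₄ * b₁ = 0
  · push Not at hs
    obtain ⟨a₁, a₂, a₃, a₄, z₁, z₂, z₃, z₄, c, hx, hne⟩ := hs
    obtain ⟨rfl, rfl⟩ := hD _ _ _ _ _ _ _ _ _ hx
    rcases le_total |a₄| |a₁| with hle | hle
    · obtain ⟨μ, hμ, ⟨y₁, y₂, y₃, y₄, y, hy⟩, hall⟩ := exists_line_generator hrk hx hne hle
      exact G.classified_of_line hD hμ hy hall
    · obtain ⟨ψ, G', hD', hψ⟩ := G.swap_diagonal hD
      have hx' : Mem ψ h a₄ 0 0 a₁ (-z₄) (-z₃) (-z₂) (-z₁) (-c) := by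
        rw [hψ]
        simpa using hx
      obtain ⟨μ, hμ, ⟨y₁, y₂, y₃, y₄, y, hy⟩, hall⟩ := exists_line_generator
        (fun a₁ a₂ a₃ a₄ z₁ z₂ z₃ z₄ c b₁ b₂ b₃ b₄ w₁ w₂ w₃ w₄ d ha hb => by
          linarith [hrk _ _ _ _ _ _ _ _ _ _ _ _ _ _ _ _ _ _ ((hψ _ _ _ _ _ _ _ _ _).mp ha)
            ((hψ _ _ _ _ _ _ _ _ _).mp hb)]) hx' hne.symm hle
      exact G'.classified_of_line hD' hμ hy hall
  · push Not at hrk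
    obtain ⟨a₁, a₂, a₃, a₄, z₁, z₂, z₃, z₄, c, b₁, b₂, b₃, b₄, w₁, w₂, w₃, w₄, d, ha, hb, hne⟩ := hrk
    obtain ⟨rfl, rfl⟩ := hD _ _ _ _ _ _ _ _ _ ha
    obtain ⟨rfl, rfl⟩ := hD _ _ _ _ _ _ _ _ _ hb
    exact G.classified_of_diagonal hD ha hb hne

end SplitG2

/-! ### Subalgebras of 𝔤𝔩(2,ℝ): triangular, or containing a rotation. -/

namespace SplitG2

variable {V : Type*} [AddCommGroup V] [Module ℝ V] {e : Module.Basis (Fin 7) ℝ V}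
  {h : LieSubalgebra ℝ (Module.End ℝ V)} {φ : V ≃ₗ[ℝ] (Fin 7 → ℝ)}

/-- The projection of `h` to `𝔤𝔩(2,ℝ)` consists of upper triangular matrices. -/
def IsTriangular (φ : V ≃ₗ[ℝ] (Fin 7 → ℝ)) (h : LieSubalgebra ℝ (Module.End ℝ V)) : Prop :=
  ∀ a₁ a₂ a₃ a₄ z₁ z₂ z₃ z₄ c, Mem φ h a₁ a₂ a₃ a₄ z₁ z₂ z₃ z₄ c → a₃ = 0

/-- The projection of `h` to `𝔤𝔩(2,ℝ)` contains a matrix `C_r`. -/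
def HasRotation (φ : V ≃ₗ[ℝ] (Fin 7 → ℝ)) (h : LieSubalgebra ℝ (Module.End ℝ V)) : Prop :=
  ∃ r z₁ z₂ z₃ z₄ c, Mem φ h r (-1) 1 r z₁ z₂ z₃ z₄ c

/-- Semisimplicity of the socle makes a triangular projection diagonal after a shear. -/
theorem Good.classified_of_isTriangular (G : Good e h φ) (hT : IsTriangular φ h) :
    Classified e h := by
  obtain ⟨t, ht⟩ := G.exists_shear hT
  obtain ⟨ψ, G', hψ⟩ := G.shear t
  refine G'.classified_of_isDiagonal fun a₁ a₂ a₃ a₄ z₁ z₂ z₃ z₄ c hm => ?_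
  have hm' := (hψ _ _ _ _ _ _ _ _ _).mp hm
  obtain rfl := hT _ _ _ _ _ _ _ _ _ hm'
  have := ht _ _ _ _ _ _ _ _ _ hm'
  exact ⟨by linarith, rfl⟩

/-- The assumption says that (x, y) is a common eigenvector of 𝔞; swaps and a shear move it to the
first axis. -/
theorem Good.exists_isTriangular (G : Good e h φ) {x y : ℝ} (h0 : ¬(x = 0 ∧ y = 0))
    (H : ∀ a₁ a₂ a₃ a₄ z₁ z₂ z₃ z₄ c, Mem φ h a₁ a₂ a₃ a₄ z₁ z₂ z₃ z₄ c →
      (a₁ * x + a₂ * y) * y = (a₃ * x + a₄ * y) * x) : ∃ ψ, Good e h ψ ∧ IsTriangular ψ h := by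
  obtain ⟨ψ, G', hψ⟩ := G.swap
  by_cases hx : x = 0
  · have hy : y ≠ 0 := fun hy => h0 ⟨hx, hy⟩
    refine ⟨ψ, G', fun a₁ a₂ a₃ a₄ z₁ z₂ z₃ z₄ c hm => ?_⟩
    have := H _ _ _ _ _ _ _ _ _ ((hψ _ _ _ _ _ _ _ _ _).mp hm)
    simpa [hx, hy] using this
  · obtain ⟨χ, G'', hχ⟩ := G'.shear (y / x)
    obtain ⟨ρ, G''', hρ⟩ := G''.swap
    refine ⟨ρ, G''', fun a₁ a₂ a₃ a₄ z₁ z₂ z₃ z₄ c hm => ?_⟩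
    have := H _ _ _ _ _ _ _ _ _ ((hψ _ _ _ _ _ _ _ _ _).mp ((hχ _ _ _ _ _ _ _ _ _).mp
      ((hρ _ _ _ _ _ _ _ _ _).mp hm)))
    field_simp at this
    have h1 : a₃ * x ^ 2 = 0 := by linear_combination -this
    simpa [hx] using h1

/-- A matrix without real eigenvalues: the shear makes its diagonal entries equal and the torus
makes its off-diagonal entries opposite. -/
theorem Good.exists_hasRotation (G : Good e h φ) {a₁ a₂ a₃ a₄ z₁ z₂ z₃ z₄ c : ℝ}
    (hm : Mem φ h a₁ a₂ a₃ a₄ z₁ z₂ z₃ z₄ c) (hneg : (a₁ - a₄) ^ 2 + 4 * a₂ * a₃ < 0) :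
    ∃ ψ, Good e h ψ ∧ HasRotation ψ h := by
  have h3 : a₃ ≠ 0 := by
    rintro rfl
    nlinarith [sq_nonneg (a₁ - a₄)]
  set t := (a₁ - a₄) / (2 * a₃) with ht
  set b := a₂ + t ^ 2 * a₃ with hb
  have hta : t * a₃ = (a₁ - a₄) / 2 := by
    rw [ht]
    field_simp
  have hprod : 0 < -(b * a₃) := by
    have : b * a₃ = a₂ * a₃ + (t * a₃) ^ 2 := by
      rw [hb]
      ring
    rw [this, hta]
    linarith
  obtain ⟨ψ, G', hψ⟩ := G.shear t
  have hm' : Mem ψ h ((a₁ + a₄) / 2) b a₃ ((a₁ + a₄) / 2) z₁ (z₂ - t * z₁)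
      (z₃ - 2 * t * z₂ + t ^ 2 * z₁) (z₄ - 3 * t * z₃ + 3 * t ^ 2 * z₂ - t ^ 3 * z₁) c := by
    rw [hψ]
    refine hm.congr ?_ ?_ rfl ?_ ?_ ?_ ?_ ?_ rfl
    · linarith
    · rw [hb]
      ring
    · linarith
    all_goals ring
  set k := √(-(b * a₃)) with hk
  have hk0 : k ≠ 0 := (Real.sqrt_pos.mpr hprod).ne'
  have hk2 : k ^ 2 = -(b * a₃) := Real.sq_sqrt hprod.le
  obtain ⟨χ, G'', hχ⟩ := G'.torus (l := k) (m := a₃) hk0 h3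
  refine ⟨χ, G'', (a₁ + a₄) / 2 / k, _, _, _, _, _, (hχ _ _ _ _ _ _ _ _ _).mpr
    ((hm'.smul k⁻¹).congr ?_ ?_ ?_ ?_
    (mul_div_cancel₀ (k⁻¹ * z₁) (div_ne_zero (pow_ne_zero 2 h3) hk0))
    (mul_div_cancel₀ _ h3) (mul_div_cancel₀ _ hk0)
    (mul_div_cancel₀ _ (div_ne_zero (pow_ne_zero 2 hk0) h3))
    (mul_div_cancel₀ _ (mul_ne_zero hk0 h3)))⟩
  · ring
  · field_simp
    linarith
  · field_simp
  · ring

/-- Bracketing with diag(α, δ) isolates the off-diagonal entries. If both kinds occur, their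
combination is a rotation modulo the nilradical. -/
theorem Good.triangular_or_rotation_of_diagonal (G : Good e h φ) {α δ x₁ x₂ x₃ x₄ x : ℝ}
    (hx : Mem φ h α 0 0 δ x₁ x₂ x₃ x₄ x) (hne : δ ≠ α) :
    ∃ ψ, Good e h ψ ∧ (IsTriangular ψ h ∨ HasRotation ψ h) := by
  by_cases hT : IsTriangular φ h
  · exact ⟨φ, G, .inl hT⟩
  by_cases hT' : ∀ a₁ a₂ a₃ a₄ z₁ z₂ z₃ z₄ c, Mem φ h a₁ a₂ a₃ a₄ z₁ z₂ z₃ z₄ c → a₂ = 0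
  · obtain ⟨ψ, G', hψ⟩ := G.swap
    exact ⟨ψ, G', .inl fun a₁ a₂ a₃ a₄ z₁ z₂ z₃ z₄ c hm =>
      hT' _ _ _ _ _ _ _ _ _ ((hψ _ _ _ _ _ _ _ _ _).mp hm)⟩
  simp only [IsTriangular] at hT
  push Not at hT hT'
  obtain ⟨a₁, a₂, a₃, a₄, z₁, z₂, z₃, z₄, c, ha, ha0⟩ := hT
  obtain ⟨b₁, b₂, b₃, b₄, w₁, w₂, w₃, w₄, d, hb, hb0⟩ := hT'
  have hd : α - δ ≠ 0 := sub_ne_zero.mpr hne.symm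
  have h1 := ((hx.lie (hx.lie ha)).sub ((hx.lie ha).smul (α - δ))).smul (2 * (α - δ) ^ 2 * a₃)⁻¹
  have h2 := ((hx.lie (hx.lie hb)).add ((hx.lie hb).smul (α - δ))).smul (2 * (α - δ) ^ 2 * b₂)⁻¹
  obtain ⟨ψ, G', hψ⟩ := G.exists_hasRotation (a₁ := 0) (a₂ := -1) (a₃ := 1) (a₄ := 0)
    ((h1.sub h2).congr (by ring) (by field_simp; ring) (by field_simp; ring) (by ring)
      rfl rfl rfl rfl rfl) (by norm_num)
  exact ⟨ψ, G', .inr hψ⟩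

/-- The cases are distinguished by the sign of the discriminant of the characteristic polynomial on
𝔞. -/
theorem Good.triangular_or_rotation (G : Good e h φ) :
    ∃ ψ, Good e h ψ ∧ (IsTriangular ψ h ∨ HasRotation ψ h) := by
  by_cases hneg : ∃ a₁ a₂ a₃ a₄ z₁ z₂ z₃ z₄ c, Mem φ h a₁ a₂ a₃ a₄ z₁ z₂ z₃ z₄ c ∧
      (a₁ - a₄) ^ 2 + 4 * a₂ * a₃ < 0
  · obtain ⟨a₁, a₂, a₃, a₄, z₁, z₂, z₃, z₄, c, hm, hneg⟩ := hneg
    obtain ⟨ψ, G', hψ⟩ := G.exists_hasRotation hm hneg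
    exact ⟨ψ, G', .inr hψ⟩
  by_cases hpos : ∃ a₁ a₂ a₃ a₄ z₁ z₂ z₃ z₄ c, Mem φ h a₁ a₂ a₃ a₄ z₁ z₂ z₃ z₄ c ∧
      0 < (a₁ - a₄) ^ 2 + 4 * a₂ * a₃
  · obtain ⟨a₁, a₂, a₃, a₄, z₁, z₂, z₃, z₄, c, hm, hpos⟩ := hpos
    have tri : ∀ {ψ : V ≃ₗ[ℝ] (Fin 7 → ℝ)} {b₁ b₂ b₄ w₁ w₂ w₃ w₄ d : ℝ}, Good e h ψ →
        Mem ψ h b₁ b₂ 0 b₄ w₁ w₂ w₃ w₄ d → b₁ ≠ b₄ →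
        ∃ ψ, Good e h ψ ∧ (IsTriangular ψ h ∨ HasRotation ψ h) := by
      intro ψ b₁ b₂ b₄ w₁ w₂ w₃ w₄ d G' hb hne
      set t := b₂ / (b₄ - b₁) with ht
      have hd : b₄ - b₁ ≠ 0 := sub_ne_zero.mpr hne.symm
      obtain ⟨χ, G'', hχ⟩ := G'.shear t
      refine G''.triangular_or_rotation_of_diagonal (α := b₁) (δ := b₄) (x₁ := w₁)
        (x₂ := w₂ - t * w₁) (x₃ := w₃ - 2 * t * w₂ + t ^ 2 * w₁)
        (x₄ := w₄ - 3 * t * w₃ + 3 * t ^ 2 * w₂ - t ^ 3 * w₁) (x := d) ?_ hne.symm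
      rw [hχ]
      refine hb.congr (by ring) ?_ rfl (by ring) rfl (by ring) (by ring) (by ring) rfl
      rw [ht]
      field_simp
      ring
    by_cases h3 : a₃ = 0
    · subst h3
      exact tri G hm fun h14 => by simp [h14] at hpos
    · set k := √((a₁ - a₄) ^ 2 + 4 * a₂ * a₃) with hk
      have hk2 : k ^ 2 = (a₁ - a₄) ^ 2 + 4 * a₂ * a₃ := Real.sq_sqrt hpos.le
      have hk0 : 0 < k := Real.sqrt_pos.mpr hpos
      set t := (a₁ - a₄ + k) / (2 * a₃) with ht
      have hta : t * a₃ = (a₁ - a₄ + k) / 2 := by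
        rw [ht]
        field_simp
      obtain ⟨ψ, G', hψ⟩ := G.shear t
      have hm' : Mem ψ h (a₁ - t * a₃) 0 a₃ (a₄ + t * a₃) z₁ (z₂ - t * z₁)
          (z₃ - 2 * t * z₂ + t ^ 2 * z₁) (z₄ - 3 * t * z₃ + 3 * t ^ 2 * z₂ - t ^ 3 * z₁) c := by
        rw [hψ]
        refine hm.congr (by ring) ?_ rfl (by ring) rfl (by ring) (by ring) (by ring) rfl
        refine mul_right_cancel₀ h3 ?_
        linear_combination (t * a₃ + (a₄ - a₁ + k) / 2) * hta + hk2 / 4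
      obtain ⟨χ, G'', hχ⟩ := G'.swap
      refine tri (b₁ := a₄ + t * a₃) (b₂ := a₃) (b₄ := a₁ - t * a₃) G'' ((hχ _ _ _ _ _ _ _ _ _).mpr
        (hm'.congr rfl rfl rfl rfl (neg_neg _) (neg_neg _) (neg_neg _) (neg_neg _) (neg_neg _)))
        fun h14 => ?_
      linarith
  push Not at hneg hpos
  have hq : ∀ {a₁ a₂ a₃ a₄ z₁ z₂ z₃ z₄ c}, Mem φ h a₁ a₂ a₃ a₄ z₁ z₂ z₃ z₄ c →
      (a₁ - a₄) ^ 2 + 4 * a₂ * a₃ = 0 := fun hm =>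
    le_antisymm (hpos _ _ _ _ _ _ _ _ _ hm) (hneg _ _ _ _ _ _ _ _ _ hm)
  by_cases hT : IsTriangular φ h
  · exact ⟨φ, G, .inl hT⟩
  simp only [IsTriangular] at hT
  push Not at hT
  obtain ⟨a₁, a₂, a₃, a₄, z₁, z₂, z₃, z₄, c, ha, ha0⟩ := hT
  -- The discriminant vanishes on the linear space 𝔞, hence so does its polarisation; this makes (a₁
  -- - a₄, 2a₃), the eigenvector of one matrix, common to all.
  obtain ⟨ψ, G', hψ⟩ := G.exists_isTriangular (x := a₁ - a₄) (y := 2 * a₃) (by simp [ha0])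
    fun b₁ b₂ b₃ b₄ w₁ w₂ w₃ w₄ d hb => by
      linear_combination a₃ * hq (ha.add hb) - (a₃ + b₃) * hq ha - a₃ * hq hb
  exact ⟨ψ, G', .inl hψ⟩

end SplitG2

/-! ### Rotations acting on binary cubics. -/

namespace SplitG2

variable {V : Type*} [AddCommGroup V] [Module ℝ V] {e : Module.Basis (Fin 7) ℝ V}
  {h : LieSubalgebra ℝ (Module.End ℝ V)} {φ : V ≃ₗ[ℝ] (Fin 7 → ℝ)}

theorem eq_zero_of_add_sq_eq_zero {x y : ℝ} (h : x ^ 2 + y ^ 2 = 0) : x = 0 ∧ y = 0 :=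
  ⟨by nlinarith, by nlinarith⟩

/-- If the projection of `h` contains a rotation, then `h` contains the centre of the nilradical
of `𝔭₂`. -/
theorem Good.center_of_hasRotation (G : Good e h φ) (hR : HasRotation φ h) :
    Mem φ h 0 0 0 0 0 0 0 0 1 := by
  obtain ⟨r, x₁, x₂, x₃, x₄, x, hX⟩ := hR
  by_contra hcen
  have hc : ∀ c, Mem φ h 0 0 0 0 0 0 0 0 c → c = 0 := fun c hm => by
    by_contra h0
    exact hcen (hm.center_of_ne h0)
  -- This is the action J of the rotation part alone. On its two invariant planes J² equals -1 and
  -- -9, and pairing z with Jz is definite on each, so an isotropic J-invariant subspace is zero.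
  have rot : ∀ {z₁ z₂ z₃ z₄ c}, Mem φ h 0 0 0 0 z₁ z₂ z₃ z₄ c →
      ∃ d, Mem φ h 0 0 0 0 (3 * z₂) (-z₁ + 2 * z₃) (-2 * z₂ + z₄) (-3 * z₃) d := fun {_ _ _ _ c} hm =>
    ⟨_, ((hX.lie hm).sub (hm.smul r)).congr (by ring) (by ring) (by ring) (by ring) (by ring)
      (by ring) (by ring) (by ring) rfl⟩
  have isotropic : ∀ {z₁ z₂ z₃ z₄ c w₁ w₂ w₃ w₄ d}, Mem φ h 0 0 0 0 z₁ z₂ z₃ z₄ c →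
      Mem φ h 0 0 0 0 w₁ w₂ w₃ w₄ d → -(z₁ * w₄ - z₄ * w₁) + 3 * (z₂ * w₃ - z₃ * w₂) = 0 :=
    fun hz hw => hc _ ((hz.lie hw).congr (by ring) (by ring) (by ring) (by ring) (by ring)
      (by ring) (by ring) (by ring) (by ring))
  have hzero : ∀ {z₁ z₂ z₃ z₄ c}, Mem φ h 0 0 0 0 z₁ z₂ z₃ z₄ c →
      z₁ = 0 ∧ z₂ = 0 ∧ z₃ = 0 ∧ z₄ = 0 ∧ c = 0 := by
    intro z₁ z₂ z₃ z₄ c hm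
    obtain ⟨d, hd⟩ := rot hm
    obtain ⟨d', hd'⟩ := rot hd
    have h1 : Mem φ h 0 0 0 0 (3 * (z₁ + z₃)) (z₂ + z₄) (z₁ + z₃) (3 * (z₂ + z₄))
        (1 / 2 * (d' + 9 * c)) :=
      ((hd'.add (hm.smul 9)).smul (1 / 2)).congr (by ring) (by ring) (by ring) (by ring) (by ring)
        (by ring) (by ring) (by ring) rfl
    obtain ⟨d₁, hd₁⟩ := rot h1
    have e1 := isotropic h1 hd₁
    obtain ⟨h3, h4⟩ := eq_zero_of_add_sq_eq_zero (x := z₁ + z₃) (y := z₂ + z₄)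
      (by linear_combination e1 / 12)
    obtain rfl : z₃ = -z₁ := by linarith
    obtain rfl : z₄ = -z₂ := by linarith
    have e2 := isotropic hm hd
    obtain ⟨rfl, rfl⟩ := eq_zero_of_add_sq_eq_zero (x := z₁) (y := z₂)
      (by linear_combination -e2 / 12)
    simp only [neg_zero] at hm
    exact ⟨rfl, rfl, neg_zero, neg_zero, hc _ hm⟩
  -- Since 𝔥 meets the nilradical trivially, the row m17 makes every lower left entry of a curvature
  -- value vanish.
  have := G.linForm_eq_zero ![0, 0, 1, 0, 0, 0, 0, 0, 0] (fun p₀ p₁ p₂ p₃ p₄ q₀ q₁ q₂ q₃ q₄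
    s₀ s₁ s₂ s₃ s₄ s₅ s₆ r₁ r₂ r₃ r₄ v₁ v₂ v₃ v₄ w C => by
      obtain ⟨rfl, rfl, rfl, rfl, rfl⟩ := hzero C.m17
      simp [linForm]) hX
  simp [linForm] at this

/-- Membership in coordinates adapted to the decomposition of `ℝ⁴` under rotations. -/
abbrev RotMem (φ : V ≃ₗ[ℝ] (Fin 7 → ℝ)) (h : LieSubalgebra ℝ (Module.End ℝ V))
    (a₁ a₂ a₃ a₄ p q s t : ℝ) : Prop :=
  Mem φ h a₁ a₂ a₃ a₄ (3 * p + s) (q + t) (p - s) (3 * q - t) 0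

/-- On the planes of weights 1 and 3 the action of C_r is r + J. It is invertible, as r² + 1 and r²
+ 9 are non-zero, so the nilradical part of the generator can be removed. -/
theorem Good.exists_pure_rotation (G : Good e h φ) (hR : HasRotation φ h) :
    ∃ ψ r, Good e h ψ ∧ Mem ψ h r (-1) 1 r 0 0 0 0 0 := by
  have hc := G.center_of_hasRotation hR
  obtain ⟨r, x₁, x₂, x₃, x₄, x, hX⟩ := hR
  have hr1 : r ^ 2 + 1 ≠ 0 := by positivity
  have hr9 : r ^ 2 + 9 ≠ 0 := by positivity
  set p := (x₁ + x₃) / 4 / (r ^ 2 + 1) with hp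
  set q := (x₂ + x₄) / 4 / (r ^ 2 + 1) with hq
  set s := (x₁ - 3 * x₃) / 4 / (r ^ 2 + 9) with hs
  set t := (3 * x₂ - x₄) / 4 / (r ^ 2 + 9) with ht
  have ep : p * (r ^ 2 + 1) = (x₁ + x₃) / 4 := div_mul_cancel₀ _ hr1
  have eq : q * (r ^ 2 + 1) = (x₂ + x₄) / 4 := div_mul_cancel₀ _ hr1
  have es : s * (r ^ 2 + 9) = (x₁ - 3 * x₃) / 4 := div_mul_cancel₀ _ hr9
  have et : t * (r ^ 2 + 9) = (3 * x₂ - x₄) / 4 := div_mul_cancel₀ _ hr9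
  obtain ⟨ψ, G', hψ⟩ := G.unip (-(3 * (r * p - q) + (r * s - 3 * t)))
    (-((r * q + p) + (r * t + 3 * s))) (-((r * p - q) - (r * s - 3 * t)))
    (-(3 * (r * q + p) - (r * t + 3 * s))) 0
  refine ⟨ψ, r, G', ?_⟩
  rw [hψ]
  refine hc.center (hX.congr rfl rfl rfl rfl ?_ ?_ ?_ ?_ rfl) _
  · linear_combination 3 * ep + es
  · linear_combination eq + et
  · linear_combination ep - es
  · linear_combination 3 * eq - et

section

variable {r a₁ a₂ a₃ a₄ p q s t : ℝ}

theorem RotMem.rotate (hc : Mem φ h 0 0 0 0 0 0 0 0 1) (hX : Mem φ h r (-1) 1 r 0 0 0 0 0)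
    (hm : RotMem φ h a₁ a₂ a₃ a₄ p q s t) : RotMem φ h (-(a₂ + a₃)) (a₁ - a₄) (a₁ - a₄) (a₂ + a₃)
      (r * p + q) (r * q - p) (r * s + 3 * t) (r * t - 3 * s) :=
  hc.center ((hX.lie hm).congr (by ring) (by ring) (by ring) (by ring) (by ring) (by ring)
    (by ring) (by ring) rfl) 0

/-- The operators J² + 9 and J² + 1 are multiples of the projections onto the two planes. -/
theorem RotMem.split (hc : Mem φ h 0 0 0 0 0 0 0 0 1) (hX : Mem φ h r (-1) 1 r 0 0 0 0 0)
    (hm : RotMem φ h 0 0 0 0 p q s t) :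
    RotMem φ h 0 0 0 0 p q 0 0 ∧ RotMem φ h 0 0 0 0 0 0 s t := by
  have rot : ∀ {p q s t}, RotMem φ h 0 0 0 0 p q s t → RotMem φ h 0 0 0 0 q (-p) (3 * t) (-3 * s) :=
    fun hm => ((RotMem.rotate hc hX hm).sub (hm.smul r)).congr (by ring) (by ring) (by ring)
      (by ring) (by ring) (by ring) (by ring) (by ring) (by ring)
  have h2 := rot (rot hm)
  exact ⟨((h2.add (hm.smul 9)).smul (1 / 8)).congr (by ring) (by ring) (by ring) (by ring)
    (by ring) (by ring) (by ring) (by ring) (by ring),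
    ((h2.add hm).smul (-1 / 8)).congr (by ring) (by ring) (by ring) (by ring)
    (by ring) (by ring) (by ring) (by ring) (by ring)⟩

/-- A non-zero vector and its image under J span the plane. -/
theorem RotMem.first_of_ne (hc : Mem φ h 0 0 0 0 0 0 0 0 1) (hX : Mem φ h r (-1) 1 r 0 0 0 0 0)
    (hm : RotMem φ h 0 0 0 0 p q s t) (hne : ¬(p = 0 ∧ q = 0)) (p' q' : ℝ) :
    RotMem φ h 0 0 0 0 p' q' 0 0 := by
  have h1 := (RotMem.split hc hX hm).1
  have h2 := (RotMem.rotate hc hX h1).sub (h1.smul r)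
  have hpos : p ^ 2 + q ^ 2 ≠ 0 := fun h0 => hne (eq_zero_of_add_sq_eq_zero h0)
  refine (((h1.smul (p' * p + q' * q)).add (h2.smul (p' * q - q' * p))).smul
    (p ^ 2 + q ^ 2)⁻¹).congr (by ring) (by ring) (by ring) (by ring) ?_ ?_ ?_ ?_ (by ring) <;>
  field_simp <;> ring

theorem RotMem.second_of_ne (hc : Mem φ h 0 0 0 0 0 0 0 0 1) (hX : Mem φ h r (-1) 1 r 0 0 0 0 0)
    (hm : RotMem φ h 0 0 0 0 p q s t) (hne : ¬(s = 0 ∧ t = 0)) (s' t' : ℝ) :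
    RotMem φ h 0 0 0 0 0 0 s' t' := by
  have h1 := (RotMem.split hc hX hm).2
  have h2 := ((RotMem.rotate hc hX h1).sub (h1.smul r)).smul (1 / 3)
  have hpos : s ^ 2 + t ^ 2 ≠ 0 := fun h0 => hne (eq_zero_of_add_sq_eq_zero h0)
  refine (((h1.smul (s' * s + t' * t)).add (h2.smul (s' * t - t' * s))).smul
    (s ^ 2 + t ^ 2)⁻¹).congr (by ring) (by ring) (by ring) (by ring) ?_ ?_ ?_ ?_ (by ring) <;>
  field_simp <;> ring

/-- The adjoint action of a rotation isolates the nilradical part of an element. -/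
theorem RotMem.isolate (hc : Mem φ h 0 0 0 0 0 0 0 0 1) (hX : Mem φ h r (-1) 1 r 0 0 0 0 0)
    (hm : RotMem φ h a₁ a₂ a₃ a₄ p q s t) :
    RotMem φ h 0 0 0 0 ((r ^ 3 + r) * p + (3 * r ^ 2 + 3) * q)
      ((r ^ 3 + r) * q - (3 * r ^ 2 + 3) * p)
      ((r ^ 3 - 23 * r) * s + (9 * r ^ 2 - 15) * t)
      ((r ^ 3 - 23 * r) * t - (9 * r ^ 2 - 15) * s) := by
  -- On 𝔤𝔩(2,ℝ) the bracket with C_r has eigenvalues 0 and ±2i, so (ad)³ + 4 ad kills the linear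
  -- part. It is invertible on both planes of ℝ⁴.
  have h1 := RotMem.rotate hc hX hm
  have h3 := RotMem.rotate hc hX (RotMem.rotate hc hX h1)
  exact (h3.add (h1.smul 4)).congr (by ring) (by ring) (by ring) (by ring)
    (by ring) (by ring) (by ring) (by ring) (by ring)

theorem RotMem.first_eq_zero (hc : Mem φ h 0 0 0 0 0 0 0 0 1) (hX : Mem φ h r (-1) 1 r 0 0 0 0 0)
    (hno : ¬RotMem φ h 0 0 0 0 1 0 0 0) (hm : RotMem φ h a₁ a₂ a₃ a₄ p q s t) : p = 0 ∧ q = 0 := by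
  by_contra hne
  refine hno (RotMem.first_of_ne hc hX (RotMem.isolate hc hX hm) (fun ⟨e1, e2⟩ => hne ?_) 1 0)
  have : (r ^ 2 + 1) ^ 2 * (r ^ 2 + 9) * (p ^ 2 + q ^ 2) = 0 := by
    linear_combination ((r ^ 3 + r) * p + (3 * r ^ 2 + 3) * q) * e1
      + ((r ^ 3 + r) * q - (3 * r ^ 2 + 3) * p) * e2
  exact eq_zero_of_add_sq_eq_zero ((mul_eq_zero_iff_left (by positivity)).mp this)

theorem RotMem.second_eq_zero (hc : Mem φ h 0 0 0 0 0 0 0 0 1) (hX : Mem φ h r (-1) 1 r 0 0 0 0 0)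
    (hno : ¬RotMem φ h 0 0 0 0 0 0 1 0) (hm : RotMem φ h a₁ a₂ a₃ a₄ p q s t) : s = 0 ∧ t = 0 := by
  by_contra hne
  refine hno (RotMem.second_of_ne hc hX (RotMem.isolate hc hX hm) (fun ⟨e1, e2⟩ => hne ?_) 1 0)
  have : ((r ^ 3 - 23 * r) ^ 2 + (9 * r ^ 2 - 15) ^ 2) * (s ^ 2 + t ^ 2) = 0 := by
    linear_combination ((r ^ 3 - 23 * r) * s + (9 * r ^ 2 - 15) * t) * e1
      + ((r ^ 3 - 23 * r) * t - (9 * r ^ 2 - 15) * s) * e2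
  have hN : (r ^ 3 - 23 * r) ^ 2 + (9 * r ^ 2 - 15) ^ 2 ≠ 0 := by
    intro h0
    have h1 : 9 * r ^ 2 - 15 = 0 := by nlinarith [sq_nonneg (r ^ 3 - 23 * r)]
    have h2 : r ^ 3 - 23 * r = 0 := by nlinarith [sq_nonneg (9 * r ^ 2 - 15)]
    have h3 : r * (r ^ 2 - 23) = 0 := by linear_combination h2
    rcases mul_eq_zero.mp h3 with rfl | h4
    · norm_num at h1
    · linarith
  exact eq_zero_of_add_sq_eq_zero ((mul_eq_zero_iff_left hN).mp this)

/-- The nilradical part of each element, obtained by isolation, already lies in 𝔥. Thus 𝔥 is a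
semidirect product, and each plane is contained in it entirely or does not contribute. -/
theorem RotMem.iff_components (hc : Mem φ h 0 0 0 0 0 0 0 0 1)
    (hX : Mem φ h r (-1) 1 r 0 0 0 0 0) (a₁ a₂ a₃ a₄ p q s t : ℝ) :
    RotMem φ h a₁ a₂ a₃ a₄ p q s t ↔ Mem φ h a₁ a₂ a₃ a₄ 0 0 0 0 0 ∧
      (¬RotMem φ h 0 0 0 0 1 0 0 0 → p = 0 ∧ q = 0) ∧
      (¬RotMem φ h 0 0 0 0 0 0 1 0 → s = 0 ∧ t = 0) := by
  have key : (¬RotMem φ h 0 0 0 0 1 0 0 0 → p = 0 ∧ q = 0) →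
      (¬RotMem φ h 0 0 0 0 0 0 1 0 → s = 0 ∧ t = 0) → RotMem φ h 0 0 0 0 p q s t := by
    intro H₁ H₂
    have h1 : RotMem φ h 0 0 0 0 p q 0 0 := by
      by_cases hP : RotMem φ h 0 0 0 0 1 0 0 0
      · exact RotMem.first_of_ne hc hX hP (by simp) p q
      · obtain ⟨rfl, rfl⟩ := H₁ hP
        simpa [RotMem] using Mem.zero
    have h2 : RotMem φ h 0 0 0 0 0 0 s t := by
      by_cases hP : RotMem φ h 0 0 0 0 0 0 1 0
      · exact RotMem.second_of_ne hc hX hP (by simp) s t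
      · obtain ⟨rfl, rfl⟩ := H₂ hP
        simpa [RotMem] using Mem.zero
    exact (h1.add h2).congr (by ring) (by ring) (by ring) (by ring) (by ring) (by ring) (by ring)
      (by ring) (by ring)
  constructor
  · intro hm
    have H₁ := fun hP => RotMem.first_eq_zero hc hX hP hm
    have H₂ := fun hP => RotMem.second_eq_zero hc hX hP hm
    exact ⟨(hm.sub (key H₁ H₂)).congr (by ring) (by ring) (by ring) (by ring) (by ring) (by ring)
      (by ring) (by ring) (by ring), H₁, H₂⟩
  · rintro ⟨hA, H₁, H₂⟩
    exact (hA.add (key H₁ H₂)).congr (by ring) (by ring) (by ring) (by ring) (by ring) (by ring)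
      (by ring) (by ring) (by ring)

end

end SplitG2

/-! ### Algebras with a rotation, and the conclusion. -/

namespace SplitG2

variable {V : Type*} [AddCommGroup V] [Module ℝ V] {e : Module.Basis (Fin 7) ℝ V}
  {h : LieSubalgebra ℝ (Module.End ℝ V)} {φ : V ≃ₗ[ℝ] (Fin 7 → ℝ)}

section

variable {r a₁ a₂ a₃ a₄ z₁ z₂ z₃ z₄ c : ℝ}

theorem mem_iff_rotMem (hc : Mem φ h 0 0 0 0 0 0 0 0 1) : Mem φ h a₁ a₂ a₃ a₄ z₁ z₂ z₃ z₄ c ↔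
    RotMem φ h a₁ a₂ a₃ a₄ ((z₁ + z₃) / 4) ((z₂ + z₄) / 4) ((z₁ - 3 * z₃) / 4)
      ((3 * z₂ - z₄) / 4) :=
  ⟨fun hm => hc.center (hm.congr rfl rfl rfl rfl (by ring) (by ring) (by ring) (by ring) rfl) 0,
    fun hm => hc.center (hm.congr rfl rfl rfl rfl (by ring) (by ring) (by ring) (by ring) rfl) c⟩

/-- If only the plane of weight 3 occurs, the middle vector (1, 0, 1) is a common eigenvector. If
neither plane occurs, the curvature rows have no lower left entries, contrary to Berger's criterion.
-/
theorem Good.first_component (G : Good e h φ) (hc : Mem φ h 0 0 0 0 0 0 0 0 1)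
    (hX : Mem φ h r (-1) 1 r 0 0 0 0 0) : RotMem φ h 0 0 0 0 1 0 0 0 := by
  by_contra hno
  by_cases hP : RotMem φ h 0 0 0 0 0 0 1 0
  · refine one_ne_zero (G.middle_eq_zero (x₃ := 1) (x₄ := 0) (x₅ := 1)
      fun a₁ a₂ a₃ a₄ z₁ z₂ z₃ z₄ c hm => ?_).1
    obtain ⟨h1, h2⟩ := RotMem.first_eq_zero hc hX hno ((mem_iff_rotMem hc).mp hm)
    -- Bracketing the linear part with the plane of weight 3 must not produce weight 1, so the
    -- linear part is conformal.
    have hA := ((RotMem.iff_components hc hX _ _ _ _ _ _ _ _).mp ((mem_iff_rotMem hc).mp hm)).1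
    obtain ⟨h3, h4⟩ := RotMem.first_eq_zero hc hX hno ((mem_iff_rotMem hc).mp (hA.lie hP))
    exact ⟨by linarith, by linarith, 0, by linarith, by linarith, by linarith⟩
  · have hz : ∀ {a₁ a₂ a₃ a₄ z₁ z₂ z₃ z₄ c}, Mem φ h a₁ a₂ a₃ a₄ z₁ z₂ z₃ z₄ c →
        z₁ = 0 ∧ z₂ = 0 ∧ z₃ = 0 ∧ z₄ = 0 := by
      intro a₁ a₂ a₃ a₄ z₁ z₂ z₃ z₄ c hm
      obtain ⟨h1, h2⟩ := RotMem.first_eq_zero hc hX hno ((mem_iff_rotMem hc).mp hm)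
      obtain ⟨h3, h4⟩ := RotMem.second_eq_zero hc hX hP ((mem_iff_rotMem hc).mp hm)
      exact ⟨by linarith, by linarith, by linarith, by linarith⟩
    have := G.linForm_eq_zero ![0, 0, 1, 0, 0, 0, 0, 0, 0] (fun p₀ p₁ p₂ p₃ p₄ q₀ q₁ q₂ q₃ q₄
      s₀ s₁ s₂ s₃ s₄ s₅ s₆ r₁ r₂ r₃ r₄ v₁ v₂ v₃ v₄ w C => by
        obtain ⟨rfl, rfl, rfl, rfl⟩ := hz C.m17
        obtain ⟨-, -, rfl, -⟩ := hz C.m37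
        obtain ⟨-, h2, -, -⟩ := hz C.m36
        obtain rfl : r₃ = 0 := by linarith
        simp [linForm]) hX
    simp [linForm] at this

/-- The linear part must preserve the plane of weight 1, and only conformal matrices do. -/
theorem conformal_of_not_second (hc : Mem φ h 0 0 0 0 0 0 0 0 1)
    (hX : Mem φ h r (-1) 1 r 0 0 0 0 0) (h1 : RotMem φ h 0 0 0 0 1 0 0 0)
    (h2 : ¬RotMem φ h 0 0 0 0 0 0 1 0) (hA : Mem φ h a₁ a₂ a₃ a₄ 0 0 0 0 0) :
    a₄ = a₁ ∧ a₃ = -a₂ := by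
  obtain ⟨h3, h4⟩ := RotMem.second_eq_zero hc hX h2 ((mem_iff_rotMem hc).mp (hA.lie h1))
  exact ⟨by linarith, by linarith⟩

theorem line_rotation_iff : !![a₁, a₂; a₃, a₄] ∈ line (Ca r) ↔
    a₁ = a₃ * r ∧ a₂ = -a₃ ∧ a₄ = a₃ * r := by
  have hs : ∀ t : ℝ, t • Ca r = !![t * r, -t; t, t * r] := by
    intro t
    ext i j
    fin_cases i <;> fin_cases j <;> simp [Ca]
  constructor
  · rintro ⟨t, ht⟩
    rw [hs, matrix_eq_iff] at ht
    obtain ⟨rfl, rfl, rfl, rfl⟩ := ht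
    exact ⟨rfl, rfl, rfl⟩
  · rintro ⟨rfl, rfl, rfl⟩
    exact ⟨a₃, by rw [hs]⟩

theorem mem_u1_iff : !![a₁, a₂; a₃, a₄] ∈ u1 ↔ a₂ = -a₃ ∧ a₄ = a₁ := by
  constructor
  · rintro ⟨a, b, hab⟩
    obtain ⟨rfl, rfl, rfl, rfl⟩ := matrix_eq_iff.mp hab
    exact ⟨rfl, rfl⟩
  · rintro ⟨rfl, rfl⟩
    exact ⟨_, _, rfl⟩

theorem mem_sl2_iff : !![a₁, a₂; a₃, a₄] ∈ sl2 ↔ a₁ + a₄ = 0 := by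
  simp [sl2, Matrix.trace_fin_two]

/-- The linear part of an algebra with a rotation. -/
theorem linear_part_cases (hX : Mem φ h r (-1) 1 r 0 0 0 0 0) :
    (∃ a, (a = u1 ∨ ∃ r, a = line (Ca r)) ∧
      ∀ a₁ a₂ a₃ a₄, Mem φ h a₁ a₂ a₃ a₄ 0 0 0 0 0 ↔ !![a₁, a₂; a₃, a₄] ∈ a) ∨
    (∃ a, (a = sl2 ∨ a = Set.univ) ∧
      ∀ a₁ a₂ a₃ a₄, Mem φ h a₁ a₂ a₃ a₄ 0 0 0 0 0 ↔ !![a₁, a₂; a₃, a₄] ∈ a) := by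
  by_cases hu : ∀ a₁ a₂ a₃ a₄, Mem φ h a₁ a₂ a₃ a₄ 0 0 0 0 0 → a₂ = -a₃ ∧ a₄ = a₁
  · left
    by_cases hI : Mem φ h 1 0 0 1 0 0 0 0 0
    · refine ⟨u1, .inl rfl, fun a₁ a₂ a₃ a₄ => ?_⟩
      rw [mem_u1_iff]
      refine ⟨hu _ _ _ _, ?_⟩
      rintro ⟨rfl, rfl⟩
      exact ((hX.smul a₃).add (hI.smul (a₄ - a₃ * r))).congr (by ring) (by ring) (by ring)
        (by ring) (by ring) (by ring) (by ring) (by ring) (by ring)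
    · refine ⟨line (Ca r), .inr ⟨r, rfl⟩, fun a₁ a₂ a₃ a₄ => ?_⟩
      rw [line_rotation_iff]
      constructor
      · intro hA
        obtain ⟨rfl, rfl⟩ := hu _ _ _ _ hA
        have : a₄ = a₃ * r := by
          by_contra hne
          have h0 : a₄ - a₃ * r ≠ 0 := sub_ne_zero.mpr hne
          refine hI (((hA.sub (hX.smul a₃)).smul (a₄ - a₃ * r)⁻¹).congr ?_ (by ring) (by ring) ?_
            (by ring) (by ring) (by ring) (by ring) (by ring)) <;> rw [inv_mul_cancel₀ h0]
        exact ⟨this, rfl, this⟩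
      · rintro ⟨rfl, rfl, rfl⟩
        exact (hX.smul a₃).congr (by ring) (by ring) (by ring) (by ring) (by ring) (by ring)
          (by ring) (by ring) (by ring)
  · right
    push Not at hu
    obtain ⟨b₁, b₂, b₃, b₄, hB, hne⟩ := hu
    have hpos : (b₁ - b₄) ^ 2 + (b₂ + b₃) ^ 2 ≠ 0 := fun h0 => by
      obtain ⟨e1, e2⟩ := eq_zero_of_add_sq_eq_zero h0
      exact hne (by linarith) (by linarith)
    -- A non-conformal B has a non-zero traceless symmetric part. Its rotations span all such
    -- matrices, and their brackets supply the skew ones, so 𝔰𝔩(2,ℝ) lies in 𝔞.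
    have hB₁ : Mem φ h (-(b₂ + b₃)) (b₁ - b₄) (b₁ - b₄) (b₂ + b₃) 0 0 0 0 0 :=
      (hX.lie hB).congr (by ring) (by ring) (by ring) (by ring) (by ring) (by ring) (by ring)
        (by ring) (by ring)
    have hB₂ : Mem φ h (b₁ - b₄) (b₂ + b₃) (b₂ + b₃) (-(b₁ - b₄)) 0 0 0 0 0 :=
      ((hX.lie hB₁).smul (-1 / 2)).congr (by ring) (by ring) (by ring) (by ring) (by ring)
        (by ring) (by ring) (by ring) (by ring)
    have sym : ∀ x y : ℝ, Mem φ h x y y (-x) 0 0 0 0 0 := by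
      intro x y
      refine (((hB₂.smul (x * (b₁ - b₄) + y * (b₂ + b₃))).add
        (hB₁.smul (y * (b₁ - b₄) - x * (b₂ + b₃)))).smul
        ((b₁ - b₄) ^ 2 + (b₂ + b₃) ^ 2)⁻¹).congr ?_ ?_ ?_ ?_ (by ring) (by ring) (by ring)
        (by ring) (by ring) <;> rw [eq_comm, inv_mul_eq_iff_eq_mul₀ hpos] <;> ring
    have hsl : ∀ x y w : ℝ, Mem φ h x y w (-x) 0 0 0 0 0 := fun x y w =>
      ((sym x ((y + w) / 2)).add (((sym 1 0).lie (sym 0 1)).smul ((y - w) / 4))).congr (by ring)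
        (by ring) (by ring) (by ring) (by ring) (by ring) (by ring) (by ring) (by ring)
    by_cases hI : Mem φ h 1 0 0 1 0 0 0 0 0
    · refine ⟨Set.univ, .inr rfl, fun a₁ a₂ a₃ a₄ => iff_of_true ?_ trivial⟩
      exact ((hsl ((a₁ - a₄) / 2) a₂ a₃).add (hI.smul ((a₁ + a₄) / 2))).congr (by ring) (by ring)
        (by ring) (by ring) (by ring) (by ring) (by ring) (by ring) (by ring)
    · refine ⟨sl2, .inl rfl, fun a₁ a₂ a₃ a₄ => ?_⟩
      rw [mem_sl2_iff]
      constructor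
      · intro hA
        by_contra hne
        refine hI (((hA.sub (hsl ((a₁ - a₄) / 2) a₂ a₃)).smul ((a₁ + a₄) / 2)⁻¹).congr ?_
          (by ring) (by ring) ?_ (by ring) (by ring) (by ring) (by ring) (by ring)) <;>
        field_simp <;> ring
      · intro h0
        obtain rfl : a₄ = -a₁ := by linarith
        exact hsl _ _ _

end

theorem Good.classified_of_pure_rotation (G : Good e h φ) {r : ℝ}
    (hX : Mem φ h r (-1) 1 r 0 0 0 0 0) : Classified e h := by
  have hc := G.center_of_hasRotation ⟨r, _, _, _, _, _, hX⟩
  have hP₁ := G.first_component hc hX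
  have hiff := fun a₁ a₂ a₃ a₄ p q s t => RotMem.iff_components hc hX a₁ a₂ a₃ a₄ p q s t
  by_cases hP₃ : RotMem φ h 0 0 0 0 0 0 1 0
  · have hmem : ∀ {a : Set (Matrix (Fin 2) (Fin 2) ℝ)},
        (∀ a₁ a₂ a₃ a₄, Mem φ h a₁ a₂ a₃ a₄ 0 0 0 0 0 ↔ !![a₁, a₂; a₃, a₄] ∈ a) →
        glProjection (frameBasis φ) h = a ∧
          (h : Set (Module.End ℝ V)) = semi (frameBasis φ) a Set.univ := fun ha =>
      G.eq_semi Set.univ_nonempty fun a₁ a₂ a₃ a₄ z₁ z₂ z₃ z₄ c => by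
        rw [mem_iff_rotMem hc, hiff, ha]
        simp [hP₁, hP₃]
    rcases linear_part_cases hX with ⟨a, ha, hA⟩ | ⟨a, ha, hA⟩
    · obtain ⟨k1, k2⟩ := hmem hA
      exact ⟨φ, G, .case2 (by rwa [k1]) (.inl (by rwa [k1]))⟩
    · obtain ⟨k1, k2⟩ := hmem hA
      exact ⟨φ, G, .case1 (by rwa [k1]) (by rwa [k1])⟩
  · have hmem : ∀ {a : Set (Matrix (Fin 2) (Fin 2) ℝ)},
        (∀ a₁ a₂ a₃ a₄, Mem φ h a₁ a₂ a₃ a₄ 0 0 0 0 0 ↔ !![a₁, a₂; a₃, a₄] ∈ a) →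
        glProjection (frameBasis φ) h = a ∧ (h : Set (Module.End ℝ V)) =
          semi (frameBasis φ) a {z | ∃ r s : ℝ, z = ![3 * r, s, r, 3 * s]} := fun ha =>
      G.eq_semi ⟨_, 0, 0, rfl⟩ fun a₁ a₂ a₃ a₄ z₁ z₂ z₃ z₄ c => by
        rw [mem_iff_rotMem hc, hiff, ha]
        refine and_congr_right fun _ => ⟨fun ⟨_, H⟩ => ?_,
          fun ⟨r, s, hz⟩ => ⟨fun H => (H hP₁).elim, fun _ => ?_⟩⟩
        · obtain ⟨e1, e2⟩ := H hP₃
          obtain rfl : z₁ = 3 * z₃ := by linarith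
          obtain rfl : z₄ = 3 * z₂ := by linarith
          exact ⟨_, _, rfl⟩
        · have e0 := congrFun hz 0
          have e1 := congrFun hz 1
          have e2 := congrFun hz 2
          have e3 := congrFun hz 3
          simp at e0 e1 e2 e3
          exact ⟨by linarith, by linarith⟩
    rcases linear_part_cases hX with ⟨a, ha, hA⟩ | ⟨a, ha, hA⟩
    · obtain ⟨k1, k2⟩ := hmem hA
      exact ⟨φ, G, .case2 (by rwa [k1]) (.inr (by rwa [k1]))⟩
    -- The matrix diag(1, -1) is not conformal, so 𝔰𝔩(2,ℝ) and 𝔤𝔩(2,ℝ) cannot occur without the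
    -- plane of weight 3.
    · have h1 : Mem φ h 1 0 0 (-1) 0 0 0 0 0 := by
        rw [hA]
        rcases ha with rfl | rfl
        · simp [mem_sl2_iff]
        · trivial
      have := (conformal_of_not_second hc hX hP₁ hP₃ h1).1
      norm_num at this

theorem Good.classified (G : Good e h φ) : Classified e h := by
  obtain ⟨ψ, G', hT | hR⟩ := G.triangular_or_rotation
  · exact G'.classified_of_isTriangular hT
  · obtain ⟨χ, r, G'', hX⟩ := G'.exists_pure_rotation hR
    exact G''.classified_of_pure_rotation hX

end SplitG2

theorem theorem2 {V : Type*} [AddCommGroup V] [Module ℝ V] (e : Module.Basis (Fin 7) ℝ V)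
    (h : LieSubalgebra ℝ (Module.End ℝ V)) (hg : h ≤ SplitG2.g2star e)
    (hind : SplitG2.IsIndecomposable (SplitG2.metric0 e) h) (hberger : SplitG2.IsBerger h)
    (htype : SplitG2.IsTypeII h) :
    ∃ b : Module.Basis (Fin 7) ℝ V,
      SplitG2.metric0 e = SplitG2.metricII b ∧ SplitG2.omega0 e = SplitG2.omegaII b ∧
      (h : Set (Module.End ℝ V)) ⊆ SplitG2.p2 b ∧
      SplitG2.InList b (SplitG2.glProjection b h) (h : Set (Module.End ℝ V)) := by
  obtain ⟨φ, hφ⟩ := SplitG2.exists_adapted_frame hg hind htype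
  obtain ⟨ψ, G, hlist⟩ := (SplitG2.Good.mk hφ hg hberger htype).classified
  exact ⟨SplitG2.frameBasis ψ, SplitG2.frameBasis_metric G.frame, SplitG2.frameBasis_form G.frame,
    fun _ hX => G.exists_hElem hX, hlist⟩
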